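/- For $g\in L^p(\mathbb R)$ with $1\le p\le 2$ let $\hat g$ denote its Fourier transform in the sense of tempered distributions (a function), normalised so that $\hat g(\xi)=\int_{\mathbb R} g(x)e^{-ix\xi}\,dx$ for $g\in L^1(\mathbb R)$. For $a>0$, $\gamma>1$, $t>0$ put $$P^t_{a,\gamma}f(x)=\frac1{2\pi}\int_{\mathbb R}\hat f(\xi)\,e^{ix\xi}\,e^{it|\xi|^a}\,e^{-t^\gamma|\xi|^a}\,d\xi .$$ For $s>0$ and $1<p<\infty$ write $s=m+\tau$ with $m\ge 0$ an integer and $0\le\tau<1$. The space $W^{s,p}(\mathbb R)$ consists of all complex-valued $u\in L^p(\mathbb R)$ whose distributional derivatives $D^k u$, $1\le k\le m$, are in $L^p(\mathbb R)$ and which, if $\tau>0$, satisfy in addition $$\iint_{\mathbb R\times\mathbb R}\frac{|D^m u(x)-D^m u(y)|^p}{|x-y|^{\tau p+1}}\,dx\,dy<\infty$$ (with $D^0u=u$). **Theorem.** Let $s>0$, $\gamma>1$, $1<p\le 2$ and $a>0$, and assume that - $s>\frac{2-p}{2p}+\frac a4\bigl(1-\frac1\gamma\bigr)$ if $0<a<1$;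 - $s>\frac1p-\frac1{2\gamma}$ if $a=1$; - $s>\frac{2-p}{2p}+\min\bigl\{\frac a4\bigl(1-\frac1\gamma\bigr),\frac14\bigr\}$ if $a>1$. Then for every $f\in W^{s,p}(\mathbb R)$ the Fourier transform $\hat f$ is a function, the integral defining $P^t_{a,\gamma}f(x)$ converges absolutely for all $t>0$ and $x\in\mathbb R$, and $$\lim_{t\to0^+}P^t_{a,\gamma}f(x)=f(x)\qquad\text{for almost every }x\in\mathbb R .$$ -/

import Mathlib

open MeasureTheory Filter Topology
open scoped SchwartzMap ENNReal

noncomputable section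

namespace LandauSchrodinger

/-- The classical Fourier integral `∫ e^{-i x ξ} φ(x) dx`
(the normalisation without `2π` in the exponent). -/
def fourierIntegral (φ : ℝ → ℂ) (ξ : ℝ) : ℂ :=
  ∫ x : ℝ, Complex.exp (-(Complex.I * x * ξ)) * φ x

/-- The function `g` is the Fourier transform of `f` in the sense of tempered distributions:
`g` pairs absolutely with every Schwartz function, and `⟨g, φ⟩ = ⟨f, φ̂⟩` for all Schwartz `φ`.
It is meant for `f` in some `L^p`, where the right-hand pairing converges absolutely.
Such a `g` is unique up to a null set. -/
def IsFourierTransform (f g : ℝ → ℂ) : Prop :=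
  (∀ φ : 𝓢(ℝ, ℂ), Integrable (fun ξ : ℝ => g ξ * φ ξ)) ∧
    ∀ φ : 𝓢(ℝ, ℂ), ∫ ξ : ℝ, g ξ * φ ξ = ∫ x : ℝ, f x * fourierIntegral (fun ξ => φ ξ) x

open Classical in
/-- The Fourier transform `f̂` as a function, for `f` whose distributional Fourier transform is
a function (this covers every `f ∈ L^p`, `1 ≤ p ≤ 2`); the value is `0` for all other `f`. -/
def fourierHat (f : ℝ → ℂ) : ℝ → ℂ :=
  if h : ∃ g, IsFourierTransform f g then h.choose else 0

/-- The integrand `f̂(ξ) e^{ixξ} e^{it|ξ|^a} e^{-t^γ |ξ|^a}`. -/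
def landauIntegrand (a γ : ℝ) (f : ℝ → ℂ) (t x ξ : ℝ) : ℂ :=
  fourierHat f ξ * Complex.exp (Complex.I * x * ξ)
    * Complex.exp (Complex.I * t * ((|ξ| ^ a : ℝ) : ℂ))
    * Complex.exp (-((t ^ γ * |ξ| ^ a : ℝ) : ℂ))

/-- The Landau type Schrödinger operator
`P^t_{a,γ} f(x) = (2π)⁻¹ ∫ f̂(ξ) e^{ixξ} e^{it|ξ|^a} e^{-t^γ |ξ|^a} dξ`, used for `t > 0`. -/
def landauOp (a γ t : ℝ) (f : ℝ → ℂ) (x : ℝ) : ℂ :=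
  (1 / (2 * Real.pi : ℂ)) * ∫ ξ : ℝ, landauIntegrand a γ f t x ξ

/-- `v` is the `k`-th distributional derivative of `u` on `ℝ`
(both being locally integrable functions). -/
def IsWeakDeriv (k : ℕ) (u v : ℝ → ℂ) : Prop :=
  LocallyIntegrable u ∧ LocallyIntegrable v ∧
    ∀ φ : ℝ → ℝ, ContDiff ℝ (⊤ : ℕ∞) φ → HasCompactSupport φ →
      ∫ x : ℝ, iteratedDeriv k φ x • u x = (-1 : ℂ) ^ k * ∫ x : ℝ, φ x • v x

/-- `∬ |u(x) - u(y)|^p / |x - y|^{τp+1} dx dy`, as an extended non-negative number. -/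
def gagliardo (τ p : ℝ) (u : ℝ → ℂ) : ℝ≥0∞ :=
  ∫⁻ x : ℝ, ∫⁻ y : ℝ, ENNReal.ofReal (‖u x - u y‖ ^ p / |x - y| ^ (τ * p + 1))

/-- Membership in the fractional Sobolev (Sobolev–Slobodeckij) space `W^{s,p}(ℝ)`, `s > 0`.
Write `s = m + τ` with `m = ⌊s⌋` and `τ ∈ [0,1)`. The distributional derivatives of order
`0, …, m` are functions in `L^p`, and if `τ ≠ 0` then the derivative of order `m` (which is `u`
itself when `m = 0`) has finite Gagliardo seminorm of order `τ`. -/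
def MemW (s p : ℝ) (u : ℝ → ℂ) : Prop :=
  ∃ D : ℕ → ℝ → ℂ, D 0 = u ∧
    (∀ k ≤ ⌊s⌋₊, IsWeakDeriv k u (D k) ∧ MemLp (D k) (ENNReal.ofReal p) volume) ∧
    (Int.fract s ≠ 0 → gagliardo (Int.fract s) p (D ⌊s⌋₊) < ⊤)

end LandauSchrodinger

end

noncomputable section

namespace LandauSchrodinger

open FourierTransform Real ComplexConjugate

/-! Write `d = (2-p)/(2p) = 1/p - 1/2`. The proof trades `d` derivatives for a passage from `L^p` to
`L²`, proves an `L²` maximal estimate on dyadic frequency annuli, and sums.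

From `L^p` to `L²`. Choose `b` with `b < s` and `b < 1`. A function in `W^{s,p}` has, up to a null
set, an averaged `L^p` modulus of smoothness of some order `σ > b` (`MemW.exists_averagedModulus`).
Averaging over an interval of length `h` maps `L^p` to `L²` with norm at most `h^(-d)`
(`eLpNorm_two_avg_le`). Hence such a function lies in `L²` if `σ > d`
(`memLp_two_of_averagedModulus`), and the average of `u - avg h u` has `L²` norm `O(h^(σ-d))`. On
the Fourier side this operation is a multiplier bounded below where `3 ≤ |hξ| ≤ 6`, so Plancherel
gives `∫ |f̂|² = O(l^(-2(σ-d)))` over `l ≤ |ξ| ≤ 2l` (`exists_band_bound`).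

Maximal estimate. For frequencies in `l ≤ |ξ| < 2l`, `l ≥ 1`, the supremum over `t > 0` is bounded
from `L²` to `L²` of unit intervals with norm `O(l^ρ)`, for every `ρ` above the threshold
(`exists_maximal_bound`). Linearising the supremum by a measurable time `t(x)`, the `T T*` argument
and Schur's test reduce this to the bound `l^(2ρ)|r|^(-1+η)` for an oscillatory integral with phase
`rξ + τξ^a` and damping `e^(-qξ^a)`, where `r = ±(x-y)`, `τ = t(x)-t(y)` and `q = t(x)^γ + t(y)^γ ≥
|τ|^γ` (`exists_kernel_bound`). If the linear term dominates `φ'`, the first derivative test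
applies. Otherwise `|τ| l^(a-1) ≳ |r|`: then van der Corput gives `(l/|r|)^(1/2)` if `a ≠ 1`, and a
large `|τ|` also forces a large damping, which exchanges powers of `l` for powers of `1/|r|`. This
balance produces the thresholds.

Conclusion. With `r < ρ < σ - d`, where `r` is the critical value from `exists_threshold`, the
maximal functions of the annuli have geometrically decaying local `L²` norms, so they are summable
almost everywhere. Dominated convergence for series then gives a limit as `t → 0+`, equal to the
limit of the truncated inverse Fourier integrals. A subsequence of these converges almost everywhere
to `f` by `L²` inversion, so the limit is `f(x)`. -/

/-! ### The Fourier transform on `L²`: normalisation, uniqueness, Plancherel, inversion. -/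

lemma fourierIntegral_eq_fourier (φ : ℝ → ℂ) (ξ : ℝ) :
    fourierIntegral φ ξ = 𝓕 φ (ξ / (2 * π)) := by
  rw [Real.fourier_real_eq_integral_exp_smul, fourierIntegral]
  congr 1; ext x
  rw [smul_eq_mul]; congr 2
  push_cast
  have : (π : ℂ) ≠ 0 := by exact_mod_cast pi_ne_zero
  field_simp

lemma eLpNorm_two_sq (f : ℝ → ℂ) (μ : Measure ℝ) : eLpNorm f 2 μ ^ 2 = ∫⁻ x, ‖f x‖ₑ ^ 2 ∂μ := by
  rw [eLpNorm_eq_lintegral_rpow_enorm_toReal (by norm_num) (by norm_num)]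
  simp only [ENNReal.toReal_ofNat, one_div]
  rw [← ENNReal.rpow_natCast, ← ENNReal.rpow_mul]
  norm_num

lemma integrable_mul_schwartz {f : ℝ → ℂ} (hf : MemLp f 2) (φ : 𝓢(ℝ, ℂ)) :
    Integrable (fun x => f x * φ x) :=
  hf.integrable_mul (φ.memLp 2)

/-- Dilation of a Schwartz function. -/
def dilate (c : ℝ) (hc : c ≠ 0) (φ : 𝓢(ℝ, ℂ)) : 𝓢(ℝ, ℂ) :=
  SchwartzMap.compCLMOfContinuousLinearEquiv ℂ
    (ContinuousLinearEquiv.smulLeft (Units.mk0 c hc) : ℝ ≃L[ℝ] ℝ) φ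

@[simp] lemma dilate_apply (c : ℝ) (hc : c ≠ 0) (φ : 𝓢(ℝ, ℂ)) (x : ℝ) :
    dilate c hc φ x = φ (c * x) := rfl

/-- The Fourier transform without `2π` in the exponent, as a Schwartz function. -/
def schwartzFourier (φ : 𝓢(ℝ, ℂ)) : 𝓢(ℝ, ℂ) :=
  dilate (2 * π)⁻¹ (by positivity) (𝓕 φ)

lemma schwartzFourier_apply (φ : 𝓢(ℝ, ℂ)) (x : ℝ) :
    schwartzFourier φ x = fourierIntegral (fun ξ => φ ξ) x := by
  rw [fourierIntegral_eq_fourier, schwartzFourier, dilate_apply, SchwartzMap.fourier_coe]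
  field_simp

/-- Moving the dilation inside the transform allows the distributional identity for `𝓕` to be tested
on a dilate of `φ`; the factor `2π` is the Jacobian. -/
lemma schwartzFourier_eq_fourier_dilate (φ : 𝓢(ℝ, ℂ)) (x : ℝ) :
    schwartzFourier φ x = 2 * π * 𝓕 (dilate (2 * π) (by positivity) φ) x := by
  rw [schwartzFourier_apply, fourierIntegral, SchwartzMap.fourier_coe,
    Real.fourier_real_eq_integral_exp_smul]
  have := Measure.integral_comp_mul_left
    (fun y : ℝ => Complex.exp (-(Complex.I * y * x)) * φ y) (2 * π)
  rw [abs_of_pos (by positivity)] at this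
  rw [show (2 * π : ℂ) = ((2 * π : ℝ) : ℂ) by push_cast; rfl, ← Complex.real_smul,
    ← inv_smul_eq_iff₀ (by positivity), ← this]
  congr 1; ext y
  rw [smul_eq_mul, dilate_apply]
  congr 2
  push_cast; ring

/-- The Fourier transform of an `L²` function in the normalisation without `2π`. -/
def planchTransform (f : Lp ℂ 2 (volume : Measure ℝ)) (ξ : ℝ) : ℂ :=
  (𝓕 f : Lp ℂ 2 (volume : Measure ℝ)) ((2 * π)⁻¹ * ξ)

lemma lintegral_comp_mul (f : ℝ → ℝ≥0∞) {c : ℝ} (hc : c ≠ 0) :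
    ∫⁻ x, f (c * x) = ENNReal.ofReal |c⁻¹| * ∫⁻ x, f x := by
  have h := (Homeomorph.mulLeft₀ c hc).measurableEmbedding.lintegral_map (μ := volume) f
  simp only [Homeomorph.coe_mulLeft₀] at h
  rw [← h, Real.map_volume_mul_left hc, lintegral_smul_measure, smul_eq_mul]

lemma memLp_comp_mul {f : ℝ → ℂ} {p : ℝ≥0∞} (hf : MemLp f p) (hp0 : p ≠ 0) (hp : p ≠ ⊤) {c : ℝ}
    (hc : c ≠ 0) : MemLp (fun x => f (c * x)) p := by
  have hq : Measure.QuasiMeasurePreserving (fun x : ℝ => c * x) :=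
    ⟨by fun_prop, by
      rw [Real.map_volume_mul_left hc]; exact Measure.smul_absolutelyContinuous⟩
  refine ⟨hf.1.comp_quasiMeasurePreserving hq, ?_⟩
  have h := hf.2
  rw [eLpNorm_lt_top_iff_lintegral_rpow_enorm_lt_top hp0 hp] at h ⊢
  rw [lintegral_comp_mul (fun x => ‖f x‖ₑ ^ p.toReal) hc]
  exact ENNReal.mul_lt_top ENNReal.ofReal_lt_top h

lemma memLp_planchTransform (f : Lp ℂ 2 (volume : Measure ℝ)) : MemLp (planchTransform f) 2 :=
  memLp_comp_mul (Lp.memLp _) (by norm_num) (by norm_num) (by positivity)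

lemma isFourierTransform_planchTransform (f : Lp ℂ 2 (volume : Measure ℝ)) :
    IsFourierTransform f (planchTransform f) := by
  refine ⟨fun φ => integrable_mul_schwartz (memLp_planchTransform f) φ, fun φ => ?_⟩
  have h := congrArg (fun T => T (dilate (2 * π) (by positivity) φ))
    (Lp.fourier_toTemperedDistribution_eq f)
  simp only [TemperedDistribution.fourier_apply, Lp.toTemperedDistribution_apply] at h
  have h2 := Measure.integral_comp_mul_left
    (fun y : ℝ => planchTransform f y * φ y) (2 * π)
  rw [abs_of_pos (by positivity)] at h2
  have h3 : ∫ y, planchTransform f y * φ y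
      = (2 * π : ℝ) • ∫ x, planchTransform f (2 * π * x) * φ (2 * π * x) := by
    rw [h2, smul_smul, mul_inv_cancel₀ (by positivity), one_smul]
  have h4 : ∀ x, planchTransform f (2 * π * x) * φ (2 * π * x)
      = dilate (2 * π) (by positivity) φ x • (𝓕 f : Lp ℂ 2 (volume : Measure ℝ)) x := by
    intro x
    rw [dilate_apply, smul_eq_mul, mul_comm, planchTransform]
    congr 2; field_simp
  simp_rw [h4] at h3
  rw [h3, ← h, ← integral_smul]
  congr 1; ext x
  rw [← schwartzFourier_apply, schwartzFourier_eq_fourier_dilate, Complex.real_smul, smul_eq_mul]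
  push_cast; ring

/-- A compactly supported smooth real function as a complex Schwartz function. -/
def testFunction (b : ℝ → ℝ) (h1 : ContDiff ℝ (⊤ : ℕ∞) b) (h2 : HasCompactSupport b) : 𝓢(ℝ, ℂ) :=
  HasCompactSupport.toSchwartzMap (f := fun x => (b x : ℂ))
    (h2.comp_left (g := fun r : ℝ => (r : ℂ)) (by simp)) (Complex.ofRealCLM.contDiff.comp h1)

@[simp] lemma testFunction_apply (b : ℝ → ℝ) (h1 : ContDiff ℝ (⊤ : ℕ∞) b)
    (h2 : HasCompactSupport b) (x : ℝ) : testFunction b h1 h2 x = b x := rfl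

/-- Test against a smooth bump equal to `1` on the given compact set. -/
lemma locallyIntegrable_of_forall_schwartz {g : ℝ → ℂ}
    (h : ∀ φ : 𝓢(ℝ, ℂ), Integrable (fun ξ : ℝ => g ξ * φ ξ)) : LocallyIntegrable g := by
  rw [locallyIntegrable_iff]
  intro K hK
  obtain ⟨R, hR⟩ := hK.isBounded.subset_closedBall 0
  let b : ContDiffBump (0 : ℝ) := ⟨|R| + 1, |R| + 2, by positivity, by linarith⟩
  have hi := (h (testFunction b b.contDiff b.hasCompactSupport)).integrableOn (s := K)
  refine hi.congr_fun_ae ?_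
  filter_upwards [ae_restrict_mem hK.measurableSet] with x hx
  rw [testFunction_apply, b.one_of_mem_closedBall]
  · simp
  · exact (Metric.closedBall_subset_closedBall (by linarith [le_abs_self R])) (hR hx)

lemma ae_eq_of_forall_schwartz {g g' : ℝ → ℂ}
    (h : ∀ φ : 𝓢(ℝ, ℂ), Integrable (fun ξ : ℝ => g ξ * φ ξ))
    (h' : ∀ φ : 𝓢(ℝ, ℂ), Integrable (fun ξ : ℝ => g' ξ * φ ξ))
    (heq : ∀ φ : 𝓢(ℝ, ℂ), ∫ ξ, g ξ * φ ξ = ∫ ξ, g' ξ * φ ξ) : g =ᵐ[volume] g' := by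
  refine ae_eq_of_integral_contDiff_smul_eq (locallyIntegrable_of_forall_schwartz h)
    (locallyIntegrable_of_forall_schwartz h') fun b hb1 hb2 => ?_
  have := heq (testFunction b hb1 hb2)
  simp only [testFunction_apply] at this
  simpa only [Complex.real_smul, mul_comm] using this

/-- `fourierHat` is an arbitrary choice, so what is known about the `L²` transform reaches it only
through this uniqueness. -/
lemma IsFourierTransform.ae_eq {f g g' : ℝ → ℂ} (h : IsFourierTransform f g)
    (h' : IsFourierTransform f g') : g =ᵐ[volume] g' :=
  ae_eq_of_forall_schwartz h.1 h'.1 fun φ => by rw [h.2, h'.2]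

lemma IsFourierTransform.congr_left {f f' g : ℝ → ℂ} (h : IsFourierTransform f g)
    (hf : f =ᵐ[volume] f') : IsFourierTransform f' g := by
  refine ⟨h.1, fun φ => ?_⟩
  rw [h.2]
  refine integral_congr_ae ?_
  filter_upwards [hf] with x hx
  rw [hx]

lemma IsFourierTransform.sub {f g f' g' : ℝ → ℂ} (hf : MemLp f 2) (hf' : MemLp f' 2)
    (h : IsFourierTransform f g) (h' : IsFourierTransform f' g') :
    IsFourierTransform (f - f') (g - g') := by
  refine ⟨fun φ => ?_, fun φ => ?_⟩
  · simp only [Pi.sub_apply, sub_mul]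
    exact (h.1 φ).sub (h'.1 φ)
  · have h1 := integrable_mul_schwartz hf (schwartzFourier φ)
    have h2 := integrable_mul_schwartz hf' (schwartzFourier φ)
    simp only [schwartzFourier_apply] at h1 h2
    simp only [Pi.sub_apply, sub_mul]
    rw [integral_sub (h.1 φ) (h'.1 φ), integral_sub h1 h2, h.2, h'.2]

lemma isFourierTransform_planchTransform_toLp {f : ℝ → ℂ} (hf : MemLp f 2) :
    IsFourierTransform f (planchTransform (hf.toLp f)) :=
  (isFourierTransform_planchTransform (hf.toLp f)).congr_left hf.coeFn_toLp

lemma isFourierTransform_fourierHat {f : ℝ → ℂ} (hf : MemLp f 2) :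
    IsFourierTransform f (fourierHat f) := by
  have h : ∃ g, IsFourierTransform f g := ⟨_, isFourierTransform_planchTransform_toLp hf⟩
  rw [fourierHat, dif_pos h]
  exact h.choose_spec

lemma IsFourierTransform.ae_eq_planchTransform {f g : ℝ → ℂ} (hf : MemLp f 2)
    (h : IsFourierTransform f g) : g =ᵐ[volume] planchTransform (hf.toLp f) :=
  h.ae_eq (isFourierTransform_planchTransform_toLp hf)

lemma IsFourierTransform.memLp {f g : ℝ → ℂ} (hf : MemLp f 2)
    (h : IsFourierTransform f g) : MemLp g 2 :=
  (memLp_planchTransform _).ae_eq (h.ae_eq_planchTransform hf).symm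

/-- Plancherel's identity. -/
lemma IsFourierTransform.lintegral_sq {f g : ℝ → ℂ} (hf : MemLp f 2)
    (h : IsFourierTransform f g) :
    ∫⁻ ξ, ‖g ξ‖ₑ ^ 2 = ENNReal.ofReal (2 * π) * ∫⁻ x, ‖f x‖ₑ ^ 2 := by
  have h1 : ∫⁻ ξ, ‖g ξ‖ₑ ^ 2 = ∫⁻ ξ, ‖planchTransform (hf.toLp f) ξ‖ₑ ^ 2 := by
    refine lintegral_congr_ae ?_
    filter_upwards [h.ae_eq_planchTransform hf] with x hx
    rw [hx]
  rw [h1]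
  simp only [planchTransform]
  rw [lintegral_comp_mul (fun x => ‖(𝓕 (hf.toLp f) : Lp ℂ 2 (volume : Measure ℝ)) x‖ₑ ^ 2)
    (by positivity), ← eLpNorm_two_sq, ← eLpNorm_two_sq, inv_inv, abs_of_pos (by positivity)]
  congr 2
  have h2 := Lp.norm_fourier_eq (hf.toLp f)
  rw [Lp.norm_def, Lp.norm_def, ENNReal.toReal_eq_toReal_iff' (Lp.eLpNorm_ne_top _)
    (Lp.eLpNorm_ne_top _)] at h2
  rw [h2]
  exact eLpNorm_congr_ae hf.coeFn_toLp

/-- Both sides have the same pairing with every Schwartz function: on the left by the distributional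
definition, on the right because the Fourier integral can be moved to the other factor. This makes
the abstract `L²` inverse computable on truncated functions. -/
lemma fourierInv_toLp_ae {ψ : ℝ → ℂ} (h1 : Integrable ψ) (h2 : MemLp ψ 2) :
    ((𝓕⁻ (h2.toLp ψ) : Lp ℂ 2 (volume : Measure ℝ)) : ℝ → ℂ) =ᵐ[volume] 𝓕⁻ ψ := by
  have hc : Continuous (𝓕⁻ ψ) := 
    VectorFourier.fourierIntegral_continuous Real.continuous_fourierChar
      (L := -innerₗ ℝ) (by simp; fun_prop) h1
  have hb : ∀ x, ‖𝓕⁻ ψ x‖ ≤ ∫ y, ‖ψ y‖ := fun x =>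
    VectorFourier.norm_fourierIntegral_le_integral_norm _ _ _ _ _
  refine ae_eq_of_forall_schwartz (fun φ => integrable_mul_schwartz (Lp.memLp _) φ)
    (fun φ => φ.integrable.bdd_mul hc.aestronglyMeasurable (ae_of_all _ hb)) fun φ => ?_
  have h := congrArg (fun T => T φ) (Lp.fourierInv_toTemperedDistribution_eq (h2.toLp ψ))
  simp only [TemperedDistribution.fourierInv_apply, Lp.toTemperedDistribution_apply] at h
  simp only [smul_eq_mul] at h
  simp_rw [mul_comm _ (φ _)]
  rw [← h]
  have h3 := VectorFourier.integral_fourierIntegral_smul_eq_flip (L := -innerₗ ℝ)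
    (μ := volume) (ν := volume) Real.continuous_fourierChar
      (by simp; fun_prop) φ.integrable h1
  have h4 : (-innerₗ ℝ : ℝ →ₗ[ℝ] ℝ →ₗ[ℝ] ℝ).flip = -innerₗ ℝ := by
    ext; simp
  rw [h4] at h3
  calc _ = ∫ x, 𝓕⁻ (φ : ℝ → ℂ) x * ψ x := by
        refine integral_congr_ae ?_
        filter_upwards [h2.coeFn_toLp] with x hx
        rw [hx, SchwartzMap.fourierInv_coe]
    _ = _ := h3

lemma tendsto_lintegral_sq_compl {g : ℝ → ℂ} (hg : MemLp g 2) {E : ℕ → Set ℝ}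
    (hE : ∀ n, MeasurableSet (E n)) (hmono : ∀ x, ∀ᶠ n in atTop, x ∈ E n) :
    Tendsto (fun n => ∫⁻ x, ‖(E n).indicator g x - g x‖ₑ ^ 2) atTop (𝓝 0) := by
  have hfin : ∫⁻ x, ‖g x‖ₑ ^ 2 ≠ ⊤ := by
    rw [← eLpNorm_two_sq]; exact ENNReal.pow_ne_top hg.2.ne
  have := tendsto_lintegral_of_dominated_convergence' (μ := volume)
    (F := fun n x => ‖(E n).indicator g x - g x‖ₑ ^ 2) (f := fun _ => 0)
    (fun x => ‖g x‖ₑ ^ 2)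
    (fun n => ((hg.1.indicator (hE n)).sub hg.1).enorm.pow_const 2)
    (fun n => ae_of_all _ fun x => by
      by_cases hx : x ∈ E n <;> simp [hx]) hfin
    (ae_of_all _ fun x => by
      refine tendsto_const_nhds.congr' ?_
      filter_upwards [hmono x] with n hn
      simp [hn])
  simpa using this

/-- The truncated inverse Fourier integral. -/
def truncInv (E : Set ℝ) (g : ℝ → ℂ) (x : ℝ) : ℂ :=
  (1 / (2 * π : ℂ)) * ∫ ξ in E, g ξ * Complex.exp (Complex.I * x * ξ)

lemma truncInv_eq_fourierInv {E : Set ℝ} (hE : MeasurableSet E) (F : ℝ → ℂ) (x : ℝ) :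
    truncInv E (fun ξ => F ((2 * π)⁻¹ * ξ)) x
      = 𝓕⁻ (((fun η => 2 * π * η) ⁻¹' E).indicator F) x := by
  rw [Real.fourierInv_eq', truncInv, ← integral_indicator hE]
  have := Measure.integral_comp_mul_left
    (fun y : ℝ => E.indicator (fun ξ => F ((2 * π)⁻¹ * ξ) * Complex.exp (Complex.I * x * ξ)) y)
    (2 * π)
  rw [abs_of_pos (by positivity)] at this
  rw [show (1 / (2 * π : ℂ)) = (((2 * π)⁻¹ : ℝ) : ℂ) by push_cast; rw [one_div],
    ← Complex.real_smul, ← this]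
  congr 1; ext y
  by_cases hy : 2 * π * y ∈ E
  · rw [Set.indicator_of_mem hy, Set.indicator_of_mem (by exact hy),
      inv_mul_cancel_left₀ (by positivity), smul_eq_mul, mul_comm]
    congr 2
    simp; ring
  · rw [Set.indicator_of_notMem hy, Set.indicator_of_notMem (by exact hy), smul_zero]

/-- `L²` inversion of the Fourier transform along bounded truncations. -/
lemma tendsto_truncInv {f g : ℝ → ℂ} (hf : MemLp f 2) (h : IsFourierTransform f g) {E : ℕ → Set ℝ}
    (hE : ∀ n, MeasurableSet (E n)) (hb : ∀ n, Bornology.IsBounded (E n))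
    (hmono : ∀ x, ∀ᶠ n in atTop, x ∈ E n) :
    Tendsto (fun n => eLpNorm (truncInv (E n) g - f) 2) atTop (𝓝 0) := by
  set F : Lp ℂ 2 (volume : Measure ℝ) := 𝓕 (hf.toLp f) with hF
  set E' : ℕ → Set ℝ := fun n => (fun η => 2 * π * η) ⁻¹' E n with hE'
  have hE'm : ∀ n, MeasurableSet (E' n) := fun n => by
    exact (measurable_const_mul _) (hE n)
  have hE'b : ∀ n, volume (E' n) ≠ ⊤ := fun n => by
    rw [hE', Real.volume_preimage_mul_left (by positivity)]
    exact ENNReal.mul_ne_top ENNReal.ofReal_ne_top (hb n).measure_lt_top.ne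
  have hFn : ∀ n, MemLp ((E' n).indicator F) 2 := fun n => (Lp.memLp F).indicator (hE'm n)
  have hFi : ∀ n, Integrable ((E' n).indicator F) := fun n => by
    rw [integrable_indicator_iff (hE'm n)]
    have : IsFiniteMeasure (volume.restrict (E' n)) := ⟨by simpa using (hE'b n).lt_top⟩
    exact ((Lp.memLp F).restrict _).integrable (by norm_num)
  have hS : ∀ n, truncInv (E n) g = 𝓕⁻ ((E' n).indicator F) := fun n => by
    ext x
    rw [← truncInv_eq_fourierInv (hE n)]
    simp only [truncInv]
    congr 1
    refine integral_congr_ae (ae_restrict_of_ae ?_)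
    filter_upwards [h.ae_eq_planchTransform hf] with ξ hξ
    rw [hξ, planchTransform]
  -- The inverse transform is an isometry, so the error is exactly the `L²` mass of `F` outside the
  -- truncation set.
  have hN : ∀ n, eLpNorm (truncInv (E n) g - f) 2 ^ 2
      = ∫⁻ x, ‖(E' n).indicator F x - F x‖ₑ ^ 2 := fun n => by
    have h1 : truncInv (E n) g - f =ᵐ[volume]
        ((𝓕⁻ ((hFn n).toLp _ - F) : Lp ℂ 2 (volume : Measure ℝ)) : ℝ → ℂ) := by
      have e1 : (𝓕⁻ ((hFn n).toLp _ - F) : Lp ℂ 2 (volume : Measure ℝ))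
          = 𝓕⁻ ((hFn n).toLp _) - hf.toLp f := by
        have : 𝓕⁻ F = hf.toLp f := FourierPair.fourierInv_fourier_eq _
        rw [← this]
        exact (Lp.fourierTransformₗᵢ ℝ ℂ).symm.map_sub _ _
      rw [e1]
      filter_upwards [Lp.coeFn_sub (𝓕⁻ ((hFn n).toLp _)) (hf.toLp f), hf.coeFn_toLp,
        fourierInv_toLp_ae (hFi n) (hFn n)] with x hx1 hx2 hx3
      rw [hx1, Pi.sub_apply, Pi.sub_apply, hx2, hx3, hS]
    rw [eLpNorm_congr_ae h1, ← eLpNorm_two_sq (fun x => (E' n).indicator F x - F x)]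
    have e2 : ‖(𝓕⁻ ((hFn n).toLp _ - F) : Lp ℂ 2 (volume : Measure ℝ))‖
        = ‖(hFn n).toLp _ - F‖ := (Lp.fourierTransformₗᵢ ℝ ℂ).symm.norm_map _
    rw [Lp.norm_def, Lp.norm_def, ENNReal.toReal_eq_toReal_iff' (Lp.eLpNorm_ne_top _)
      (Lp.eLpNorm_ne_top _)] at e2
    rw [e2]
    congr 1
    refine eLpNorm_congr_ae ?_
    filter_upwards [Lp.coeFn_sub ((hFn n).toLp _) F, (hFn n).coeFn_toLp] with x hx1 hx2
    rw [hx1, Pi.sub_apply, hx2]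
  have ht := tendsto_lintegral_sq_compl (Lp.memLp F) hE'm (fun x => hmono _)
  simp_rw [← hN] at ht
  have := ((ENNReal.continuous_rpow_const (y := 1 / 2)).tendsto 0).comp ht
  simp only [Function.comp_def, ← ENNReal.rpow_natCast, ← ENNReal.rpow_mul] at this
  norm_num at this
  exact this

/-! ### Averages over short intervals and the averaged modulus of smoothness. -/

/-- The average of `u` over `(x - h, x)`. -/
def avg (h : ℝ) (u : ℝ → ℂ) (x : ℝ) : ℂ := (h⁻¹ : ℝ) • ∫ y in Set.Ioc 0 h, u (x - y)

lemma measurable_avg {u : ℝ → ℂ} (hu : Measurable u) (h : ℝ) : Measurable (avg h u) := by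
  have : StronglyMeasurable (Function.uncurry fun x y : ℝ => u (x - y)) :=
    (hu.comp (measurable_fst.sub measurable_snd)).stronglyMeasurable
  exact (this.integral_prod_right (ν := volume.restrict (Set.Ioc 0 h))).measurable.const_smul (h⁻¹ : ℝ)

lemma enorm_integral_Ioc_rpow_le {p h : ℝ} (hp : 1 ≤ p) (hh : 0 < h) {F : ℝ → ℂ}
    (hF : AEStronglyMeasurable F (volume.restrict (Set.Ioc 0 h))) :
    ‖∫ y in Set.Ioc 0 h, F y‖ₑ ^ p
      ≤ ENNReal.ofReal (h ^ (p - 1)) * ∫⁻ y in Set.Ioc 0 h, ‖F y‖ₑ ^ p := by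
  have hp0 : 0 < p := by linarith
  have h1 := eLpNorm_le_eLpNorm_mul_rpow_measure_univ (p := 1) (q := ENNReal.ofReal p)
    (by simpa using hp) hF
  rw [eLpNorm_one_eq_lintegral_enorm, eLpNorm_eq_lintegral_rpow_enorm_toReal (by simpa using hp0)
    (by simp), ENNReal.toReal_ofReal hp0.le] at h1
  simp only [Measure.restrict_apply_univ, Real.volume_Ioc, sub_zero, ENNReal.toReal_one, div_one]
    at h1
  calc _ ≤ (∫⁻ y in Set.Ioc 0 h, ‖F y‖ₑ) ^ p := by
        gcongr; exact enorm_integral_le_lintegral_enorm _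
    _ ≤ _ := ENNReal.rpow_le_rpow h1 hp0.le
    _ = _ := by
        rw [ENNReal.mul_rpow_of_nonneg _ _ hp0.le, ← ENNReal.rpow_mul, ← ENNReal.rpow_mul,
          one_div_mul_cancel hp0.ne', ENNReal.rpow_one, mul_comm, sub_mul,
          one_div_mul_cancel hp0.ne', one_mul, ENNReal.ofReal_rpow_of_pos hh]

/-- Jensen's inequality for the mean over an interval of length `h`, obtained from Hölder. -/
lemma enorm_average_rpow_le {p h : ℝ} (hp : 1 ≤ p) (hh : 0 < h) {F : ℝ → ℂ}
    (hF : AEStronglyMeasurable F (volume.restrict (Set.Ioc 0 h))) :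
    ‖(h⁻¹ : ℝ) • ∫ y in Set.Ioc 0 h, F y‖ₑ ^ p
      ≤ ENNReal.ofReal h⁻¹ * ∫⁻ y in Set.Ioc 0 h, ‖F y‖ₑ ^ p := by
  have hp0 : 0 < p := by linarith
  rw [enorm_smul, ENNReal.mul_rpow_of_nonneg _ _ hp0.le]
  refine (mul_le_mul_right (enorm_integral_Ioc_rpow_le hp hh hF) _).trans_eq ?_
  rw [← mul_assoc, Real.enorm_eq_ofReal (by positivity), ENNReal.ofReal_rpow_of_pos (by positivity),
    ← ENNReal.ofReal_mul (by positivity)]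
  congr 2
  rw [Real.rpow_sub_one hh.ne', Real.inv_rpow hh.le]
  field_simp

lemma lintegral_average_rpow_le {p h : ℝ} (hp : 1 ≤ p) (hh : 0 < h) {G : ℝ → ℝ → ℂ}
    (hG : Measurable (Function.uncurry G)) :
    ∫⁻ x, ‖(h⁻¹ : ℝ) • ∫ y in Set.Ioc 0 h, G x y‖ₑ ^ p
      ≤ ENNReal.ofReal h⁻¹ * ∫⁻ x, ∫⁻ y in Set.Ioc 0 h, ‖G x y‖ₑ ^ p := by
  rw [← lintegral_const_mul']
  · exact lintegral_mono fun x => enorm_average_rpow_le hp hh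
      (hG.of_uncurry_left).aestronglyMeasurable
  · simp

lemma eLpNorm_ofReal_rpow {p : ℝ} (hp : 1 ≤ p) (u : ℝ → ℂ) :
    eLpNorm u (ENNReal.ofReal p) ^ p = ∫⁻ x, ‖u x‖ₑ ^ p := by
  have hp0 : 0 < p := by linarith
  rw [eLpNorm_eq_lintegral_rpow_enorm_toReal (by simpa using hp0)
    (by simp), ENNReal.toReal_ofReal hp0.le, ← ENNReal.rpow_mul, one_div_mul_cancel hp0.ne',
    ENNReal.rpow_one]

lemma eLpNorm_avg_le {p h : ℝ} (hp : 1 ≤ p) (hh : 0 < h) {v : ℝ → ℂ} (hv : Measurable v) :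
    eLpNorm (avg h v) (ENNReal.ofReal p) ≤ eLpNorm v (ENNReal.ofReal p) := by
  have hp0 : 0 < p := by linarith
  rw [← ENNReal.rpow_le_rpow_iff hp0, eLpNorm_ofReal_rpow hp, eLpNorm_ofReal_rpow hp]
  have hm : Measurable (Function.uncurry fun x y : ℝ => v (x - y)) :=
    hv.comp (measurable_fst.sub measurable_snd)
  refine (lintegral_average_rpow_le hp hh hm).trans_eq ?_
  rw [lintegral_lintegral_swap (by exact (hm.enorm.pow_const p).aemeasurable)]
  simp_rw [lintegral_sub_right_eq_self (fun x => ‖v x‖ₑ ^ p)]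
  rw [lintegral_const, Measure.restrict_apply_univ, Real.volume_Ioc, sub_zero, mul_left_comm,
    ← ENNReal.ofReal_mul (by positivity), inv_mul_cancel₀ hh.ne', ENNReal.ofReal_one, mul_one]

lemma enorm_avg_rpow_le {p h : ℝ} (hp : 1 ≤ p) (hh : 0 < h) {v : ℝ → ℂ} (hv : Measurable v)
    (x : ℝ) : ‖avg h v x‖ₑ ^ p ≤ ENNReal.ofReal h⁻¹ * ∫⁻ x, ‖v x‖ₑ ^ p := by
  refine (enorm_average_rpow_le hp hh
    (hv.comp (measurable_const.sub measurable_id)).aestronglyMeasurable).trans ?_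
  refine mul_le_mul_right ((setLIntegral_le_lintegral _ _).trans_eq ?_) _
  exact lintegral_sub_left_eq_self (fun x => ‖v x‖ₑ ^ p) x

/-- Interpolation between `L^p → L^p` (norm at most `1`) and `L^p → L^∞` (norm at most `h^(-1/p)`):
write `|A|² = |A|^(2-p) |A|^p`, bound the first factor pointwise and integrate the second. This is
the only place where `L^p` is exchanged for `L²`, and its price is the term `(2-p)/(2p)` of the
theorem. -/
lemma eLpNorm_two_avg_le {p h : ℝ} (hp : 1 ≤ p) (hp2 : p ≤ 2) (hh : 0 < h) {v : ℝ → ℂ}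
    (hv : Measurable v) :
    eLpNorm (avg h v) 2
      ≤ ENNReal.ofReal (h ^ (-((2 - p) / (2 * p)))) * eLpNorm v (ENNReal.ofReal p) := by
  have hp0 : 0 < p := by linarith
  have hsq : ∀ a : ℝ≥0∞, a ^ 2 = (a ^ p) ^ ((2 - p) / p) * a ^ p := fun a => by
    rw [← ENNReal.rpow_mul, ← ENNReal.rpow_add_of_nonneg _ _ (mul_nonneg hp0.le
      (div_nonneg (by linarith) hp0.le)) hp0.le, mul_div_cancel₀ _ hp0.ne', sub_add_cancel,
      ← ENNReal.rpow_natCast]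
    norm_num
  set N := ∫⁻ x, ‖v x‖ₑ ^ p with hN
  have key : eLpNorm (avg h v) 2 ^ 2
      ≤ (ENNReal.ofReal (h ^ (-((2 - p) / (2 * p)))) * eLpNorm v (ENNReal.ofReal p)) ^ 2 := by
    rw [eLpNorm_two_sq]
    calc _ ≤ ∫⁻ x, (ENNReal.ofReal h⁻¹ * N) ^ ((2 - p) / p) * ‖avg h v x‖ₑ ^ p := by
          refine lintegral_mono fun x => ?_
          rw [hsq]
          exact mul_le_mul_left (ENNReal.rpow_le_rpow (enorm_avg_rpow_le hp hh hv x)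
            (div_nonneg (by linarith) hp0.le)) _
      _ ≤ (ENNReal.ofReal h⁻¹ * N) ^ ((2 - p) / p) * N := by
          rw [lintegral_const_mul _ ((measurable_avg hv h).enorm.pow_const p)]
          gcongr
          rw [hN, ← eLpNorm_ofReal_rpow hp, ← eLpNorm_ofReal_rpow hp]
          gcongr
          exact eLpNorm_avg_le hp hh hv
      _ = _ := by
          rw [mul_pow, hsq (eLpNorm v (ENNReal.ofReal p) volume), eLpNorm_ofReal_rpow hp, ← hN,
            ENNReal.mul_rpow_of_nonneg _ _ (div_nonneg (by linarith) hp0.le), mul_assoc]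
          congr 1
          rw [ENNReal.ofReal_rpow_of_pos (by positivity), ← ENNReal.ofReal_pow (by positivity)]
          congr 1
          rw [← Real.rpow_natCast, ← Real.rpow_mul hh.le, Real.inv_rpow hh.le,
            ← Real.rpow_neg hh.le]
          congr 1
          push_cast
          field_simp
  exact (ENNReal.pow_le_pow_left_iff two_ne_zero).mp key

/-- The `L^p` modulus of smoothness of order `σ`, averaged over translations up to `h`. -/
def AveragedModulus (σ p C : ℝ) (u : ℝ → ℂ) : Prop :=
  ∀ h : ℝ, 0 < h → ∫⁻ x, ∫⁻ y in Set.Ioc 0 h, ‖u x - u (x - y)‖ₑ ^ p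
    ≤ ENNReal.ofReal (C * h ^ (σ * p + 1))

lemma integrableOn_sub_left {u : ℝ → ℂ} {q : ℝ≥0∞} (hq : 1 ≤ q) (hu : MemLp u q) (x h : ℝ) :
    IntegrableOn (fun y => u (x - y)) (Set.Ioc 0 h) := by
  have h1 : MemLp (fun y => u (x - y)) q :=
    hu.comp_measurePreserving (Measure.measurePreserving_sub_left volume x)
  have : IsFiniteMeasure (volume.restrict (Set.Ioc 0 h)) := ⟨by simp⟩
  exact (h1.restrict _).integrable hq

lemma sub_avg_eq {u : ℝ → ℂ} {q : ℝ≥0∞} (hq : 1 ≤ q) (hu : MemLp u q) {h : ℝ} (hh : 0 < h)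
    (x : ℝ) : u x - avg h u x = (h⁻¹ : ℝ) • ∫ y in Set.Ioc 0 h, (u x - u (x - y)) := by
  rw [integral_sub (integrable_const _) (integrableOn_sub_left hq hu x h), smul_sub, avg]
  congr 1
  simp [Measure.real, hh.le, hh.ne']

/-- `u - avg h u` is the mean of the differences `u(x) - u(x-y)` over `0 < y ≤ h`, so Jensen brings
in the averaged modulus. -/
lemma eLpNorm_sub_avg_le {σ p C h : ℝ} (hp : 1 ≤ p) (hC : 0 ≤ C) (hh : 0 < h) {u : ℝ → ℂ}
    (hum : Measurable u) (hu : MemLp u (ENNReal.ofReal p)) (hG : AveragedModulus σ p C u) :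
    eLpNorm (u - avg h u) (ENNReal.ofReal p) ≤ ENNReal.ofReal (C ^ (1 / p) * h ^ σ) := by
  have hp0 : 0 < p := by linarith
  rw [← ENNReal.rpow_le_rpow_iff hp0, eLpNorm_ofReal_rpow hp]
  have hm : Measurable (Function.uncurry fun x y : ℝ => u x - u (x - y)) :=
    (hum.comp measurable_fst).sub (hum.comp (measurable_fst.sub measurable_snd))
  simp only [Pi.sub_apply]
  simp_rw [sub_avg_eq (by simpa using hp) hu hh]
  refine (lintegral_average_rpow_le hp hh hm).trans ?_
  refine (mul_le_mul_right (hG h hh) _).trans_eq ?_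
  rw [← ENNReal.ofReal_mul (by positivity), ENNReal.ofReal_rpow_of_nonneg (by positivity) hp0.le]
  congr 1
  rw [Real.mul_rpow (by positivity) (by positivity), ← Real.rpow_mul hC,
    one_div_mul_cancel hp0.ne', Real.rpow_one, ← Real.rpow_mul hh.le, Real.rpow_add_one hh.ne']
  field_simp

lemma avg_sub {u v : ℝ → ℂ} {q : ℝ≥0∞} (hq : 1 ≤ q) (hu : MemLp u q) (hv : MemLp v q) (h : ℝ) :
    avg h (u - v) = avg h u - avg h v := by
  ext x
  simp only [avg, Pi.sub_apply]
  rw [integral_sub (integrableOn_sub_left hq hu x h) (integrableOn_sub_left hq hv x h), smul_sub]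

lemma memLp_avg {p h : ℝ} (hp : 1 ≤ p) (hh : 0 < h) {u : ℝ → ℂ}
    (hum : Measurable u) (hu : MemLp u (ENNReal.ofReal p)) : MemLp (avg h u) (ENNReal.ofReal p) :=
  ⟨(measurable_avg hum h).aestronglyMeasurable, (eLpNorm_avg_le hp hh hum).trans_lt hu.2⟩

lemma avg_comm {p h k : ℝ} (hp : 1 ≤ p) (hh : 0 < h) {u : ℝ → ℂ}
    (hum : Measurable u) (hu : MemLp u (ENNReal.ofReal p)) :
    avg h (avg k u) = avg k (avg h u) := by
  ext x
  simp only [avg]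
  rw [integral_smul, integral_smul, smul_comm]
  congr 2
  have hint : Integrable (Function.uncurry fun y z : ℝ => u (x - y - z))
      ((volume.restrict (Set.Ioc 0 h)).prod (volume.restrict (Set.Ioc 0 k))) := by
    refine ⟨(hum.comp ((measurable_const.sub measurable_fst).sub
      measurable_snd)).aestronglyMeasurable, ?_⟩
    have hm : Measurable fun z : ℝ × ℝ =>
        ‖Function.uncurry (fun y z : ℝ => u (x - y - z)) z‖ₑ :=
      (hum.comp ((measurable_const.sub measurable_fst).sub measurable_snd)).enorm
    rw [HasFiniteIntegral, lintegral_prod_symm' _ hm]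
    have hb : ∀ z, ∫⁻ y in Set.Ioc 0 h, ‖Function.uncurry (fun y z : ℝ => u (x - y - z)) (y, z)‖ₑ
        ≤ eLpNorm u (ENNReal.ofReal p) * ENNReal.ofReal h ^ (1 - 1 / p) := fun z => by
      have h1 := eLpNorm_le_eLpNorm_mul_rpow_measure_univ (p := 1) (q := ENNReal.ofReal p)
        (μ := volume.restrict (Set.Ioc 0 h)) (f := fun y => u (x - y - z))
        (by simpa using hp) (hum.comp ((measurable_const.sub measurable_id).sub
          measurable_const)).aestronglyMeasurable
      rw [eLpNorm_one_eq_lintegral_enorm, ENNReal.toReal_ofReal (by linarith)] at h1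
      simp only [Measure.restrict_apply_univ, Real.volume_Ioc, sub_zero, ENNReal.toReal_one,
        div_one] at h1
      refine h1.trans ?_
      gcongr
      refine (eLpNorm_mono_measure _ Measure.restrict_le_self).trans_eq ?_
      have h2 : (fun y => u (x - y - z)) = u ∘ fun y => (x - z) - y := by
        ext y; simp only [Function.comp]; congr 1; ring
      rw [h2]
      exact eLpNorm_comp_measurePreserving hu.1 (Measure.measurePreserving_sub_left volume (x - z))
    refine (lintegral_mono hb).trans_lt ?_
    rw [lintegral_const]
    refine ENNReal.mul_lt_top (ENNReal.mul_lt_top hu.2 ?_) (by simp)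
    rw [ENNReal.ofReal_rpow_of_pos hh]; exact ENNReal.ofReal_lt_top
  rw [integral_integral_swap hint]
  congr 1; ext z; congr 1; ext y; congr 1; ring

lemma exists_geometric_bound (a : ℕ → ℝ≥0∞) {K q : ℝ} (hK : 0 ≤ K) (hq0 : 0 ≤ q) (hq : q < 1)
    (h0 : a 0 ≠ ⊤) (h : ∀ n, a (n + 1) ≤ a n + ENNReal.ofReal (K * q ^ n)) :
    ∃ M : ℝ≥0∞, M ≠ ⊤ ∧ ∀ n, a n ≤ M := by
  refine ⟨a 0 + ENNReal.ofReal (K * (1 - q)⁻¹), by simp [h0], fun n => ?_⟩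
  have h1 : ∀ n, a n ≤ a 0 + ENNReal.ofReal (K * ∑ k ∈ Finset.range n, q ^ k) := by
    intro n
    induction n with
    | zero => simp
    | succ n ih =>
      refine (h n).trans ?_
      rw [Finset.sum_range_succ, mul_add, ENNReal.ofReal_add (by positivity) (by positivity),
        ← add_assoc]
      gcongr
  refine (h1 n).trans ?_
  gcongr
  rw [← tsum_geometric_of_lt_one hq0 hq]
  exact (summable_geometric_of_lt_one hq0 hq).sum_le_tsum _ (fun _ _ => by positivity)

/-! ### Embedding into `L²`. -/

/-- A function in `L^p` with averaged modulus of smoothness of order `σ > 1/p - 1/2` is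
in `L²`. -/
theorem memLp_two_of_averagedModulus {σ p C : ℝ} (hp : 1 ≤ p) (hp2 : p ≤ 2) (hC : 0 ≤ C)
    {u : ℝ → ℂ} (hum : Measurable u) (hu : MemLp u (ENNReal.ofReal p))
    (hG : AveragedModulus σ p C u) (hσ : (2 - p) / (2 * p) < σ) : MemLp u 2 := by
  have hp0 : 0 < p := by linarith
  have hp1 : (1 : ℝ≥0∞) ≤ ENNReal.ofReal p := by simpa using hp
  set d := (2 - p) / (2 * p) with hd
  have hd0 : 0 ≤ d := div_nonneg (by linarith) (by linarith)
  have hσ0 : 0 < σ := by linarith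
  set D := C ^ (1 / p) with hD
  have hD0 : 0 ≤ D := by positivity
  set η : ℕ → ℝ := fun n => (2⁻¹ : ℝ) ^ n with hη
  have hη0 : ∀ n, 0 < η n := fun n => by positivity
  set A : ℕ → ℝ → ℂ := fun n => avg (η n) u with hA
  have hAm : ∀ n, Measurable (A n) := fun n => measurable_avg hum _
  have hAL : ∀ n, MemLp (A n) (ENNReal.ofReal p) := fun n => memLp_avg hp (hη0 n) hum hu
  have hstep : ∀ n, eLpNorm (A n - A (n + 1)) (ENNReal.ofReal p)
      ≤ ENNReal.ofReal (2 * D * (η n) ^ σ) := fun n => by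
    have e : A n - A (n + 1) = (u - A (n + 1)) - (u - A n) := by abel
    rw [e]
    refine (eLpNorm_sub_le (hum.sub (hAm _)).aestronglyMeasurable
      (hum.sub (hAm _)).aestronglyMeasurable hp1).trans ?_
    rw [show 2 * D * (η n) ^ σ = D * (η n) ^ σ + D * (η n) ^ σ by ring,
      ENNReal.ofReal_add (by positivity) (by positivity)]
    refine add_le_add ((eLpNorm_sub_avg_le hp hC (hη0 _) hum hu hG).trans
      (ENNReal.ofReal_le_ofReal ?_)) (eLpNorm_sub_avg_le hp hC (hη0 n) hum hu hG)
    have : η (n + 1) ≤ η n := pow_le_pow_of_le_one (by norm_num) (by norm_num) (Nat.le_succ n)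
    gcongr
  -- Averaging twice is essential. As averages commute, consecutive double averages differ by the
  -- sum of the two averaging operators applied to `A n - A (n + 1)`, like a difference of squares.
  -- The outer average turns the `L^p` size `η^σ` of this difference into the `L²` size `η^(σ-d)`,
  -- which is summable.
  set a : ℕ → ℝ → ℂ := fun n => avg (η n) (A n) with ha
  have ham : ∀ n, Measurable (a n) := fun n => measurable_avg (hAm n) _
  set q : ℝ := (2⁻¹ : ℝ) ^ (σ - d) with hq
  have hq1 : q < 1 := Real.rpow_lt_one (by norm_num) (by norm_num) (by linarith)
  have hrec : ∀ n, eLpNorm (a (n + 1)) 2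
      ≤ eLpNorm (a n) 2 + ENNReal.ofReal (2 * 2 ^ d * (2 * D) * q ^ n) := fun n => by
    have e : a (n + 1) = a n - (avg (η n) (A n - A (n + 1)) + avg (η (n + 1)) (A n - A (n + 1))) := by
      rw [avg_sub hp1 (hAL _) (hAL _), avg_sub hp1 (hAL _) (hAL _),
        show avg (η n) (A (n + 1)) = avg (η (n + 1)) (A n) from avg_comm hp (hη0 _) hum hu]
      simp only [ha]; abel
    have hdm : Measurable (A n - A (n + 1)) := (hAm n).sub (hAm _)
    rw [e]
    refine (eLpNorm_sub_le (ham n).aestronglyMeasurable ((measurable_avg hdm _).add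
      (measurable_avg hdm _)).aestronglyMeasurable (by norm_num)).trans ?_
    gcongr
    refine (eLpNorm_add_le (measurable_avg hdm _).aestronglyMeasurable
      (measurable_avg hdm _).aestronglyMeasurable (by norm_num)).trans ?_
    have hb : ∀ k, k ≤ n + 1 → eLpNorm (avg (η k) (A n - A (n + 1))) 2
        ≤ ENNReal.ofReal (2 ^ d * (2 * D) * q ^ n) := fun k hk => by
      refine (eLpNorm_two_avg_le hp hp2 (hη0 k) hdm).trans ?_
      refine (mul_le_mul_right (hstep n) _).trans ?_
      rw [← ENNReal.ofReal_mul (by positivity)]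
      apply ENNReal.ofReal_le_ofReal
      have h1 : η k ^ (-d) ≤ η (n + 1) ^ (-d) :=
        Real.rpow_le_rpow_of_nonpos (hη0 _)
          (pow_le_pow_of_le_one (by norm_num) (by norm_num) hk) (by linarith)
      have h2 : η (n + 1) ^ (-d) = 2 ^ d * (η n) ^ (-d) := by
        rw [hη]
        simp only [pow_succ]
        rw [Real.mul_rpow (by positivity) (by norm_num), Real.inv_rpow (by norm_num),
          Real.rpow_neg (by norm_num : (0 : ℝ) ≤ 2), inv_inv, mul_comm]
      have h3 : q ^ n = (η n) ^ σ * (η n) ^ (-d) := by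
        rw [← Real.rpow_add (hη0 n)]
        change ((2⁻¹ : ℝ) ^ (σ - d)) ^ n = ((2⁻¹ : ℝ) ^ n) ^ (σ + -d)
        rw [← Real.rpow_natCast, ← Real.rpow_natCast,
          ← Real.rpow_mul (by norm_num), ← Real.rpow_mul (by norm_num), mul_comm, sub_eq_add_neg]
      calc _ ≤ (2 ^ d * (η n) ^ (-d)) * (2 * D * η n ^ σ) := by
            rw [← h2]; gcongr
        _ = _ := by rw [h3]; ring
    refine (add_le_add (hb n (Nat.le_succ n)) (hb (n + 1) le_rfl)).trans_eq ?_
    rw [← ENNReal.ofReal_add (by positivity) (by positivity)]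
    congr 1; ring
  have hK0 : 0 ≤ 2 * 2 ^ d * (2 * D) := by positivity
  have h0 : eLpNorm (a 0) 2 ≠ ⊤ := by
    refine ((eLpNorm_two_avg_le hp hp2 (hη0 0) (hAm 0)).trans_lt ?_).ne
    exact ENNReal.mul_lt_top ENNReal.ofReal_lt_top (hAL 0).2
  have hex : ∃ M : ℝ≥0∞, M ≠ ⊤ ∧ ∀ n, eLpNorm (a n) 2 volume ≤ M := by
    refine exists_geometric_bound (fun n => eLpNorm (a n) 2 volume) (K := 2 * 2 ^ d * (2 * D))
      (q := q) hK0 ?_ hq1 h0 ?_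
    · exact Real.rpow_nonneg (by norm_num) _
    · exact hrec
  obtain ⟨M, hM, hMb⟩ := hex
  have hconv : Tendsto (fun n => eLpNorm (a n - u) (ENNReal.ofReal p)) atTop (𝓝 0) := by
    have hbd : ∀ n, eLpNorm (a n - u) (ENNReal.ofReal p) ≤ ENNReal.ofReal (2 * D * (η n) ^ σ) := by
      intro n
      have e : a n - u = -((u - A n) + avg (η n) (u - A n)) := by
        rw [avg_sub hp1 hu (hAL _)]
        simp only [ha, hA]; abel
      rw [e, eLpNorm_neg]
      have hdm : Measurable (u - A n) := hum.sub (hAm n)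
      refine (eLpNorm_add_le hdm.aestronglyMeasurable
        (measurable_avg hdm _).aestronglyMeasurable hp1).trans ?_
      rw [show 2 * D * (η n) ^ σ = D * (η n) ^ σ + D * (η n) ^ σ by ring,
        ENNReal.ofReal_add (by positivity) (by positivity)]
      have := eLpNorm_sub_avg_le hp hC (hη0 n) hum hu hG
      exact add_le_add this ((eLpNorm_avg_le hp (hη0 n) hdm).trans this)
    refine tendsto_of_tendsto_of_tendsto_of_le_of_le tendsto_const_nhds ?_ (fun _ => zero_le)
      hbd
    have h1 : Tendsto η atTop (𝓝 0) :=
      tendsto_pow_atTop_nhds_zero_of_lt_one (by norm_num) (by norm_num)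
    have h2 := (h1.rpow_const (p := σ) (Or.inr hσ0.le)).const_mul (2 * D)
    rw [Real.zero_rpow hσ0.ne', mul_zero] at h2
    simpa using ENNReal.tendsto_ofReal h2
  -- `L^p` convergence gives almost everywhere convergence along a subsequence, and Fatou carries
  -- the uniform `L²` bound to `u`.
  have hmeas := tendstoInMeasure_of_tendsto_eLpNorm (μ := volume) (p := ENNReal.ofReal p)
    (by simpa using hp0) (fun n => (ham n).aestronglyMeasurable) hum.aestronglyMeasurable hconv
  obtain ⟨ns, -, hns⟩ := hmeas.exists_seq_tendsto_ae
  refine ⟨hum.aestronglyMeasurable, ?_⟩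
  refine (Lp.eLpNorm_lim_le_liminf_eLpNorm (fun n => (ham (ns n)).aestronglyMeasurable) u
    hns).trans_lt ?_
  refine lt_of_le_of_lt ?_ hM.lt_top
  exact liminf_le_of_le (by isBoundedDefault) fun b hb => by
    obtain ⟨n, hn⟩ := hb.exists
    exact hn.trans (hMb _)

/-! ### The averaging multiplier and dyadic decay of the Fourier transform. -/

/-- Modulation is translation on the Fourier side: translating `𝓕 φ` and inverting keeps the
function in the Schwartz class without any seminorm estimates. -/
lemma exists_modulation (φ : 𝓢(ℝ, ℂ)) (y : ℝ) :
    ∃ χ : 𝓢(ℝ, ℂ), ∀ ξ, χ ξ = Complex.exp (-(Complex.I * y * ξ)) * φ ξ := by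
  refine ⟨𝓕⁻ (SchwartzMap.compSubConstCLM ℂ (-(y / (2 * π))) (𝓕 φ)), fun ξ => ?_⟩
  rw [SchwartzMap.fourierInv_coe]
  have h := congrFun (VectorFourier.fourierIntegral_comp_add_right Real.fourierChar volume
    (-innerₗ ℝ) (𝓕 φ : 𝓢(ℝ, ℂ)) (y / (2 * π))) ξ
  have h2 : VectorFourier.fourierIntegral Real.fourierChar volume
    (-innerₗ ℝ) (𝓕 φ : 𝓢(ℝ, ℂ)) ξ = φ ξ := by
    have : 𝓕⁻ ((𝓕 φ : 𝓢(ℝ, ℂ)) : ℝ → ℂ) ξ = φ ξ := by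
      rw [← SchwartzMap.fourierInv_coe, FourierTransform.fourierInv_fourier_eq]
    exact this
  rw [h2] at h
  have h3 : ((SchwartzMap.compSubConstCLM ℂ (-(y / (2 * π))) (𝓕 φ) : 𝓢(ℝ, ℂ)) : ℝ → ℂ)
      = (𝓕 φ : 𝓢(ℝ, ℂ)) ∘ fun v => v + y / (2 * π) := by
    ext v; simp
  rw [h3]
  refine h.trans ?_
  rw [Circle.smul_def, Real.fourierChar_apply, smul_eq_mul]
  congr 2
  simp
  have : (π : ℂ) ≠ 0 := by exact_mod_cast pi_ne_zero
  field_simp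

/-- The Fourier multiplier of the unit average. -/
def mult (η : ℝ) : ℂ := ∫ y in (0 : ℝ)..1, Complex.exp (-(Complex.I * y * η))

lemma continuous_mult : Continuous mult := by
  unfold mult
  exact intervalIntegral.continuous_parametric_intervalIntegral_of_continuous' (by fun_prop) 0 1

lemma norm_exp_neg_I_mul (y η : ℝ) : ‖Complex.exp (-(Complex.I * y * η))‖ = 1 := by
  rw [Complex.norm_exp]; simp

lemma norm_mult_le (η : ℝ) : ‖mult η‖ ≤ 1 := by
  refine (intervalIntegral.norm_integral_le_of_norm_le_const (C := 1) fun y _ => ?_).trans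
    (by simp)
  rw [norm_exp_neg_I_mul]

lemma mult_eq {η : ℝ} (hη : η ≠ 0) :
    mult η = (Complex.exp (-(Complex.I * η)) - 1) / (-(Complex.I * η)) := by
  have hc : -(Complex.I * η) ≠ 0 := by simp [hη]
  have := integral_exp_mul_complex (a := 0) (b := 1) hc
  simp only [Complex.ofReal_one, mul_one, Complex.ofReal_zero, mul_zero, Complex.exp_zero] at this
  rw [← this, mult]
  congr 1; ext y; congr 1; ring

lemma average_exp_eq_mult {h : ℝ} (hh : 0 < h) (ξ : ℝ) :
    (h⁻¹ : ℝ) • ∫ y in Set.Ioc 0 h, Complex.exp (-(Complex.I * y * ξ)) = mult (h * ξ) := by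
  rw [← intervalIntegral.integral_of_le hh.le]
  have := intervalIntegral.integral_comp_mul_right (a := 0) (b := 1)
    (fun y : ℝ => Complex.exp (-(Complex.I * y * ξ))) hh.ne'
  rw [zero_mul, one_mul] at this
  rw [← this, mult]
  congr 1; ext y; congr 1; push_cast; ring

/-- By compactness it is enough that `m(1 - m)` has no zero in the range. Zeros of `m` are nonzero
multiples of `2π`, and `6 < 2π`; and `m = 1` is excluded by `|m| ≤ 2/|η| ≤ 2/3`. The endpoints have
ratio `2`, so a rescaling covers a dyadic annulus. -/
lemma exists_mult_lower_bound : ∃ c : ℝ, 0 < c ∧ ∀ η : ℝ, 3 ≤ |η| → |η| ≤ 6 →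
    c ≤ ‖mult η - mult η * mult η‖ := by
  have hK : IsCompact {η : ℝ | 3 ≤ |η| ∧ |η| ≤ 6} := by
    refine (isCompact_Icc (a := (-6 : ℝ)) (b := 6)).of_isClosed_subset ?_ fun η hη => ?_
    · exact (isClosed_le continuous_const continuous_abs).inter
        (isClosed_le continuous_abs continuous_const)
    · exact abs_le.mp hη.2
  obtain ⟨η₀, hη₀, hmin⟩ := hK.exists_isMinOn ⟨3, by norm_num⟩
    (f := fun η => ‖mult η - mult η * mult η‖)
    (by have := continuous_mult; fun_prop)
  refine ⟨_, ?_, fun η h1 h2 => hmin ⟨h1, h2⟩⟩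
  obtain ⟨h3, h6⟩ := hη₀
  have hne : η₀ ≠ 0 := by rintro rfl; norm_num at h3
  rw [norm_pos_iff, ← mul_one_sub, mul_ne_zero_iff]
  constructor
  · rw [mult_eq hne]
    refine div_ne_zero ?_ (by simp [hne])
    rw [sub_ne_zero]
    intro he
    obtain ⟨n, hn⟩ := Complex.exp_eq_one_iff.mp he
    have hn' : -η₀ = n * (2 * π) := by
      have h4 : Complex.I * ((-η₀ : ℝ) : ℂ) = Complex.I * ((n * (2 * π) : ℝ) : ℂ) := by
        push_cast; rw [mul_neg, hn]; ring
      exact_mod_cast mul_left_cancel₀ Complex.I_ne_zero h4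
    have habs : |η₀| = |(n : ℝ)| * (2 * π) := by
      rw [← abs_neg, hn', abs_mul, abs_of_pos (by positivity : 0 < 2 * π)]
    have hn0 : n ≠ 0 := by
      rintro rfl
      simp at hn'; exact hne hn'
    have : (1 : ℝ) ≤ |(n : ℝ)| := by exact_mod_cast Int.one_le_abs hn0
    nlinarith [pi_gt_three]
  · intro h0
    have h1 : ‖mult η₀‖ ≤ 2 / 3 := by
      rw [mult_eq hne, norm_div, norm_neg, norm_mul, Complex.norm_I, one_mul, Complex.norm_real,
        Real.norm_eq_abs]
      refine div_le_div₀ (by norm_num) ?_ (by norm_num) h3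
      refine (norm_sub_le _ _).trans ?_
      have := norm_exp_neg_I_mul 1 η₀
      simp only [Complex.ofReal_one, mul_one] at this
      rw [this]; norm_num
    rw [← sub_eq_zero.mp h0] at h1
    norm_num at h1

lemma integrable_prod_translate {u v : ℝ → ℂ} (hum : Measurable u) (hu : MemLp u 2)
    (hvm : Measurable v) (hv : MemLp v 2) (h : ℝ) :
    Integrable (Function.uncurry fun x y : ℝ => u (x - y) * v x)
      (volume.prod (volume.restrict (Set.Ioc 0 h))) := by
  have hm : Measurable (Function.uncurry fun x y : ℝ => u (x - y) * v x) :=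
    (hum.comp (measurable_fst.sub measurable_snd)).mul (hvm.comp measurable_fst)
  refine ⟨hm.aestronglyMeasurable, ?_⟩
  rw [HasFiniteIntegral, lintegral_prod_symm' _ hm.enorm]
  have hmy : ∀ y, Measurable fun x => ‖u (x - y)‖ₑ ^ 2 := fun y =>
    (hum.comp (measurable_id.sub measurable_const)).enorm.pow_const 2
  have hb : ∀ y, ∫⁻ x, ‖Function.uncurry (fun x y : ℝ => u (x - y) * v x) (x, y)‖ₑ
      ≤ eLpNorm u 2 ^ 2 + eLpNorm v 2 ^ 2 := fun y => by
    rw [eLpNorm_two_sq, eLpNorm_two_sq, ← lintegral_sub_right_eq_self (fun x => ‖u x‖ₑ ^ 2) y,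
      ← lintegral_add_left (hmy y)]
    refine lintegral_mono fun x => ?_
    simp only [Function.uncurry_apply_pair, enorm_mul]
    rcases le_total ‖u (x - y)‖ₑ ‖v x‖ₑ with hle | hle
    · refine le_add_left ?_
      rw [sq]; gcongr
    · refine le_add_right ?_
      rw [sq]; gcongr
  refine (lintegral_mono hb).trans_lt ?_
  rw [lintegral_const]
  exact ENNReal.mul_lt_top (ENNReal.add_lt_top.mpr ⟨ENNReal.pow_lt_top hu.2,
    ENNReal.pow_lt_top hv.2⟩) (by simp)

lemma memLp_mult_mul {g : ℝ → ℂ} (hg : MemLp g 2) (h : ℝ) :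
    MemLp (fun ξ => mult (h * ξ) * g ξ) 2 := by
  refine hg.of_le ((continuous_mult.comp (by fun_prop)).aestronglyMeasurable.mul hg.1)
    (ae_of_all _ fun ξ => ?_)
  rw [norm_mul]
  exact mul_le_of_le_one_left (norm_nonneg _) (norm_mult_le _)

/-- Translating `u` by `y` multiplies its transform by `e^(-iyξ)`, seen by testing on the modulated
Schwartz function; Fubini on both sides then averages over `y`. -/
lemma IsFourierTransform.avg {u g : ℝ → ℂ} (hum : Measurable u) (hu : MemLp u 2)
    (hF : IsFourierTransform u g) {h : ℝ} (hh : 0 < h) :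
    IsFourierTransform (avg h u) (fun ξ => mult (h * ξ) * g ξ) := by
  have hg := hF.memLp hu
  refine ⟨fun φ => integrable_mul_schwartz (memLp_mult_mul hg h) φ, fun φ => ?_⟩
  have hφm : Measurable (schwartzFourier φ) := (schwartzFourier φ).continuous.measurable
  simp_rw [← schwartzFourier_apply]
  have hF1 := integrable_prod_translate hum hu hφm ((schwartzFourier φ).memLp 2) h
  have hF2 : Integrable (Function.uncurry fun y ξ : ℝ =>
      Complex.exp (-(Complex.I * y * ξ)) * (g ξ * φ ξ))
      ((volume.restrict (Set.Ioc 0 h)).prod volume) := by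
    have : IsFiniteMeasure (volume.restrict (Set.Ioc 0 h)) := ⟨by simp⟩
    have h1 : Integrable (fun z : ℝ × ℝ => g z.2 * φ z.2)
        ((volume.restrict (Set.Ioc 0 h)).prod volume) :=
      (hF.1 φ).comp_snd _
    refine h1.bdd_mul (c := 1) (f := fun z : ℝ × ℝ => Complex.exp (-(Complex.I * z.1 * z.2)))
      (Continuous.aestronglyMeasurable (by fun_prop)) (ae_of_all _ fun z => ?_)
    rw [norm_exp_neg_I_mul]
  calc ∫ ξ, mult (h * ξ) * g ξ * φ ξ
      = ∫ ξ : ℝ, (h⁻¹ : ℝ) • ∫ y : ℝ in Set.Ioc 0 h, Complex.exp (-(Complex.I * y * ξ)) * (g ξ * φ ξ) := by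
        congr 1; ext ξ
        rw [integral_mul_const, ← average_exp_eq_mult hh, mul_assoc, smul_mul_assoc]
    _ = (h⁻¹ : ℝ) • ∫ y : ℝ in Set.Ioc 0 h, ∫ ξ : ℝ, Complex.exp (-(Complex.I * y * ξ)) * (g ξ * φ ξ) := by
        rw [integral_smul, integral_integral_swap hF2]
    _ = (h⁻¹ : ℝ) • ∫ y in Set.Ioc 0 h, ∫ x, u (x - y) * schwartzFourier φ x := by
        congr 2; ext y
        obtain ⟨χ, hχ⟩ := exists_modulation φ y
        have h1 := hF.2 χ
        simp_rw [hχ] at h1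
        rw [← integral_sub_right_eq_self
          (fun x => u x * fourierIntegral (fun ξ => Complex.exp (-(Complex.I * y * ξ)) * φ ξ) x) y] at h1
        calc _ = ∫ ξ, g ξ * (Complex.exp (-(Complex.I * y * ξ)) * φ ξ) := by
              congr 1; ext ξ; ring
          _ = _ := h1
          _ = _ := by
              congr 1; ext x
              congr 1
              rw [schwartzFourier_apply, fourierIntegral, fourierIntegral]
              congr 1; ext ξ
              rw [← mul_assoc, ← Complex.exp_add]
              congr 2
              push_cast; ring
    _ = ∫ x, (h⁻¹ : ℝ) • ∫ y in Set.Ioc 0 h, u (x - y) * schwartzFourier φ x := by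
        rw [integral_smul, integral_integral_swap hF1]
    _ = _ := by
        congr 1; ext x
        rw [integral_mul_const, LandauSchrodinger.avg, smul_mul_assoc]

/-- Dyadic decay of the Fourier transform of a function with averaged `L^p` modulus of smoothness
of order `σ`. -/
theorem exists_band_bound {σ p C : ℝ} (hp : 1 ≤ p) (hp2 : p ≤ 2) (hC : 0 ≤ C)
    {u g : ℝ → ℂ} (hum : Measurable u) (hu : MemLp u (ENNReal.ofReal p))
    (hG : AveragedModulus σ p C u) (hu2 : MemLp u 2) (hF : IsFourierTransform u g) :
    ∃ B : ℝ, 0 ≤ B ∧ ∀ l : ℝ, 0 < l → ∫⁻ ξ in {ξ | l ≤ |ξ| ∧ |ξ| ≤ 2 * l}, ‖g ξ‖ₑ ^ 2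
      ≤ ENNReal.ofReal (B * l ^ (-(2 * (σ - (2 - p) / (2 * p))))) := by
  obtain ⟨c, hc0, hc⟩ := exists_mult_lower_bound
  have hp1 : (1 : ℝ≥0∞) ≤ ENNReal.ofReal p := by simpa using hp
  set d := (2 - p) / (2 * p) with hd
  set D := C ^ (1 / p) with hD
  have hD0 : 0 ≤ D := by positivity
  refine ⟨c⁻¹ ^ 2 * (2 * π * (D * 3 ^ (σ - d)) ^ 2), by positivity, fun l hl => ?_⟩
  -- For `l ≤ |ξ| ≤ 2l` this puts `|hξ|` in `[3, 6]`, where the multiplier is bounded below.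
  set h := 3 / l with hh
  have hh0 : 0 < h := by positivity
  have hA2 : MemLp (avg h u) 2 := by
    have := memLp_avg (p := 2) (by norm_num) hh0 hum (by simpa using hu2)
    simpa using this
  have hAm := measurable_avg hum h
  have hAA2 : MemLp (avg h (avg h u)) 2 := by
    have := memLp_avg (p := 2) (by norm_num) hh0 hAm (by simpa using hA2)
    simpa using this
  have hFA := hF.avg hum hu2 hh0
  have hFAA := hFA.avg hAm hA2 hh0
  have hFw := hFA.sub hA2 hAA2 hFAA
  have hpl := hFw.lintegral_sq (hA2.sub hAA2)
  -- This function is the average of `u - avg h u`: the inner difference gains `h^σ` in `L^p`, the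
  -- outer average loses `h^(-d)` on the way to `L²`.
  have hw : eLpNorm (avg h u - avg h (avg h u)) 2
      ≤ ENNReal.ofReal (D * 3 ^ (σ - d) * l ^ (-(σ - d))) := by
    rw [← avg_sub hp1 hu (memLp_avg hp hh0 hum hu)]
    refine (eLpNorm_two_avg_le hp hp2 hh0 (hum.sub hAm)).trans ?_
    refine (mul_le_mul_right (eLpNorm_sub_avg_le hp hC hh0 hum hu hG) _).trans_eq ?_
    rw [← ENNReal.ofReal_mul (by positivity)]
    congr 1
    rw [← mul_assoc, mul_comm _ D, mul_assoc, ← Real.rpow_add hh0, hh,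
      Real.div_rpow (by norm_num) hl.le, Real.rpow_neg hl.le, neg_add_eq_sub]
    ring
  have hS : MeasurableSet {ξ : ℝ | l ≤ |ξ| ∧ |ξ| ≤ 2 * l} :=
    (measurableSet_le measurable_const measurable_norm).inter
      (measurableSet_le measurable_norm measurable_const)
  calc ∫⁻ ξ in {ξ | l ≤ |ξ| ∧ |ξ| ≤ 2 * l}, ‖g ξ‖ₑ ^ 2
      ≤ ∫⁻ ξ in {ξ | l ≤ |ξ| ∧ |ξ| ≤ 2 * l}, ENNReal.ofReal (c⁻¹ ^ 2) *
        ‖mult (h * ξ) * g ξ - mult (h * ξ) * (mult (h * ξ) * g ξ)‖ₑ ^ 2 := by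
        refine setLIntegral_mono_ae' hS (ae_of_all _ fun ξ hξ => ?_)
        rw [ENNReal.ofReal_pow (by positivity), ← mul_pow]
        gcongr
        rw [← ofReal_norm, ← ofReal_norm, ← ENNReal.ofReal_mul (by positivity)]
        apply ENNReal.ofReal_le_ofReal
        rw [← mul_assoc, ← sub_mul, norm_mul]
        have h1 : |h * ξ| = 3 * (|ξ| / l) := by
          rw [abs_mul, abs_of_pos hh0, hh]; ring
        have h2 := hc (h * ξ) (by rw [h1]; linarith [(one_le_div hl).mpr hξ.1])
          (by rw [h1]; linarith [(div_le_iff₀ hl).mpr hξ.2])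
        calc ‖g ξ‖ = c⁻¹ * (c * ‖g ξ‖) := by rw [inv_mul_cancel_left₀ hc0.ne']
          _ ≤ _ := by gcongr
    _ ≤ ∫⁻ ξ, ENNReal.ofReal (c⁻¹ ^ 2) *
        ‖mult (h * ξ) * g ξ - mult (h * ξ) * (mult (h * ξ) * g ξ)‖ₑ ^ 2 :=
        setLIntegral_le_lintegral _ _
    _ = ENNReal.ofReal (c⁻¹ ^ 2) * (ENNReal.ofReal (2 * π) *
        eLpNorm (avg h u - avg h (avg h u)) 2 ^ 2) := by
        rw [lintegral_const_mul' _ _ ENNReal.ofReal_ne_top, eLpNorm_two_sq, ← hpl]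
        rfl
    _ ≤ ENNReal.ofReal (c⁻¹ ^ 2) * (ENNReal.ofReal (2 * π) *
        ENNReal.ofReal (D * 3 ^ (σ - d) * l ^ (-(σ - d))) ^ 2) := by gcongr
    _ = _ := by
        rw [← ENNReal.ofReal_pow (by positivity), ← ENNReal.ofReal_mul (by positivity),
          ← ENNReal.ofReal_mul (by positivity)]
        congr 1
        have : l ^ (-(2 * (σ - d))) = (l ^ (-(σ - d))) ^ 2 := by
          rw [← Real.rpow_natCast, ← Real.rpow_mul hl.le]; congr 1; push_cast; ring
        rw [this]; ring

/-! ### Averaged moduli of Sobolev–Slobodeckij functions. -/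

lemma AveragedModulus.congr {σ p C : ℝ} {u u' : ℝ → ℂ} (h : AveragedModulus σ p C u)
    (huu' : u =ᵐ[volume] u') : AveragedModulus σ p C u' := by
  intro η hη
  refine le_trans (le_of_eq ?_) (h η hη)
  refine lintegral_congr_ae ?_
  filter_upwards [huu'] with x hx
  refine lintegral_congr_ae (ae_restrict_of_ae ?_)
  have := (Measure.measurePreserving_sub_left volume x).quasiMeasurePreserving.ae_eq_comp huu'
  filter_upwards [this] with y hy
  simp only [Function.comp_apply] at hy
  rw [hx, hy]

/-- For `0 < y ≤ η` the Gagliardo weight `y^(-(σp+1))` is at least `η^(-(σp+1))`, so restricting the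
seminorm to these increments suffices. -/
lemma averagedModulus_of_gagliardo {σ p : ℝ} (hσ : 0 < σ) (hp : 1 ≤ p) {u : ℝ → ℂ}
    (h : gagliardo σ p u < ⊤) : AveragedModulus σ p (gagliardo σ p u).toReal u := by
  intro η hη
  have hp0 : 0 < p := by linarith
  have hη1 : 0 < η ^ (σ * p + 1) := by positivity
  rw [mul_comm, ENNReal.ofReal_mul hη1.le, ENNReal.ofReal_toReal h.ne, gagliardo,
    ← lintegral_const_mul' _ _ ENNReal.ofReal_ne_top]
  refine lintegral_mono fun x => ?_
  rw [← lintegral_sub_left_eq_self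
    (fun y => ENNReal.ofReal (‖u x - u y‖ ^ p / |x - y| ^ (σ * p + 1))) x, ← lintegral_const_mul' _ _ ENNReal.ofReal_ne_top]
  refine le_trans ?_ (setLIntegral_le_lintegral (Set.Ioc 0 η) _)
  refine setLIntegral_mono_ae' measurableSet_Ioc (ae_of_all _ fun y hy => ?_)
  rw [← ofReal_norm, ENNReal.ofReal_rpow_of_nonneg (norm_nonneg _) hp0.le,
    ← ENNReal.ofReal_mul hη1.le, sub_sub_cancel, abs_of_pos hy.1]
  apply ENNReal.ofReal_le_ofReal
  have hy1 : 0 < y ^ (σ * p + 1) := Real.rpow_pos_of_pos hy.1 _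
  rw [mul_div_assoc', le_div_iff₀ hy1, mul_comm]
  gcongr
  · exact hy.1.le
  · exact hy.2

/-- The window sum `x ↦ ∫_0^y ψ(x + r) dr` of a test function. -/
lemma exists_window_primitive {ψ : ℝ → ℝ} (h1 : ContDiff ℝ (⊤ : ℕ∞) ψ) (h2 : HasCompactSupport ψ)
    {y : ℝ} (hy : 0 < y) : ∃ Ψ : ℝ → ℝ, ContDiff ℝ (⊤ : ℕ∞) Ψ ∧ HasCompactSupport Ψ ∧
      (∀ x, deriv Ψ x = ψ (x + y) - ψ x) ∧ ∀ x, Ψ x = ∫ r in Set.Ioc 0 y, ψ (x + r) := by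
  have hc := h1.continuous
  set P : ℝ → ℝ := fun x => ∫ r in (0 : ℝ)..x, ψ r with hP
  have hPd : ∀ x, HasDerivAt P (ψ x) x := fun x => hc.integral_hasStrictDerivAt 0 x |>.hasDerivAt
  set Ψ : ℝ → ℝ := fun x => P (x + y) - P x with hΨ
  have hd : ∀ x, HasDerivAt Ψ (ψ (x + y) - ψ x) x := fun x =>
    ((hPd (x + y)).comp_add_const x y).sub (hPd x)
  have hform : ∀ x, Ψ x = ∫ r in Set.Ioc 0 y, ψ (x + r) := fun x => by
    rw [← intervalIntegral.integral_of_le hy.le, intervalIntegral.integral_comp_add_left, add_zero]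
    exact intervalIntegral.integral_interval_sub_left (hc.intervalIntegrable _ _)
      (hc.intervalIntegrable _ _)
  have hderiv : deriv Ψ = fun x => ψ (x + y) - ψ x := funext fun x => (hd x).deriv
  refine ⟨Ψ, ?_, ?_, fun x => (hd x).deriv, hform⟩
  · rw [contDiff_infty_iff_deriv, hderiv]
    exact ⟨fun x => (hd x).differentiableAt, (h1.comp (by fun_prop)).sub h1⟩
  · obtain ⟨R, hR⟩ := h2.isCompact.isBounded.subset_closedBall 0
    refine HasCompactSupport.intro (isCompact_closedBall (0 : ℝ) (|R| + y)) fun x hx => ?_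
    rw [hform]
    refine setIntegral_eq_zero_of_forall_eq_zero fun r hr => ?_
    by_contra hne
    have := hR (subset_tsupport _ hne)
    simp only [Metric.mem_closedBall, dist_zero_right, Real.norm_eq_abs, not_le] at hx this
    have h3 : |x| ≤ |x + r| + |r| := by
      have := abs_sub (x + r) r; simpa using this
    rw [abs_of_pos hr.1] at h3
    linarith [hr.2, le_abs_self R]

/-- The supports of all translates with `0 < r ≤ y` lie in one compact ball, where `v` is
integrable. The uniform bound justifies Fubini for a window sum of translates. -/
lemma exists_lintegral_translate_mul_le {ψ : ℝ → ℝ} (h1 : Continuous ψ) (h2 : HasCompactSupport ψ)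
    {v : ℝ → ℂ} (hv : LocallyIntegrable v) (y : ℝ) :
    ∃ B : ℝ≥0∞, B < ⊤ ∧ ∀ r ∈ Set.Ioc 0 y, ∫⁻ x, ‖ψ (x + r) • v x‖ₑ ≤ B := by
  obtain ⟨R, hR⟩ := h2.isCompact.isBounded.subset_closedBall 0
  obtain ⟨M, hM⟩ := h1.bounded_above_of_compact_support h2
  set K := Metric.closedBall (0 : ℝ) (|R| + |y|)
  have hi : IntegrableOn v K := (locallyIntegrable_iff.mp hv) K (isCompact_closedBall _ _)
  refine ⟨ENNReal.ofReal M * ∫⁻ x in K, ‖v x‖ₑ, ENNReal.mul_lt_top ENNReal.ofReal_lt_top hi.2,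
    fun r hr => ?_⟩
  rw [← lintegral_const_mul' _ _ ENNReal.ofReal_ne_top,
    ← lintegral_indicator Metric.isClosed_closedBall.measurableSet]
  refine lintegral_mono fun x => ?_
  by_cases hx : x ∈ K
  · rw [Set.indicator_of_mem hx, enorm_smul]
    gcongr
    rw [← ofReal_norm]
    exact ENNReal.ofReal_le_ofReal (hM _)
  · have : ψ (x + r) = 0 := by
      by_contra hne
      apply hx
      have := hR (subset_tsupport _ hne)
      simp only [K, Metric.mem_closedBall, dist_zero_right, Real.norm_eq_abs] at this ⊢
      have h3 : |x| ≤ |x + r| + |r| := by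
        have := abs_sub (x + r) r; simpa using this
      rw [abs_of_pos hr.1] at h3
      linarith [hr.2, le_abs_self R, le_abs_self y]
    simp [this]

/-- A weakly differentiable function is the primitive of its weak derivative. -/
lemma IsWeakDeriv.sub_translate_ae_eq {u v : ℝ → ℂ} (hvm : Measurable v)
    {p : ℝ} (hp : 1 ≤ p) (hu : MemLp u (ENNReal.ofReal p)) (hv : MemLp v (ENNReal.ofReal p))
    (h : IsWeakDeriv 1 u v) {y : ℝ} (hy : 0 < y) :
    (fun x => u x - u (x - y)) =ᵐ[volume] fun x => (y : ℂ) * avg y v x := by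
  obtain ⟨hul, hvl, hw⟩ := h
  have hp1 : (1 : ℝ≥0∞) ≤ ENNReal.ofReal p := by simpa using hp
  have hut : MemLp (fun x => u (x - y)) (ENNReal.ofReal p) :=
    hu.comp_measurePreserving (measurePreserving_sub_right volume y)
  have hav := memLp_avg hp hy hvm hv
  have hayl : LocallyIntegrable (fun x => (y : ℂ) * avg y v x) := (hav.const_mul _).locallyIntegrable hp1
  refine ae_eq_of_integral_contDiff_smul_eq ((hu.sub hut).locallyIntegrable hp1) hayl
    fun ψ h1 h2 => ?_
  obtain ⟨Ψ, hΨ1, hΨ2, hΨd, hΨ⟩ := exists_window_primitive h1 h2 hy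
  obtain ⟨B, hB, hBb⟩ := exists_lintegral_translate_mul_le h1.continuous h2 hvl y
  have hψm := h1.continuous.measurable
  have hm1 : Measurable (Function.uncurry fun x r : ℝ => ψ (x + r) • v x) :=
    (hψm.comp (measurable_fst.add measurable_snd)).smul (hvm.comp measurable_fst)
  have hm2 : Measurable (Function.uncurry fun x r : ℝ => ψ x • v (x - r)) :=
    (hψm.comp measurable_fst).smul (hvm.comp (measurable_fst.sub measurable_snd))
  have hfin : B * volume (Set.Ioc 0 y) < ⊤ := ENNReal.mul_lt_top hB (by simp)
  have hi1 : Integrable (Function.uncurry fun x r : ℝ => ψ (x + r) • v x)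
      (volume.prod (volume.restrict (Set.Ioc 0 y))) := by
    refine ⟨hm1.aestronglyMeasurable, ?_⟩
    rw [HasFiniteIntegral, lintegral_prod_symm' _ hm1.enorm]
    refine (setLIntegral_mono_ae' measurableSet_Ioc (ae_of_all _ hBb)).trans_lt ?_
    simpa using hfin
  have hi2 : Integrable (Function.uncurry fun x r : ℝ => ψ x • v (x - r))
      (volume.prod (volume.restrict (Set.Ioc 0 y))) := by
    refine ⟨hm2.aestronglyMeasurable, ?_⟩
    rw [HasFiniteIntegral, lintegral_prod_symm' _ hm2.enorm]
    refine (setLIntegral_mono_ae' measurableSet_Ioc (ae_of_all _ fun r hr => ?_)).trans_lt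
      (b := ∫⁻ r in Set.Ioc 0 y, B) (by simpa using hfin)
    refine le_trans (le_of_eq ?_) (hBb r hr)
    rw [← lintegral_sub_right_eq_self (fun x => ‖ψ (x + r) • v x‖ₑ) r]
    simp
  have hsu : Integrable (fun x => ψ x • u x) :=
    hul.integrable_smul_left_of_hasCompactSupport h1.continuous h2
  have hsut : Integrable (fun x => ψ x • u (x - y)) :=
    (hut.locallyIntegrable hp1).integrable_smul_left_of_hasCompactSupport h1.continuous h2
  have hsu' : Integrable (fun x => ψ (x + y) • u x) := by
    have := hsut.comp_add_right y
    simpa using this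
  -- Since `Ψ' = ψ(· + y) - ψ`, testing the weak derivative on `Ψ` yields the difference of `u` on
  -- one side and the average of `v` on the other.
  have hmain := hw Ψ hΨ1 hΨ2
  simp only [iteratedDeriv_one, hΨd, hΨ, pow_one, neg_mul, one_mul] at hmain
  have hL : ∫ x, (ψ (x + y) - ψ x) • u x = -∫ x, ψ x • (u x - u (x - y)) := by
    simp_rw [sub_smul, smul_sub]
    rw [integral_sub hsu' hsu, integral_sub hsu hsut, neg_sub,
      ← integral_sub_right_eq_self (fun x => ψ (x + y) • u x) y]
    simp
  rw [hL, neg_inj] at hmain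
  rw [hmain]
  calc ∫ x, (∫ r in Set.Ioc 0 y, ψ (x + r)) • v x
      = ∫ x, ∫ r in Set.Ioc 0 y, ψ (x + r) • v x := by
        congr 1; ext x; rw [integral_smul_const]
    _ = ∫ r in Set.Ioc 0 y, ∫ x, ψ (x + r) • v x := integral_integral_swap hi1
    _ = ∫ r in Set.Ioc 0 y, ∫ x, ψ x • v (x - r) := by
        congr 1; ext r
        rw [← integral_sub_right_eq_self (fun x => ψ (x + r) • v x) r]
        simp
    _ = ∫ x, ∫ r in Set.Ioc 0 y, ψ x • v (x - r) := (integral_integral_swap hi2).symm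
    _ = _ := by
        congr 1; ext x
        rw [integral_smul, avg, ← Complex.real_smul, smul_smul y, mul_inv_cancel₀ hy.ne', one_smul]

/-- Each difference `u(x) - u(x-y)` is `y` times an average of `v`, hence has `L^p` norm at most `y
‖v‖_p`; integrate over `0 < y ≤ η`. -/
lemma averagedModulus_of_isWeakDeriv {u v : ℝ → ℂ} (hum : Measurable u) (hvm : Measurable v)
    {p : ℝ} (hp : 1 ≤ p) (hu : MemLp u (ENNReal.ofReal p)) (hv : MemLp v (ENNReal.ofReal p))
    (h : IsWeakDeriv 1 u v) : AveragedModulus 1 p (∫⁻ x, ‖v x‖ₑ ^ p).toReal u := by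
  have hp0 : 0 < p := by linarith
  have hfin : ∫⁻ x, ‖v x‖ₑ ^ p ≠ ⊤ := by
    rw [← eLpNorm_ofReal_rpow hp]
    exact ENNReal.rpow_ne_top_of_nonneg hp0.le hv.2.ne
  intro η hη
  have hm : Measurable (Function.uncurry fun x y : ℝ => ‖u x - u (x - y)‖ₑ ^ p) :=
    ((hum.comp measurable_fst).sub (hum.comp (measurable_fst.sub measurable_snd))).enorm.pow_const p
  rw [lintegral_lintegral_swap (by exact hm.aemeasurable)]
  have hb : ∀ y ∈ Set.Ioc 0 η, ∫⁻ x, ‖u x - u (x - y)‖ₑ ^ p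
      ≤ ENNReal.ofReal (η ^ p) * ∫⁻ x, ‖v x‖ₑ ^ p := fun y hy => by
    calc _ = ∫⁻ x, ENNReal.ofReal (y ^ p) * ‖avg y v x‖ₑ ^ p := by
          refine lintegral_congr_ae ?_
          filter_upwards [h.sub_translate_ae_eq hvm hp hu hv hy.1] with x hx
          rw [hx, enorm_mul, ENNReal.mul_rpow_of_nonneg _ _ hp0.le, ← ofReal_norm (y : ℂ),
            ENNReal.ofReal_rpow_of_nonneg (norm_nonneg _) hp0.le, Complex.norm_real,
            Real.norm_of_nonneg hy.1.le]
      _ = ENNReal.ofReal (y ^ p) * eLpNorm (avg y v) (ENNReal.ofReal p) ^ p := by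
          rw [lintegral_const_mul' _ _ ENNReal.ofReal_ne_top, eLpNorm_ofReal_rpow hp]
      _ ≤ _ := by
          rw [← eLpNorm_ofReal_rpow hp]
          gcongr
          · exact hy.1.le
          · exact hy.2
          · exact eLpNorm_avg_le hp hy.1 hvm
  refine (setLIntegral_mono_ae' measurableSet_Ioc (ae_of_all _ hb)).trans_eq ?_
  rw [setLIntegral_const, Real.volume_Ioc, sub_zero, mul_comm _ (∫⁻ x, ‖v x‖ₑ ^ p), mul_assoc,
    ← ENNReal.ofReal_mul (by positivity), ENNReal.ofReal_mul ENNReal.toReal_nonneg,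
    ENNReal.ofReal_toReal hfin, one_mul, Real.rpow_add_one hη.ne']

/-- For every `b < min s 1`, a function in `W^{s,p}` agrees almost everywhere with a Borel function
with an averaged `L^p` modulus of smoothness of some order above `b`. -/
lemma MemW.exists_averagedModulus {s p b : ℝ} (hs : 0 < s) (hp : 1 ≤ p) (hbs : b < s) (hb1 : b < 1)
    {f : ℝ → ℂ} (hf : MemW s p f) :
    ∃ (u : ℝ → ℂ) (σ C : ℝ), f =ᵐ[volume] u ∧ Measurable u ∧ MemLp u (ENNReal.ofReal p) ∧
      b < σ ∧ 0 ≤ C ∧ AveragedModulus σ p C u := by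
  obtain ⟨D, hD0, hD, hG⟩ := hf
  have hfL : MemLp f (ENNReal.ofReal p) := hD0 ▸ (hD 0 (Nat.zero_le _)).2
  obtain ⟨u, hu, hfu⟩ := hfL.1
  have huL : MemLp u (ENNReal.ofReal p) := hfL.ae_eq hfu
  -- Below `1` the Gagliardo seminorm of `f` itself gives `σ = s`. From `1` on, the first weak
  -- derivative gives `σ = 1`, which is enough because `b < 1`.
  rcases lt_or_ge s 1 with h1 | h1
  · have hfl : ⌊s⌋₊ = 0 := Nat.floor_eq_zero.mpr h1
    have hfr : Int.fract s = s := Int.fract_eq_self.mpr ⟨hs.le, h1⟩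
    rw [hfl, hfr, hD0] at hG
    exact ⟨u, s, _, hfu, hu.measurable, huL, hbs, ENNReal.toReal_nonneg,
      (averagedModulus_of_gagliardo hs hp (hG hs.ne')).congr hfu⟩
  · obtain ⟨hw, hvL⟩ := hD 1 (Nat.one_le_floor_iff _ |>.mpr h1)
    obtain ⟨v, hv, hDv⟩ := hvL.1
    have hvL' : MemLp v (ENNReal.ofReal p) := hvL.ae_eq hDv
    have hp1 : (1 : ℝ≥0∞) ≤ ENNReal.ofReal p := by simpa using hp
    refine ⟨u, 1, _, hfu, hu.measurable, huL, hb1, ENNReal.toReal_nonneg,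
      averagedModulus_of_isWeakDeriv hu.measurable hv.measurable hp huL hvL'
      ⟨huL.locallyIntegrable hp1, hvL'.locallyIntegrable hp1, fun φ h1 h2 => ?_⟩⟩
    calc _ = ∫ x, iteratedDeriv 1 φ x • f x := integral_congr_ae (by
            filter_upwards [hfu] with x hx; rw [hx])
      _ = _ := hw.2.2 φ h1 h2
      _ = _ := by
          congr 1
          exact integral_congr_ae (by filter_upwards [hDv] with x hx; rw [hx])

/-! ### Oscillatory integrals: van der Corput estimates. -/

lemma norm_cexp_I_mul (x : ℝ) : ‖Complex.exp (Complex.I * x)‖ = 1 := by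
  rw [mul_comm]; exact Complex.norm_exp_ofReal_mul_I x

/-- The first derivative test for oscillatory integrals. -/
lemma norm_integral_le_of_deriv {φ φ₁ φ₂ : ℝ → ℝ} {a b μ : ℝ} (hab : a ≤ b) (hμ : 0 < μ)
    (h1 : ∀ x ∈ Set.Icc a b, HasDerivAt φ (φ₁ x) x)
    (h2 : ∀ x ∈ Set.Icc a b, HasDerivAt φ₁ (φ₂ x) x) (hc : ContinuousOn φ₂ (Set.Icc a b))
    (hlow : ∀ x ∈ Set.Icc a b, μ ≤ |φ₁ x|)
    (hsgn : (∀ x ∈ Set.Icc a b, 0 ≤ φ₂ x) ∨ ∀ x ∈ Set.Icc a b, φ₂ x ≤ 0) :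
    ‖∫ x in a..b, Complex.exp (Complex.I * φ x)‖ ≤ 4 / μ := by
  have hne : ∀ x ∈ Set.Icc a b, φ₁ x ≠ 0 := fun x hx h0 => by
    have := hlow x hx; rw [h0, abs_zero] at this; linarith
  have hu : Set.uIcc a b = Set.Icc a b := Set.uIcc_of_le hab
  have hφc : ContinuousOn φ (Set.Icc a b) := fun x hx => (h1 x hx).continuousAt.continuousWithinAt
  have hφ₁c : ContinuousOn φ₁ (Set.Icc a b) :=
    fun x hx => (h2 x hx).continuousAt.continuousWithinAt
  have hinv : ∀ x ∈ Set.Icc a b, |(φ₁ x)⁻¹| ≤ μ⁻¹ := fun x hx => by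
    rw [abs_inv]; exact inv_anti₀ hμ (hlow x hx)
  set e : ℝ → ℂ := fun x => Complex.exp (Complex.I * φ x) with he
  have hec : ContinuousOn e (Set.Icc a b) := by
    have := Complex.continuous_ofReal.comp_continuousOn hφc
    exact Complex.continuous_exp.comp_continuousOn (continuousOn_const.mul this)
  set w : ℝ → ℝ := fun x => -φ₂ x / φ₁ x ^ 2 with hw
  have hwc : ContinuousOn w (Set.Icc a b) :=
    hc.neg.div (hφ₁c.pow 2) fun x hx => pow_ne_zero _ (hne x hx)
  have hwd : ∀ x ∈ Set.Icc a b, HasDerivAt (fun y => (φ₁ y)⁻¹) (w x) x := fun x hx =>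
    (h2 x hx).inv (hne x hx)
  have hG : ∀ x ∈ Set.Icc a b, HasDerivAt (fun y => e y * (((φ₁ y)⁻¹ : ℝ) : ℂ))
      (Complex.I * e x + e x * (w x : ℂ)) x := fun x hx => by
    have hd1 : HasDerivAt e (e x * (Complex.I * (φ₁ x : ℂ))) x :=
      ((h1 x hx).ofReal_comp.const_mul Complex.I).cexp
    have := hd1.mul (hwd x hx).ofReal_comp
    have h0 : (φ₁ x : ℂ) ≠ 0 := by exact_mod_cast hne x hx
    have h3 : e x * (Complex.I * (φ₁ x : ℂ)) * (((φ₁ x)⁻¹ : ℝ) : ℂ) = Complex.I * e x := by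
      rw [Complex.ofReal_inv, ← mul_assoc, mul_assoc, mul_inv_cancel₀ h0, mul_one, mul_comm]
    rwa [h3] at this
  have hci : IntervalIntegrable e volume a b := (hu ▸ hec).intervalIntegrable
  have hew : ContinuousOn (fun x => e x * (w x : ℂ)) (Set.Icc a b) :=
    hec.mul (Complex.continuous_ofReal.comp_continuousOn hwc)
  have hewi : IntervalIntegrable (fun x => e x * (w x : ℂ)) volume a b :=
    (hu ▸ hew).intervalIntegrable
  have hftc := intervalIntegral.integral_eq_sub_of_hasDerivAt (fun x hx => hG x (hu ▸ hx))
    ((hci.const_mul Complex.I).add hewi)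
  rw [intervalIntegral.integral_add (hci.const_mul Complex.I) hewi,
    intervalIntegral.integral_const_mul] at hftc
  have hwftc : ∫ x in a..b, w x = (φ₁ b)⁻¹ - (φ₁ a)⁻¹ :=
    intervalIntegral.integral_eq_sub_of_hasDerivAt (fun x hx => hwd x (hu ▸ hx))
      (hu ▸ hwc).intervalIntegrable
  have ha : a ∈ Set.Icc a b := Set.left_mem_Icc.mpr hab
  have hb : b ∈ Set.Icc a b := Set.right_mem_Icc.mpr hab
  -- `w` is the derivative of `1/φ₁` and has constant sign, so its total variation is read off from
  -- the endpoints.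
  have habsw : ∫ x in a..b, |w x| ≤ 2 / μ := by
    have key : |∫ x in a..b, w x| ≤ 2 / μ := by
      rw [hwftc]
      refine (abs_sub _ _).trans ?_
      have := hinv a ha; have := hinv b hb
      rw [div_eq_mul_inv]; linarith
    rcases hsgn with hs | hs
    · rw [intervalIntegral.integral_congr (g := fun x => -w x) fun x hx => abs_of_nonpos ?_,
        intervalIntegral.integral_neg]
      · exact (neg_le_abs _).trans key
      · exact div_nonpos_of_nonpos_of_nonneg (neg_nonpos.mpr (hs x (hu ▸ hx))) (sq_nonneg _)
    · rw [intervalIntegral.integral_congr (g := w) fun x hx => abs_of_nonneg ?_]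
      · exact (le_abs_self _).trans key
      · exact div_nonneg (neg_nonneg.mpr (hs x (hu ▸ hx))) (sq_nonneg _)
  have hrem : ‖∫ x in a..b, e x * (w x : ℂ)‖ ≤ 2 / μ := by
    refine (intervalIntegral.norm_integral_le_integral_norm hab).trans ?_
    refine le_trans (le_of_eq ?_) habsw
    congr 1; ext x
    rw [norm_mul, he, norm_cexp_I_mul, one_mul, Complex.norm_real, Real.norm_eq_abs]
  have hend : ∀ x ∈ Set.Icc a b, ‖e x * (((φ₁ x)⁻¹ : ℝ) : ℂ)‖ ≤ μ⁻¹ := fun x hx => by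
    rw [norm_mul, he, norm_cexp_I_mul, one_mul, Complex.norm_real, Real.norm_eq_abs]
    exact hinv x hx
  have hfin : ‖Complex.I * ∫ x in a..b, e x‖ ≤ 4 / μ := by
    rw [eq_sub_of_add_eq hftc]
    refine (norm_sub_le _ _).trans ?_
    refine (add_le_add (norm_sub_le _ _) hrem).trans ?_
    have := hend a ha; have := hend b hb
    rw [show 4 / μ = μ⁻¹ + μ⁻¹ + 2 / μ by ring]
    linarith
  rwa [norm_mul, Complex.norm_I, one_mul] at hfin

/-- `φ₁` increases at rate at least `μ`; the centre is its zero if it changes sign, and otherwise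
the endpoint where it is closest to zero. -/
lemma exists_center_of_deriv_ge {φ₁ φ₂ : ℝ → ℝ} {a b μ : ℝ} (hab : a ≤ b)
    (h2 : ∀ x ∈ Set.Icc a b, HasDerivAt φ₁ (φ₂ x) x)
    (hlow : ∀ x ∈ Set.Icc a b, μ ≤ φ₂ x) :
    ∃ c ∈ Set.Icc a b, ∀ x ∈ Set.Icc a b, μ * |x - c| ≤ |φ₁ x| := by
  have hφ₁c : ContinuousOn φ₁ (Set.Icc a b) :=
    fun x hx => (h2 x hx).continuousAt.continuousWithinAt
  have hmvt : ∀ x ∈ Set.Icc a b, ∀ y ∈ Set.Icc a b, x ≤ y → μ * (y - x) ≤ φ₁ y - φ₁ x := by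
    refine (convex_Icc a b).mul_sub_le_image_sub_of_le_deriv hφ₁c ?_ ?_
    · exact fun x hx => (h2 x (interior_subset hx)).differentiableAt.differentiableWithinAt
    · intro x hx
      rw [(h2 x (interior_subset hx)).deriv]
      exact hlow x (interior_subset hx)
  have ha : a ∈ Set.Icc a b := Set.left_mem_Icc.mpr hab
  have hb : b ∈ Set.Icc a b := Set.right_mem_Icc.mpr hab
  rcases le_or_gt 0 (φ₁ a) with h0 | h0
  · refine ⟨a, ha, fun x hx => ?_⟩
    have := hmvt a ha x hx hx.1
    rw [abs_of_nonneg (sub_nonneg.mpr hx.1)]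
    exact le_trans (by linarith) (le_abs_self _)
  rcases le_or_gt (φ₁ b) 0 with h0' | h0'
  · refine ⟨b, hb, fun x hx => ?_⟩
    have := hmvt x hx b hb hx.2
    rw [abs_of_nonpos (sub_nonpos.mpr hx.2)]
    exact le_trans (by linarith) (neg_le_abs _)
  obtain ⟨c, hc, hc0⟩ := intermediate_value_Icc hab hφ₁c ⟨h0.le, h0'.le⟩
  refine ⟨c, hc, fun x hx => ?_⟩
  rcases le_total c x with hcx | hcx
  · have := hmvt c hc x hx hcx
    rw [abs_of_nonneg (sub_nonneg.mpr hcx)]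
    exact le_trans (by linarith) (le_abs_self _)
  · have := hmvt x hx c hc hcx
    rw [abs_of_nonpos (sub_nonpos.mpr hcx)]
    exact le_trans (by linarith) (neg_le_abs _)

/-- The second derivative test (van der Corput's lemma). -/
lemma norm_integral_le_of_deriv2 {φ φ₁ φ₂ : ℝ → ℝ} {a b μ : ℝ} (hab : a ≤ b) (hμ : 0 < μ)
    (h1 : ∀ x ∈ Set.Icc a b, HasDerivAt φ (φ₁ x) x)
    (h2 : ∀ x ∈ Set.Icc a b, HasDerivAt φ₁ (φ₂ x) x) (hc : ContinuousOn φ₂ (Set.Icc a b))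
    (hlow : (∀ x ∈ Set.Icc a b, μ ≤ φ₂ x) ∨ ∀ x ∈ Set.Icc a b, φ₂ x ≤ -μ) :
    ‖∫ x in a..b, Complex.exp (Complex.I * φ x)‖ ≤ 10 / √μ := by
  have hsgn : (∀ x ∈ Set.Icc a b, 0 ≤ φ₂ x) ∨ ∀ x ∈ Set.Icc a b, φ₂ x ≤ 0 :=
    hlow.imp (fun h x hx => hμ.le.trans (h x hx)) fun h x hx => (h x hx).trans (by linarith)
  obtain ⟨c, hcI, hcen⟩ : ∃ c ∈ Set.Icc a b, ∀ x ∈ Set.Icc a b, μ * |x - c| ≤ |φ₁ x| := by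
    rcases hlow with h | h
    · exact exists_center_of_deriv_ge hab h2 h
    · obtain ⟨c, hc, hc'⟩ := exists_center_of_deriv_ge (φ₁ := fun x => -φ₁ x) hab
        (fun x hx => (h2 x hx).neg) (fun x hx => by linarith [h x hx])
      exact ⟨c, hc, fun x hx => by simpa using hc' x hx⟩
  have hsμ : 0 < √μ := Real.sqrt_pos.mpr hμ
  -- This width balances the trivial bound `2h` near the centre with the first derivative bound
  -- `4/(μh)` on each side; the total is `4 + 2 + 4 = 10` times `1/√μ`.
  set h : ℝ := (√μ)⁻¹ with hh
  have hh0 : 0 < h := by positivity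
  have hμh : μ * h = √μ := by
    rw [hh, ← div_eq_mul_inv, Real.div_sqrt]
  have hφc : ContinuousOn φ (Set.Icc a b) := fun x hx => (h1 x hx).continuousAt.continuousWithinAt
  have hec : ContinuousOn (fun x => Complex.exp (Complex.I * φ x)) (Set.Icc a b) := by
    have := Complex.continuous_ofReal.comp_continuousOn hφc
    exact Complex.continuous_exp.comp_continuousOn (continuousOn_const.mul this)
  have hii : ∀ x y, a ≤ x → x ≤ y → y ≤ b →
      IntervalIntegrable (fun x => Complex.exp (Complex.I * φ x)) volume x y :=
    fun x y hx hxy hy => (hec.mono (by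
      rw [Set.uIcc_of_le hxy]; exact Set.Icc_subset_Icc hx hy)).intervalIntegrable
  have hpart : ∀ x y, a ≤ x → x ≤ y → y ≤ b → (∀ z ∈ Set.Icc x y, h ≤ |z - c|) →
      ‖∫ x in x..y, Complex.exp (Complex.I * φ x)‖ ≤ 4 / √μ := fun x y hx hxy hy hz => by
    have hsub : Set.Icc x y ⊆ Set.Icc a b := Set.Icc_subset_Icc hx hy
    refine norm_integral_le_of_deriv hxy hsμ (fun z hz => h1 z (hsub hz))
      (fun z hz => h2 z (hsub hz)) (hc.mono hsub) (fun z hzI => ?_)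
      (hsgn.imp (fun h z hz => h z (hsub hz)) fun h z hz => h z (hsub hz))
    refine le_trans ?_ (hcen z (hsub hzI))
    rw [← hμh]
    exact mul_le_mul_of_nonneg_left (hz z hzI) hμ.le
  have hleft : ∀ x, a ≤ x → x ≤ b → (x = a ∨ x ≤ c - h) →
      ‖∫ x in a..x, Complex.exp (Complex.I * φ x)‖ ≤ 4 / √μ := fun x hx hxb hxc => by
    rcases hxc with rfl | hxc
    · simp; positivity
    · refine hpart a x le_rfl hx hxb fun z hz => ?_
      rw [abs_sub_comm]
      exact le_trans (by linarith [hz.2]) (le_abs_self _)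
  have hright : ∀ x, a ≤ x → x ≤ b → (x = b ∨ c + h ≤ x) →
      ‖∫ x in x..b, Complex.exp (Complex.I * φ x)‖ ≤ 4 / √μ := fun x hx hxb hxc => by
    rcases hxc with rfl | hxc
    · simp; positivity
    · refine hpart x b hx hxb le_rfl fun z hz => ?_
      exact le_trans (by linarith [hz.1]) (le_abs_self _)
  set x₁ := max a (c - h) with hx₁
  set x₂ := min b (c + h) with hx₂
  have e1 : a ≤ x₁ := le_max_left _ _
  have e2 : x₂ ≤ b := min_le_left _ _
  have e3 : x₁ ≤ c := max_le hcI.1 (by linarith)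
  have e4 : c ≤ x₂ := le_min hcI.2 (by linarith)
  have e5 : c - h ≤ x₁ := le_max_right _ _
  have e6 : x₂ ≤ c + h := min_le_right _ _
  have hmid : ‖∫ x in x₁..x₂, Complex.exp (Complex.I * φ x)‖ ≤ 2 * h := by
    refine (intervalIntegral.norm_integral_le_of_norm_le_const (C := 1)
      fun x _ => (norm_cexp_I_mul _).le).trans ?_
    rw [one_mul, abs_of_nonneg (by linarith)]
    linarith
  have hl := hleft x₁ e1 (by linarith) (by
    rcases max_choice a (c - h) with h' | h'
    · exact Or.inl h'
    · exact Or.inr h'.le)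
  have hr := hright x₂ (by linarith) e2 (by
    rcases min_choice b (c + h) with h' | h'
    · exact Or.inl h'
    · exact Or.inr h'.ge)
  rw [← intervalIntegral.integral_add_adjacent_intervals (hii a x₂ le_rfl (by linarith) e2)
    (hii x₂ b (by linarith) e2 le_rfl),
    ← intervalIntegral.integral_add_adjacent_intervals (hii a x₁ le_rfl e1 (by linarith))
    (hii x₁ x₂ e1 (by linarith) e2)]
  refine (norm_add_le _ _).trans ?_
  refine (add_le_add (norm_add_le _ _) le_rfl).trans ?_
  rw [show 10 / √μ = 4 / √μ + 2 * h + 4 / √μ by rw [hh]; field_simp; norm_num]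
  linarith

/-- A nonnegative decreasing amplitude does not spoil bounds for oscillatory integrals. -/
lemma norm_integral_mul_le_of_antitone {φ A A' : ℝ → ℝ} {a b M : ℝ} (hab : a ≤ b)
    (hφ : Continuous φ) (hA : ∀ x ∈ Set.Icc a b, HasDerivAt A (A' x) x)
    (hA'c : ContinuousOn A' (Set.Icc a b)) (hA' : ∀ x ∈ Set.Icc a b, A' x ≤ 0) (hAb : 0 ≤ A b)
    (hM : ∀ x ∈ Set.Icc a b, ‖∫ y in a..x, Complex.exp (Complex.I * φ y)‖ ≤ M) :
    ‖∫ x in a..b, Complex.exp (Complex.I * φ x) * (A x : ℂ)‖ ≤ M * A a := by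
  have hu : Set.uIcc a b = Set.Icc a b := Set.uIcc_of_le hab
  have hec : Continuous (fun x => Complex.exp (Complex.I * φ x)) := by fun_prop
  set F : ℝ → ℂ := fun x => ∫ y in a..x, Complex.exp (Complex.I * φ y) with hF
  have hFd : ∀ x, HasDerivAt F (Complex.exp (Complex.I * φ x)) x := fun x =>
    (hec.integral_hasStrictDerivAt a x).hasDerivAt
  have hFc : Continuous F := continuous_iff_continuousAt.mpr fun x => (hFd x).continuousAt
  have hparts := intervalIntegral.integral_deriv_mul_eq_sub
    (u := F) (v := fun x => (A x : ℂ)) (u' := fun x => Complex.exp (Complex.I * φ x))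
    (v' := fun x => (A' x : ℂ)) (fun x _ => hFd x) (fun x hx => (hA x (hu ▸ hx)).ofReal_comp)
    (hec.intervalIntegrable _ _)
    (hu ▸ Complex.continuous_ofReal.comp_continuousOn hA'c).intervalIntegrable
  have hAc : ContinuousOn A (Set.Icc a b) := fun x hx => (hA x hx).continuousAt.continuousWithinAt
  have hi1 : IntervalIntegrable (fun x => Complex.exp (Complex.I * φ x) * (A x : ℂ)) volume a b :=
    (hu ▸ (hec.continuousOn.mul (Complex.continuous_ofReal.comp_continuousOn
      hAc))).intervalIntegrable
  have hi2 : IntervalIntegrable (fun x => F x * (A' x : ℂ)) volume a b :=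
    (hu ▸ (hFc.continuousOn.mul (Complex.continuous_ofReal.comp_continuousOn
      hA'c))).intervalIntegrable
  have hi3 : IntervalIntegrable A' volume a b := (hu ▸ hA'c).intervalIntegrable
  rw [intervalIntegral.integral_add hi1 hi2] at hparts
  rw [eq_sub_of_add_eq hparts]
  have hFa : F a = 0 := intervalIntegral.integral_same
  rw [hFa, zero_mul, sub_zero]
  have hb : b ∈ Set.Icc a b := Set.right_mem_Icc.mpr hab
  have hrem : ‖∫ x in a..b, F x * (A' x : ℂ)‖ ≤ M * (A a - A b) := by
    have h1 : ‖∫ x in a..b, F x * (A' x : ℂ)‖ ≤ ∫ x in a..b, M * -A' x := by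
      refine intervalIntegral.norm_integral_le_of_norm_le hab (ae_of_all _ fun x hx => ?_)
        (hi3.neg.const_mul M)
      have hx' : x ∈ Set.Icc a b := ⟨hx.1.le, hx.2⟩
      rw [norm_mul, Complex.norm_real, Real.norm_of_nonpos (hA' x hx')]
      exact mul_le_mul_of_nonneg_right (hM x hx') (neg_nonneg.mpr (hA' x hx'))
    refine h1.trans_eq ?_
    rw [intervalIntegral.integral_const_mul, intervalIntegral.integral_neg,
      intervalIntegral.integral_eq_sub_of_hasDerivAt (fun x hx => hA x (hu ▸ hx)) hi3]
    ring
  refine (norm_sub_le _ _).trans ?_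
  rw [norm_mul, Complex.norm_real, Real.norm_of_nonneg hAb]
  have := mul_le_mul_of_nonneg_right (hM b hb) hAb
  linarith

/-! ### Bounds for the damped oscillatory kernel. -/

/-- The oscillatory kernel of the damped propagator, localised to frequencies in `[l, 2l]`. -/
def kernel (a l r τ q : ℝ) : ℂ :=
  ∫ ξ in l..2 * l, Complex.exp (Complex.I * ((r * ξ + τ * ξ ^ a : ℝ) : ℂ)) *
    ((Real.exp (-(q * ξ ^ a)) : ℝ) : ℂ)

/-- The damping factor is nonnegative and decreasing in `ξ`, so only its value at the left endpoint
enters. -/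
lemma norm_kernel_le {a l r τ q M : ℝ} (ha : 0 < a) (hl : 0 < l) (hq : 0 ≤ q)
    (hM : ∀ x ∈ Set.Icc l (2 * l),
      ‖∫ ξ in l..x, Complex.exp (Complex.I * ((r * ξ + τ * ξ ^ a : ℝ) : ℂ))‖ ≤ M) :
    ‖kernel a l r τ q‖ ≤ M * Real.exp (-(q * l ^ a)) := by
  have hpos : ∀ x ∈ Set.Icc l (2 * l), x ≠ 0 := fun x hx => (hl.trans_le hx.1).ne'
  refine norm_integral_mul_le_of_antitone (φ := fun ξ => r * ξ + τ * ξ ^ a)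
    (A := fun ξ => Real.exp (-(q * ξ ^ a)))
    (A' := fun ξ => Real.exp (-(q * ξ ^ a)) * -(q * (a * ξ ^ (a - 1)))) (by linarith) ?_
    (fun x hx => ?_) ?_ (fun x hx => ?_) (Real.exp_pos _).le hM
  · have : Continuous fun ξ : ℝ => ξ ^ a := Real.continuous_rpow_const ha.le
    fun_prop
  · exact (((Real.hasDerivAt_rpow_const (Or.inl (hpos x hx))).const_mul q).neg).exp
  · have h1 : ContinuousOn (fun ξ : ℝ => ξ ^ a) (Set.Icc l (2 * l)) :=
      (Real.continuous_rpow_const ha.le).continuousOn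
    have h2 : ContinuousOn (fun ξ : ℝ => ξ ^ (a - 1)) (Set.Icc l (2 * l)) :=
      continuousOn_id.rpow_const fun x hx => Or.inl (hpos x hx)
    fun_prop
  · have : 0 < x := hl.trans_le hx.1
    have h3 : 0 ≤ q * (a * x ^ (a - 1)) := by positivity
    nlinarith [Real.exp_pos (-(q * x ^ a))]

lemma hasDerivAt_phase {a r τ x : ℝ} (hx : 0 < x) :
    HasDerivAt (fun ξ => r * ξ + τ * ξ ^ a) (r + τ * (a * x ^ (a - 1))) x := by
  have := ((hasDerivAt_id x).const_mul r).add
    ((Real.hasDerivAt_rpow_const (p := a) (Or.inl hx.ne')).const_mul τ)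
  rw [mul_one] at this
  exact this

lemma hasDerivAt_phase_deriv {a r τ x : ℝ} (hx : 0 < x) :
    HasDerivAt (fun ξ => r + τ * (a * ξ ^ (a - 1))) (τ * (a * ((a - 1) * x ^ (a - 2)))) x := by
  have := (((Real.hasDerivAt_rpow_const (p := a - 1) (Or.inl hx.ne')).const_mul a).const_mul
    τ).const_add r
  rwa [show a - 1 - 1 = a - 2 by ring] at this

lemma continuousOn_phase_deriv2 {a τ l x : ℝ} (hl : 0 < l) :
    ContinuousOn (fun ξ => τ * (a * ((a - 1) * ξ ^ (a - 2)))) (Set.Icc l x) := by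
  have h2 : ContinuousOn (fun ξ : ℝ => ξ ^ (a - 2)) (Set.Icc l x) :=
    continuousOn_id.rpow_const fun x hx => Or.inl (hl.trans_le hx.1).ne'
  fun_prop

lemma norm_kernel_le_trivial {a l r τ q : ℝ} (ha : 0 < a) (hl : 0 < l) (hq : 0 ≤ q) :
    ‖kernel a l r τ q‖ ≤ l * Real.exp (-(q * l ^ a)) := by
  refine norm_kernel_le ha hl hq fun x hx => ?_
  refine (intervalIntegral.norm_integral_le_of_norm_le_const (C := 1)
    fun x _ => (norm_cexp_I_mul _).le).trans ?_
  rw [one_mul, abs_of_nonneg (by linarith [hx.1])]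
  linarith [hx.2]

lemma exp_neg_mul_rpow_le_one {a l q : ℝ} (hl : 0 < l) (hq : 0 ≤ q) :
    Real.exp (-(q * l ^ a)) ≤ 1 :=
  Real.exp_le_one_iff.mpr (neg_nonpos.mpr (by positivity))

/-- The linear term dominates, so `|φ'| ≥ |r|/2`, while `φ''` keeps the sign of `τa(a-1)`: the first
derivative test applies. -/
lemma norm_kernel_le_nonstationary {a l r τ q : ℝ} (ha : 0 < a) (hl : 0 < l) (hq : 0 ≤ q)
    (hr : r ≠ 0) (hns : ∀ ξ ∈ Set.Icc l (2 * l), |τ| * (a * ξ ^ (a - 1)) ≤ |r| / 2) :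
    ‖kernel a l r τ q‖ ≤ 8 / |r| := by
  have hr0 : 0 < |r| := abs_pos.mpr hr
  have h := norm_kernel_le (M := 4 / (|r| / 2)) ha hl hq (r := r) (τ := τ) fun x hx => ?_
  · refine h.trans ?_
    calc 4 / (|r| / 2) * Real.exp (-(q * l ^ a)) ≤ 4 / (|r| / 2) * 1 := by
          gcongr; exact exp_neg_mul_rpow_le_one hl hq
      _ = 8 / |r| := by field_simp; norm_num
  · have hpos : ∀ ξ ∈ Set.Icc l x, 0 < ξ := fun ξ hξ => hl.trans_le hξ.1
    refine norm_integral_le_of_deriv hx.1 (by positivity) (fun ξ hξ => hasDerivAt_phase (hpos ξ hξ))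
      (fun ξ hξ => hasDerivAt_phase_deriv (hpos ξ hξ)) (continuousOn_phase_deriv2 hl)
      (fun ξ hξ => ?_) ?_
    · have h1 := hns ξ ⟨hξ.1, hξ.2.trans hx.2⟩
      have hpw : 0 ≤ a * ξ ^ (a - 1) := mul_nonneg ha.le (Real.rpow_nonneg (hpos ξ hξ).le _)
      have h2 : |r| ≤ |r + τ * (a * ξ ^ (a - 1))| + |τ * (a * ξ ^ (a - 1))| := by
        have := abs_sub (r + τ * (a * ξ ^ (a - 1))) (τ * (a * ξ ^ (a - 1)))
        simpa using this
      rw [abs_mul τ, abs_of_nonneg hpw] at h2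
      linarith
    · rcases le_total 0 (τ * (a * (a - 1))) with h0 | h0
      · left; intro ξ hξ
        have := mul_nonneg h0 (Real.rpow_nonneg (hpos ξ hξ).le (a - 2))
        linarith
      · right; intro ξ hξ
        have := mul_nonpos_of_nonpos_of_nonneg h0 (Real.rpow_nonneg (hpos ξ hξ).le (a - 2))
        linarith

lemma rpow_dyadic_bounds {l ξ b : ℝ} (hl : 0 < l) (h1 : l ≤ ξ) (h2 : ξ ≤ 2 * l) :
    (2 : ℝ) ^ (-|b|) * l ^ b ≤ ξ ^ b ∧ ξ ^ b ≤ 2 ^ |b| * l ^ b := by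
  have hξ : ξ = ξ / l * l := by field_simp
  have ht1 : 1 ≤ ξ / l := (one_le_div hl).mpr h1
  have ht2 : ξ / l ≤ 2 := (div_le_iff₀ hl).mpr h2
  rw [hξ, Real.mul_rpow (by positivity) hl.le]
  have ht0 : 0 < ξ / l := by positivity
  constructor
  · gcongr
    calc (2 : ℝ) ^ (-|b|) ≤ (ξ / l) ^ (-|b|) :=
          Real.rpow_le_rpow_of_nonpos ht0 ht2 (by simp)
      _ ≤ _ := Real.rpow_le_rpow_of_exponent_le ht1 (neg_abs_le b)
  · gcongr
    calc (ξ / l) ^ b ≤ (ξ / l) ^ |b| := Real.rpow_le_rpow_of_exponent_le ht1 (le_abs_self b)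
      _ ≤ _ := Real.rpow_le_rpow ht0.le ht2 (abs_nonneg b)

/-- Here `|φ''|` is comparable to `|τ| l^(a-2)`, which is at least `c|r|/l` up to a constant. The
second derivative test gives `(l/|r|)^(1/2)`, and the damping is kept for later use. -/
lemma norm_kernel_le_stationary {a l r τ q c : ℝ} (ha : 0 < a) (ha1 : a ≠ 1) (hl : 0 < l)
    (hq : 0 ≤ q) (hr : r ≠ 0) (hc : 0 < c) (hst : c * |r| ≤ |τ| * l ^ (a - 1)) :
    ‖kernel a l r τ q‖ ≤ 10 / √(c * (a * |a - 1| * 2 ^ (-|a - 2|)) * (|r| / l)) *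
      Real.exp (-(q * l ^ a)) := by
  have hr0 : 0 < |r| := abs_pos.mpr hr
  have ha10 : 0 < |a - 1| := abs_pos.mpr (sub_ne_zero.mpr ha1)
  set μ := c * (a * |a - 1| * 2 ^ (-|a - 2|)) * (|r| / l) with hμ
  have hμ0 : 0 < μ := by positivity
  refine norm_kernel_le ha hl hq fun x hx => ?_
  have hpos : ∀ ξ ∈ Set.Icc l x, 0 < ξ := fun ξ hξ => hl.trans_le hξ.1
  have hlow : ∀ ξ ∈ Set.Icc l x, μ ≤ |τ * (a * (a - 1))| * ξ ^ (a - 2) := fun ξ hξ => by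
    have hb := (rpow_dyadic_bounds (b := a - 2) hl hξ.1 (hξ.2.trans hx.2)).1
    have hla : l ^ (a - 2) = l ^ (a - 1) / l := by
      rw [show a - 2 = (a - 1) - 1 by ring, Real.rpow_sub_one hl.ne']
    rw [abs_mul, abs_mul, abs_of_pos ha]
    calc μ = (a * |a - 1|) * 2 ^ (-|a - 2|) * ((c * |r|) / l) := by rw [hμ]; ring
      _ ≤ (a * |a - 1|) * 2 ^ (-|a - 2|) * ((|τ| * l ^ (a - 1)) / l) := by gcongr
      _ = |τ| * (a * |a - 1|) * (2 ^ (-|a - 2|) * l ^ (a - 2)) := by rw [hla]; ring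
      _ ≤ _ := by gcongr
  refine norm_integral_le_of_deriv2 hx.1 hμ0 (fun ξ hξ => hasDerivAt_phase (hpos ξ hξ))
    (fun ξ hξ => hasDerivAt_phase_deriv (hpos ξ hξ)) (continuousOn_phase_deriv2 hl) ?_
  rcases le_total 0 (τ * (a * (a - 1))) with h0 | h0
  · left; intro ξ hξ
    have := hlow ξ hξ
    rw [abs_of_nonneg h0] at this
    linarith
  · right; intro ξ hξ
    have := hlow ξ hξ
    rw [abs_of_nonpos h0] at this
    linarith

lemma exp_neg_le_rpow_neg {z θ : ℝ} (hz : 0 < z) (hθ0 : 0 ≤ θ) (hθ1 : θ ≤ 1) :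
    Real.exp (-z) ≤ z ^ (-θ) := by
  rw [Real.exp_neg, Real.rpow_neg hz.le]
  apply inv_anti₀ (by positivity)
  rcases le_total z 1 with h | h
  · exact (Real.rpow_le_one hz.le h hθ0).trans (Real.one_le_exp hz.le)
  · calc z ^ θ ≤ z ^ (1 : ℝ) := Real.rpow_le_rpow_of_exponent_le h hθ1
      _ = z := Real.rpow_one z
      _ ≤ _ := by linarith [Real.add_one_le_exp z]

/-- The damping turns the stationary bound into an integrable power of `r`. -/
lemma damping_bound {a γ ρ α η c l r τ q : ℝ} (ha : 0 < a) (hγ : 1 < γ) (hc : 0 < c) (hl : 1 ≤ l)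
    (hr : r ≠ 0) (hα1 : α ≤ 1) (hη0 : 0 < η) (hηα : η ≤ α)
    (hη : η + α * (a * (1 - 1 / γ)) ≤ 2 * ρ) (hst : c * |r| ≤ |τ| * l ^ (a - 1))
    (hq : |τ| ^ γ ≤ q) :
    l ^ α * |r| ^ (-(1 - α)) * Real.exp (-(q * l ^ a))
      ≤ c ^ (-(α - η)) * (l ^ (2 * ρ) * |r| ^ (-1 + η)) := by
  have hr0 : 0 < |r| := abs_pos.mpr hr
  have hl0 : 0 < l := by linarith
  have hγ0 : 0 < γ := by linarith
  -- Chosen so that `z₀^(-θ)` supplies `|r|^(-(α-η))`, which completes `|r|^(-(1-α))` to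
  -- `|r|^(-1+η)`.
  set θ := (α - η) / γ with hθ
  have hθ0 : 0 ≤ θ := div_nonneg (by linarith) hγ0.le
  have hθ1 : θ ≤ 1 := (div_le_one hγ0).mpr (by linarith)
  have hθγ : γ * θ = α - η := by rw [hθ]; field_simp
  set z₀ := (c * |r| * l ^ (1 - a)) ^ γ * l ^ a with hz₀
  have hz₀p : 0 < z₀ := by positivity
  have hτ : c * |r| * l ^ (1 - a) ≤ |τ| := by
    calc _ ≤ |τ| * l ^ (a - 1) * l ^ (1 - a) := by gcongr
      _ = |τ| := by
        rw [mul_assoc, ← Real.rpow_add hl0, show a - 1 + (1 - a) = 0 by ring, Real.rpow_zero,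
          mul_one]
  have hz : z₀ ≤ q * l ^ a := by
    rw [hz₀]; gcongr
    exact (Real.rpow_le_rpow (by positivity) hτ hγ0.le).trans hq
  have hexp : Real.exp (-(q * l ^ a)) ≤ z₀ ^ (-θ) :=
    (Real.exp_le_exp.mpr (neg_le_neg hz)).trans (exp_neg_le_rpow_neg hz₀p hθ0 hθ1)
  have hz₀θ : z₀ ^ (-θ) = c ^ (-(α - η)) * |r| ^ (-(α - η)) *
      l ^ ((1 - a) * (-(α - η)) + a * (-θ)) := by
    rw [hz₀, Real.mul_rpow (by positivity) (by positivity), ← Real.rpow_mul (by positivity),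
      ← Real.rpow_mul hl0.le, mul_neg, hθγ, Real.mul_rpow (by positivity) (by positivity),
      Real.mul_rpow hc.le hr0.le, ← Real.rpow_mul hl0.le, mul_assoc, mul_assoc, ← Real.rpow_add hl0,
      ← mul_assoc]
  calc _ ≤ l ^ α * |r| ^ (-(1 - α)) * z₀ ^ (-θ) := by gcongr
    _ = c ^ (-(α - η)) * ((l ^ α * l ^ ((1 - a) * (-(α - η)) + a * (-θ))) *
        (|r| ^ (-(1 - α)) * |r| ^ (-(α - η)))) := by rw [hz₀θ]; ring
    _ = c ^ (-(α - η)) * (l ^ (α + ((1 - a) * (-(α - η)) + a * (-θ))) * |r| ^ (-1 + η)) := by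
        rw [← Real.rpow_add hl0, ← Real.rpow_add hr0]
        congr 3; ring
    _ ≤ _ := by
        gcongr
        have h1 : α + ((1 - a) * (-(α - η)) + a * (-θ)) = η + (α - η) * (a * (1 - 1 / γ)) := by
          rw [hθ]; field_simp; ring
        have h2 : 0 ≤ a * (1 - 1 / γ) := mul_nonneg ha.le (sub_nonneg.mpr
          ((div_le_one hγ0).mpr hγ.le))
        rw [h1]
        nlinarith

/-- The smoothness threshold for the maximal estimate in `L²`. -/
def AboveThreshold (a γ ρ : ℝ) : Prop :=
  (a ≠ 1 ∧ a * (1 - 1 / γ) / 4 < ρ) ∨ (a = 1 ∧ (1 - 1 / γ) / 2 < ρ) ∨ (1 < a ∧ 1 / 4 < ρ)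

/-- The exponent `-1 + η` makes the bound integrable in `r` near `0`, as Schur's test requires, and
the constants do not depend on the times. The three alternatives for `ρ` are curvature with damping,
damping alone (`a = 1` has no curvature), and curvature alone. -/
theorem exists_kernel_bound {a γ ρ : ℝ} (ha : 0 < a) (hγ : 1 < γ) (hρ : AboveThreshold a γ ρ) :
    ∃ C η : ℝ, 0 ≤ C ∧ 0 < η ∧ η ≤ 1 ∧ ∀ l r τ q : ℝ, 1 ≤ l → r ≠ 0 → |r| ≤ 1 → |τ| ^ γ ≤ q →
      ‖kernel a l r τ q‖ ≤ C * (l ^ (2 * ρ) * |r| ^ (-1 + η)) := by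
  have hγ0 : 0 < γ := by linarith
  have hg0 : 0 < 1 - 1 / γ := sub_pos.mpr ((div_lt_one hγ0).mpr hγ)
  -- If the nonstationary condition fails at one `ξ` of the annulus, comparing `ξ^(a-1)` with
  -- `l^(a-1)` gives `c|r| ≤ |τ| l^(a-1)` with this `c`.
  set c : ℝ := (2 * a * 2 ^ |a - 1|)⁻¹ with hc
  have hc0 : 0 < c := by positivity
  have hnonst : ∀ η l r τ q : ℝ, 0 < η → η ≤ 1 → η ≤ 2 * ρ → 1 ≤ l → r ≠ 0 → 0 ≤ q →
      (∀ ξ ∈ Set.Icc l (2 * l), |τ| * (a * ξ ^ (a - 1)) ≤ |r| / 2) →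
      ‖kernel a l r τ q‖ ≤ 8 * (l ^ (2 * ρ) * |r| ^ (-1 + η)) := by
    intro η l r τ q hη hη1 hηρ hl hr hq hns
    have hr0 : 0 < |r| := abs_pos.mpr hr
    have hl0 : 0 < l := by linarith
    have h1 := norm_kernel_le_nonstationary ha hl0 hq hr hns
    have h2 : ‖kernel a l r τ q‖ ≤ l := (norm_kernel_le_trivial ha hl0 hq).trans
      (mul_le_of_le_one_right hl0.le (exp_neg_mul_rpow_le_one hl0 hq))
    rcases (norm_nonneg (kernel a l r τ q)).eq_or_lt with h0 | h0
    · rw [← h0]; positivity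
    -- Geometric mean of the bounds `l` and `8/|r|`: the latter alone just fails to be integrable.
    calc ‖kernel a l r τ q‖ = ‖kernel a l r τ q‖ ^ η * ‖kernel a l r τ q‖ ^ (1 - η) := by
          rw [← Real.rpow_add h0, add_sub_cancel, Real.rpow_one]
      _ ≤ l ^ η * (8 / |r|) ^ (1 - η) := by gcongr
      _ = 8 ^ (1 - η) * (l ^ η * |r| ^ (-1 + η)) := by
          rw [Real.div_rpow (by norm_num) hr0.le, show -1 + η = -(1 - η) by ring,
            Real.rpow_neg hr0.le]
          ring
      _ ≤ 8 ^ (1 : ℝ) * (l ^ (2 * ρ) * |r| ^ (-1 + η)) := by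
          gcongr
          · norm_num
          · linarith
      _ = _ := by rw [Real.rpow_one]
  have hstat : ∀ l r τ : ℝ, 1 ≤ l →
      (¬ ∀ ξ ∈ Set.Icc l (2 * l), |τ| * (a * ξ ^ (a - 1)) ≤ |r| / 2) →
      c * |r| ≤ |τ| * l ^ (a - 1) := by
    intro l r τ hl hns
    push Not at hns
    obtain ⟨ξ, hξ, hlt⟩ := hns
    have hb := (rpow_dyadic_bounds (b := a - 1) (by linarith) hξ.1 hξ.2).2
    rw [hc, inv_mul_le_iff₀ (by positivity)]
    have : |τ| * (a * ξ ^ (a - 1)) ≤ |τ| * (a * (2 ^ |a - 1| * l ^ (a - 1))) := by gcongr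
    linarith
  set K : ℝ := 10 / √(c * (a * |a - 1| * 2 ^ (-|a - 2|))) with hK
  have hK0 : 0 ≤ K := by positivity
  have hvdc : a ≠ 1 → ∀ l r τ q : ℝ, 1 ≤ l → r ≠ 0 → 0 ≤ q → c * |r| ≤ |τ| * l ^ (a - 1) →
      ‖kernel a l r τ q‖ ≤ K * (l ^ (1 / 2 : ℝ) * |r| ^ (-(1 - 1 / 2) : ℝ) *
        Real.exp (-(q * l ^ a))) := by
    intro ha1 l r τ q hl hr hq hst
    have hr0 : 0 < |r| := abs_pos.mpr hr
    have hl0 : 0 < l := by linarith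
    refine (norm_kernel_le_stationary ha ha1 hl0 hq hr hc0 hst).trans_eq ?_
    rw [hK, Real.sqrt_mul (by positivity), Real.sqrt_div (by positivity),
      show (-(1 - 1 / 2) : ℝ) = -(1 / 2) by norm_num, Real.rpow_neg hr0.le,
      Real.sqrt_eq_rpow |r|, Real.sqrt_eq_rpow l]
    field_simp
  rcases hρ with ⟨ha1, hρ⟩ | ⟨rfl, hρ⟩ | ⟨ha1, hρ⟩
  -- `η` is the slack in the strict threshold, capped so that `η ≤ α` for `α = 1/2`, the exponent
  -- given by van der Corput.
  · set η := min (1 / 4) (2 * ρ - 1 / 2 * (a * (1 - 1 / γ))) with hη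
    have hη0 : 0 < η := lt_min (by norm_num) (by linarith)
    have hη4 : η ≤ 1 / 4 := min_le_left _ _
    have hη2 : η ≤ 2 * ρ - 1 / 2 * (a * (1 - 1 / γ)) := min_le_right _ _
    have hag : 0 < a * (1 - 1 / γ) := by positivity
    refine ⟨max 8 (K * c ^ (-(1 / 2 - η))), η, by positivity, hη0, by linarith,
      fun l r τ q hl hr hr1 hq => ?_⟩
    have hq0 : 0 ≤ q := le_trans (by positivity) hq
    by_cases hns : ∀ ξ ∈ Set.Icc l (2 * l), |τ| * (a * ξ ^ (a - 1)) ≤ |r| / 2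
    · refine (hnonst η l r τ q hη0 (by linarith) (by linarith) hl hr hq0 hns).trans ?_
      gcongr
      exact le_max_left _ _
    · have hst := hstat l r τ hl hns
      refine (hvdc ha1 l r τ q hl hr hq0 hst).trans ?_
      refine (mul_le_mul_of_nonneg_left (damping_bound (ρ := ρ) ha hγ hc0 hl hr (by norm_num) hη0
        (by linarith) (by linarith) hst hq) hK0).trans ?_
      rw [← mul_assoc]
      gcongr
      exact le_max_right _ _
  -- With a linear phase the trivial bound `l` replaces van der Corput, which corresponds to `α =
  -- 1`.
  · set η := min (1 / 2) (2 * ρ - (1 - 1 / γ)) with hη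
    have hη0 : 0 < η := lt_min (by norm_num) (by linarith)
    have hη4 : η ≤ 1 / 2 := min_le_left _ _
    have hη2 : η ≤ 2 * ρ - (1 - 1 / γ) := min_le_right _ _
    refine ⟨max 8 (c ^ (-(1 - η))), η, by positivity, hη0, by linarith,
      fun l r τ q hl hr hr1 hq => ?_⟩
    have hq0 : 0 ≤ q := le_trans (by positivity) hq
    by_cases hns : ∀ ξ ∈ Set.Icc l (2 * l), |τ| * (1 * ξ ^ ((1 : ℝ) - 1)) ≤ |r| / 2
    · refine (hnonst η l r τ q hη0 (by linarith) (by linarith) hl hr hq0 hns).trans ?_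
      gcongr
      exact le_max_left _ _
    · have hst := hstat l r τ hl hns
      have h1 := norm_kernel_le_trivial (r := r) (τ := τ) ha (by linarith : 0 < l) hq0
      have h2 := damping_bound (α := 1) (ρ := ρ) ha hγ hc0 hl hr (by norm_num) hη0
        (by linarith) (by linarith) hst hq
      simp only [sub_self, neg_zero, Real.rpow_zero, mul_one, Real.rpow_one] at h1 h2
      refine (h1.trans h2).trans ?_
      gcongr
      exact le_max_right _ _
  -- The bound `(l/|r|)^(1/2)` is already integrable in `r`, so the damping is discarded and `η =
  -- 1/2`.
  · refine ⟨max 8 K, 1 / 2, by positivity, by norm_num, by norm_num,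
      fun l r τ q hl hr hr1 hq => ?_⟩
    have hq0 : 0 ≤ q := le_trans (by positivity) hq
    by_cases hns : ∀ ξ ∈ Set.Icc l (2 * l), |τ| * (a * ξ ^ (a - 1)) ≤ |r| / 2
    · refine (hnonst (1 / 2) l r τ q (by norm_num) (by norm_num) (by linarith) hl hr hq0 hns).trans ?_
      gcongr
      exact le_max_left _ _
    · have hst := hstat l r τ hl hns
      have hr0 : 0 < |r| := abs_pos.mpr hr
      refine (hvdc ha1.ne' l r τ q hl hr hq0 hst).trans ?_
      calc _ ≤ K * (l ^ (1 / 2 : ℝ) * |r| ^ (-(1 - 1 / 2) : ℝ) * 1) := by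
            gcongr; exact exp_neg_mul_rpow_le_one (by linarith) hq0
        _ ≤ max 8 K * (l ^ (2 * ρ) * |r| ^ (-1 + 1 / 2 : ℝ)) := by
            rw [mul_one, show (-(1 - 1 / 2) : ℝ) = -1 + 1 / 2 by norm_num]
            gcongr
            · exact le_max_right _ _
            · linarith

/-! ### The `T T*` argument. -/

lemma mul_le_sq_add_sq (a b : ℝ≥0∞) : a * b ≤ a ^ 2 + b ^ 2 := by
  rcases le_total a b with h | h
  · refine le_add_left ?_
    rw [sq]; gcongr
  · refine le_add_right ?_
    rw [sq]; gcongr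

lemma sq_lintegral_mul_le {α : Type*} [MeasurableSpace α] {ν : Measure α} {u v : α → ℝ≥0∞}
    (hu : AEMeasurable u ν) (hv : AEMeasurable v ν) :
    (∫⁻ x, u x * v x ∂ν) ^ 2 ≤ (∫⁻ x, u x ^ 2 ∂ν) * ∫⁻ x, v x ^ 2 ∂ν := by
  have h := ENNReal.lintegral_mul_le_Lp_mul_Lq ν Real.HolderConjugate.two_two hu hv
  calc _ ≤ ((∫⁻ x, u x ^ (2 : ℝ) ∂ν) ^ (1 / 2 : ℝ) * (∫⁻ x, v x ^ (2 : ℝ) ∂ν) ^ (1 / 2 : ℝ)) ^ 2 := by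
        gcongr; exact h
    _ = _ := by
        rw [mul_pow, ← ENNReal.rpow_natCast, ← ENNReal.rpow_natCast, ← ENNReal.rpow_mul,
          ← ENNReal.rpow_mul]
        norm_num

lemma lintegral_sq_eq_enorm_integral {α : Type*} [MeasurableSpace α] (m : Measure α) {u : α → ℂ}
    (hu : Measurable u) (hf : ∫⁻ y, ‖u y‖ₑ ^ 2 ∂m ≠ ⊤) :
    ∫⁻ y, ‖u y‖ₑ ^ 2 ∂m = ‖∫ y, u y * conj (u y) ∂m‖ₑ := by
  have hself : ∀ z : ℂ, z * conj z = ((‖z‖ ^ 2 : ℝ) : ℂ) := fun z => by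
    rw [Complex.mul_conj, Complex.normSq_eq_norm_sq]
  simp_rw [hself]
  rw [integral_complex_ofReal, ← ofReal_norm, Complex.norm_real, Real.norm_of_nonneg
    (integral_nonneg fun _ => sq_nonneg _), ofReal_integral_eq_lintegral_ofReal]
  · congr 1; ext y
    rw [← ofReal_norm, ENNReal.ofReal_pow (norm_nonneg _)]
  · refine ⟨(hu.norm.pow_const 2).aestronglyMeasurable, ?_⟩
    refine lt_of_le_of_lt (lintegral_mono fun y => le_of_eq ?_) hf.lt_top
    rw [← ofReal_norm (‖u y‖ ^ 2), Real.norm_of_nonneg (sq_nonneg _),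
      ENNReal.ofReal_pow (norm_nonneg _), ofReal_norm]
  · exact ae_of_all _ fun _ => sq_nonneg _

/-- The `T T*` argument with Schur's test. -/
lemma lintegral_sq_integral_le_of_kernel {X Ξ : Type*} [MeasurableSpace X] [MeasurableSpace Ξ]
    {μ : Measure X} {ν : Measure Ξ} [IsFiniteMeasure μ] [IsFiniteMeasure ν] {e : X → Ξ → ℂ}
    (he : Measurable (Function.uncurry e)) (hb : ∀ x ξ, ‖e x ξ‖ ≤ 1) {k : X → X → ℝ≥0∞}
    (hkm : Measurable (Function.uncurry k)) (hsymm : ∀ x y, k x y = k y x)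
    (hk : ∀ᵐ x ∂μ, ∀ᵐ y ∂μ, ‖∫ ξ, e x ξ * conj (e y ξ) ∂ν‖ₑ ≤ k x y)
    {A : ℝ≥0∞} (hA : ∀ᵐ x ∂μ, ∫⁻ y, k x y ∂μ ≤ A) {g : Ξ → ℂ} (hgm : Measurable g)
    (hg : MemLp g 2 ν) :
    ∫⁻ x, ‖∫ ξ, g ξ * e x ξ ∂ν‖ₑ ^ 2 ∂μ ≤ 2 * A * ∫⁻ ξ, ‖g ξ‖ₑ ^ 2 ∂ν := by
  have hgi : Integrable g ν := hg.integrable (by norm_num)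
  have hex : ∀ x, Measurable (e x) := fun x => he.of_uncurry_left
  have heξ : ∀ ξ, Measurable (fun x => e x ξ) := fun ξ => he.of_uncurry_right
  have hcm : Measurable (conj : ℂ → ℂ) := Complex.continuous_conj.measurable
  set T : X → ℂ := fun x => ∫ ξ, g ξ * e x ξ ∂ν with hT
  have hTm : Measurable T := by
    have : StronglyMeasurable (Function.uncurry fun x ξ => g ξ * e x ξ) :=
      ((hgm.comp measurable_snd).mul he).stronglyMeasurable
    exact (this.integral_prod_right (ν := ν)).measurable
  set B : ℝ := ∫ ξ, ‖g ξ‖ ∂ν with hB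
  have hTb : ∀ x, ‖T x‖ ≤ B := fun x => by
    refine norm_integral_le_of_norm_le hgi.norm (ae_of_all _ fun ξ => ?_)
    rw [norm_mul]
    exact mul_le_of_le_one_right (norm_nonneg _) (hb x ξ)
  set h : X → ℂ := fun x => conj (T x) with hh
  have hhm : Measurable h := hcm.comp hTm
  have hhb : ∀ x, ‖h x‖ ≤ B := fun x => by rw [hh, RCLike.norm_conj]; exact hTb x
  have hhT : ∀ x, ‖h x‖ₑ = ‖T x‖ₑ := fun x => by
    rw [← ofReal_norm, ← ofReal_norm, hh, RCLike.norm_conj]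
  have hB0 : 0 ≤ B := integral_nonneg fun _ => norm_nonneg _
  set H : Ξ → ℂ := fun ξ => ∫ x, e x ξ * h x ∂μ with hH
  have hmeh : Measurable (Function.uncurry fun x ξ => e x ξ * h x) :=
    he.mul (hhm.comp measurable_fst)
  have hHm : Measurable H :=
    (hmeh.stronglyMeasurable.integral_prod_left (μ := μ)).measurable
  have hehb : ∀ x ξ, ‖e x ξ * h x‖ ≤ B := fun x ξ => by
    rw [norm_mul]
    exact (mul_le_of_le_one_left (norm_nonneg _) (hb x ξ)).trans (hhb x)
  set B' : ℝ := B * μ.real Set.univ with hB'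
  have hHb : ∀ ξ, ‖H ξ‖ ≤ B' := fun ξ => norm_integral_le_of_norm_le_const
    (ae_of_all _ fun x => hehb x ξ)
  set Q : ℝ≥0∞ := ∫⁻ x, ‖T x‖ₑ ^ 2 ∂μ with hQ
  -- Finiteness, which comes from the finite measures, lets `Q` be cancelled from `Q² ≤ 2AQ ‖g‖²` at
  -- the end.
  have hQfin : Q ≠ ⊤ := by
    have : ∀ x, ‖T x‖ₑ ^ 2 ≤ ENNReal.ofReal B ^ 2 := fun x => by
      rw [← ofReal_norm]
      gcongr
      exact hTb x
    refine ((lintegral_mono this).trans_lt ?_).ne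
    rw [lintegral_const]
    exact ENNReal.mul_lt_top (ENNReal.pow_lt_top ENNReal.ofReal_lt_top) (measure_lt_top _ _)
  have hdual : ∫ x, T x * h x ∂μ = ∫ ξ, g ξ * H ξ ∂ν := by
    have hi : Integrable (Function.uncurry fun x ξ => g ξ * (e x ξ * h x)) (μ.prod ν) := by
      have h1 : Integrable (fun z : X × Ξ => g z.2) (μ.prod ν) := hgi.comp_snd _
      exact h1.mul_bdd (c := B) hmeh.aestronglyMeasurable (ae_of_all _ fun z => hehb _ _)
    calc _ = ∫ x, ∫ ξ, g ξ * (e x ξ * h x) ∂ν ∂μ := by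
          congr 1; ext x
          rw [hT, ← integral_mul_const]
          congr 1; ext ξ; ring
      _ = ∫ ξ, ∫ x, g ξ * (e x ξ * h x) ∂μ ∂ν := integral_integral_swap hi
      _ = _ := by
          congr 1; ext ξ
          rw [integral_const_mul]
  have hHfin : ∫⁻ ξ, ‖H ξ‖ₑ ^ 2 ∂ν ≠ ⊤ := by
    have : ∀ ξ, ‖H ξ‖ₑ ^ 2 ≤ ENNReal.ofReal B' ^ 2 := fun x => by
      rw [← ofReal_norm]
      gcongr
      exact hHb x
    refine ((lintegral_mono this).trans_lt ?_).ne
    rw [lintegral_const]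
    exact ENNReal.mul_lt_top (ENNReal.pow_lt_top ENNReal.ofReal_lt_top) (measure_lt_top _ _)
  have hTT : ∫ ξ, H ξ * conj (H ξ) ∂ν
      = ∫ x, h x * ∫ y, conj (h y) * ∫ ξ, e x ξ * conj (e y ξ) ∂ν ∂μ ∂μ := by
    have hi1 : Integrable (Function.uncurry fun ξ x => e x ξ * h x * conj (H ξ)) (ν.prod μ) := by
      refine Integrable.of_bound (C := B * B') ?_ (ae_of_all _ fun z => ?_)
      · exact ((hmeh.comp measurable_swap).mul
          (hcm.comp (hHm.comp measurable_fst))).aestronglyMeasurable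
      · simp only [Function.uncurry]
        rw [norm_mul, RCLike.norm_conj]
        exact mul_le_mul (hehb _ _) (hHb _) (norm_nonneg _) hB0
    have hi2 : ∀ x, Integrable (Function.uncurry fun ξ y => e x ξ * conj (e y ξ * h y))
        (ν.prod μ) := fun x => by
      refine Integrable.of_bound (C := B) ?_ (ae_of_all _ fun z => ?_)
      · exact (((hex x).comp measurable_fst).mul
          (hcm.comp (hmeh.comp measurable_swap))).aestronglyMeasurable
      · simp only [Function.uncurry]
        rw [norm_mul, RCLike.norm_conj]
        exact (mul_le_of_le_one_left (norm_nonneg _) (hb _ _)).trans (hehb _ _)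
    calc _ = ∫ ξ, ∫ x, e x ξ * h x * conj (H ξ) ∂μ ∂ν := by
          congr 1; ext ξ
          rw [integral_mul_const]
      _ = ∫ x, ∫ ξ, e x ξ * h x * conj (H ξ) ∂ν ∂μ := integral_integral_swap hi1
      _ = ∫ x, h x * ∫ ξ, ∫ y, e x ξ * conj (e y ξ * h y) ∂μ ∂ν ∂μ := by
          congr 1; ext x
          rw [← integral_const_mul]
          congr 1; ext ξ
          rw [integral_const_mul, integral_conj]
          ring
      _ = ∫ x, h x * ∫ y, ∫ ξ, e x ξ * conj (e y ξ * h y) ∂ν ∂μ ∂μ := by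
          congr 1; ext x
          rw [integral_integral_swap (hi2 x)]
      _ = _ := by
          congr 1; ext x; congr 2; ext y
          rw [← integral_const_mul]
          congr 1; ext ξ
          rw [map_mul]; ring
  -- Schur's test: bound `|T x||T y| k` by `(|T x|² + |T y|²) k`; by symmetry of `k` the two halves
  -- are equal.
  have hHle : ∫⁻ ξ, ‖H ξ‖ₑ ^ 2 ∂ν ≤ 2 * A * Q := by
    rw [lintegral_sq_eq_enorm_integral ν hHm hHfin, hTT]
    have hm1 : Measurable (Function.uncurry fun x y => ‖T x‖ₑ ^ 2 * k x y) :=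
      ((hTm.comp measurable_fst).enorm.pow_const 2).mul hkm
    have hm2 : Measurable (Function.uncurry fun x y => ‖T y‖ₑ ^ 2 * k x y) :=
      ((hTm.comp measurable_snd).enorm.pow_const 2).mul hkm
    have hhalf : ∫⁻ x, ∫⁻ y, ‖T x‖ₑ ^ 2 * k x y ∂μ ∂μ ≤ A * Q := by
      calc _ ≤ ∫⁻ x, A * ‖T x‖ₑ ^ 2 ∂μ := by
            refine lintegral_mono_ae ?_
            filter_upwards [hA] with x hx
            rw [lintegral_const_mul _ hkm.of_uncurry_left, mul_comm]
            gcongr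
        _ = _ := lintegral_const_mul _ (hTm.enorm.pow_const 2)
    calc _ ≤ ∫⁻ x, ‖h x * ∫ y, conj (h y) * ∫ ξ, e x ξ * conj (e y ξ) ∂ν ∂μ‖ₑ ∂μ :=
          enorm_integral_le_lintegral_enorm _
      _ ≤ ∫⁻ x, ∫⁻ y, (‖T x‖ₑ ^ 2 * k x y + ‖T y‖ₑ ^ 2 * k x y) ∂μ ∂μ := by
          refine lintegral_mono_ae ?_
          filter_upwards [hk] with x hx
          rw [enorm_mul]
          refine (mul_le_mul_right (enorm_integral_le_lintegral_enorm _) _).trans ?_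
          rw [← lintegral_const_mul' _ _ (by simp)]
          refine lintegral_mono_ae ?_
          filter_upwards [hx] with y hy
          rw [enorm_mul, ← mul_assoc, ← add_mul]
          have : ‖conj (h y)‖ₑ = ‖T y‖ₑ := by
            rw [← ofReal_norm, RCLike.norm_conj, ofReal_norm, hhT]
          rw [this, hhT]
          gcongr
          exact mul_le_sq_add_sq _ _
      _ = (∫⁻ x, ∫⁻ y, ‖T x‖ₑ ^ 2 * k x y ∂μ ∂μ) + ∫⁻ x, ∫⁻ y, ‖T y‖ₑ ^ 2 * k x y ∂μ ∂μ := by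
          rw [← lintegral_add_left (f := fun x => ∫⁻ y, ‖T x‖ₑ ^ 2 * k x y ∂μ)
            hm1.lintegral_prod_right']
          congr 1; ext x
          rw [lintegral_add_left]
          exact hm1.of_uncurry_left
      _ ≤ A * Q + A * Q := by
          refine add_le_add hhalf ?_
          rw [lintegral_lintegral_swap (by exact hm2.aemeasurable)]
          refine le_trans (le_of_eq ?_) hhalf
          congr 1; ext x; congr 1; ext y
          rw [hsymm]
      _ = _ := by ring
  have hmain : Q ^ 2 ≤ (∫⁻ ξ, ‖g ξ‖ₑ ^ 2 ∂ν) * (2 * A * Q) := by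
    have h1 : Q ≤ ∫⁻ ξ, ‖g ξ‖ₑ * ‖H ξ‖ₑ ∂ν := by
      rw [hQ, lintegral_sq_eq_enorm_integral μ hTm hQfin]
      change ‖∫ x, T x * h x ∂μ‖ₑ ≤ _
      rw [hdual]
      refine (enorm_integral_le_lintegral_enorm _).trans_eq ?_
      simp_rw [enorm_mul]
    calc Q ^ 2 ≤ (∫⁻ ξ, ‖g ξ‖ₑ * ‖H ξ‖ₑ ∂ν) ^ 2 := by gcongr
      _ ≤ _ := sq_lintegral_mul_le hgm.enorm.aemeasurable hHm.enorm.aemeasurable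
      _ ≤ _ := by gcongr
  rcases eq_or_ne Q 0 with h0 | h0
  · rw [h0]; exact zero_le
  · rw [sq, ← mul_assoc] at hmain
    have := (ENNReal.mul_le_mul_iff_left h0 hQfin).mp hmain
    rwa [mul_comm] at this

/-! ### The propagator and its maximal function on a dyadic annulus. -/

/-- The symbol `e^{ixξ} e^{it|ξ|^a} e^{-t^γ|ξ|^a}` of the propagator at the point `x`. -/
def propagator (a γ t x ξ : ℝ) : ℂ :=
  Complex.exp (Complex.I * x * ξ) * Complex.exp (Complex.I * t * ((|ξ| ^ a : ℝ) : ℂ))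
    * Complex.exp (-((t ^ γ * |ξ| ^ a : ℝ) : ℂ))

lemma landauIntegrand_eq (a γ : ℝ) (f : ℝ → ℂ) (t x ξ : ℝ) :
    landauIntegrand a γ f t x ξ = fourierHat f ξ * propagator a γ t x ξ := by
  simp only [landauIntegrand, propagator]
  ring

lemma norm_propagator (a γ t x ξ : ℝ) :
    ‖propagator a γ t x ξ‖ = Real.exp (-(t ^ γ * |ξ| ^ a)) := by
  simp only [propagator, norm_mul, Complex.norm_exp]
  simp

lemma norm_propagator_le {a γ t x ξ : ℝ} (ht : 0 ≤ t) : ‖propagator a γ t x ξ‖ ≤ 1 := by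
  rw [norm_propagator]
  exact Real.exp_le_one_iff.mpr (neg_nonpos.mpr (by positivity))

lemma propagator_mul_conj (a γ t t' x y ξ : ℝ) :
    propagator a γ t x ξ * conj (propagator a γ t' y ξ)
      = Complex.exp (Complex.I * (((x - y) * ξ + (t - t') * |ξ| ^ a : ℝ) : ℂ)) *
        ((Real.exp (-((t ^ γ + t' ^ γ) * |ξ| ^ a)) : ℝ) : ℂ) := by
  simp only [propagator, map_mul, ← Complex.exp_conj, map_neg, Complex.conj_ofReal, Complex.conj_I,
    Complex.ofReal_exp]
  simp only [← Complex.exp_add]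
  congr 1
  push_cast
  ring

lemma continuous_propagator_freq {a : ℝ} (ha : 0 < a) (γ t x : ℝ) :
    Continuous (propagator a γ t x) := by
  have h : Continuous fun ξ : ℝ => ((|ξ| ^ a : ℝ) : ℂ) :=
    Complex.continuous_ofReal.comp ((Real.continuous_rpow_const ha.le).comp continuous_abs)
  unfold propagator
  simp only [Complex.ofReal_mul]
  fun_prop

/-- The dyadic frequency annulus `l ≤ |ξ| < 2l`. -/
def annulus (l : ℝ) : Set ℝ := {ξ | l ≤ |ξ| ∧ |ξ| < 2 * l}

lemma annulus_eq {l : ℝ} (hl : 0 < l) :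
    annulus l = Set.Ico l (2 * l) ∪ Set.Ioc (-(2 * l)) (-l) := by
  ext ξ
  simp only [annulus, Set.mem_ofPred_eq, Set.mem_union, Set.mem_Ico, Set.mem_Ioc]
  rcases le_total 0 ξ with h | h
  · rw [abs_of_nonneg h]
    constructor
    · exact Or.inl
    · rintro (h' | h')
      · exact h'
      · linarith [h'.2]
  · rw [abs_of_nonpos h]
    constructor
    · rintro ⟨h1, h2⟩; right; constructor <;> linarith
    · rintro (h' | h')
      · linarith [h'.1]
      · constructor <;> linarith [h'.1, h'.2]

lemma isBounded_annulus (l : ℝ) : Bornology.IsBounded (annulus l) :=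
  (Metric.isBounded_ball (x := (0 : ℝ)) (r := 2 * l)).subset fun ξ hξ => by
    simpa using hξ.2

instance isFiniteMeasure_annulus (l : ℝ) : IsFiniteMeasure (volume.restrict (annulus l)) :=
  ⟨by simpa using (isBounded_annulus l).measure_lt_top⟩

lemma integral_annulus {l : ℝ} (hl : 0 < l) {F : ℝ → ℂ} (hF : Continuous F) :
    ∫ ξ in annulus l, F ξ = (∫ ξ in l..2 * l, F ξ) + ∫ ξ in l..2 * l, F (-ξ) := by
  have hi : ∀ s : Set ℝ, Bornology.IsBounded s → IntegrableOn F s := fun s hs =>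
    (hF.locallyIntegrable.integrableOn_isCompact hs.isCompact_closure).mono_set subset_closure
  rw [annulus_eq hl, setIntegral_union _ measurableSet_Ioc (hi _ (Metric.isBounded_Ico _ _))
    (hi _ (Metric.isBounded_Ioc _ _)), integral_Ico_eq_integral_Ioc,
    ← intervalIntegral.integral_of_le (by linarith), intervalIntegral.integral_comp_neg,
    ← intervalIntegral.integral_of_le (by linarith)]
  rw [Set.disjoint_left]
  intro ξ h1 h2
  linarith [h1.1, h2.2]

/-- Apart from `e^{ixξ}` the symbol depends on `|ξ|` only, so folding negative frequencies onto
positive ones just reverses the sign of `x - y`. -/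
lemma integral_annulus_propagator_mul_conj {a : ℝ} (ha : 0 < a) {l : ℝ} (hl : 0 < l)
    (γ t t' x y : ℝ) :
    ∫ ξ in annulus l, propagator a γ t x ξ * conj (propagator a γ t' y ξ)
      = kernel a l (x - y) (t - t') (t ^ γ + t' ^ γ)
        + kernel a l (-(x - y)) (t - t') (t ^ γ + t' ^ γ) := by
  rw [integral_annulus hl (F := fun ξ => propagator a γ t x ξ * conj (propagator a γ t' y ξ))
    ((continuous_propagator_freq ha _ _ _).mul
      (Complex.continuous_conj.comp (continuous_propagator_freq ha _ _ _)))]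
  have hpos : ∀ ξ ∈ Set.uIcc l (2 * l), 0 < ξ := fun ξ hξ => by
    rw [Set.uIcc_of_le (by linarith)] at hξ; exact hl.trans_le hξ.1
  congr 1
  · refine intervalIntegral.integral_congr fun ξ hξ => ?_
    simp only [propagator_mul_conj, abs_of_pos (hpos ξ hξ)]
  · refine intervalIntegral.integral_congr fun ξ hξ => ?_
    simp only [propagator_mul_conj, abs_neg, abs_of_pos (hpos ξ hξ)]
    congr 4
    ring

/-- This is the hypothesis `|τ|^γ ≤ q` of the kernel bound: widely separated times are strongly
damped. -/
lemma abs_sub_rpow_le {γ t t' : ℝ} (hγ : 0 ≤ γ) (ht : 0 ≤ t) (ht' : 0 ≤ t') :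
    |t - t'| ^ γ ≤ t ^ γ + t' ^ γ := by
  have h1 : 0 ≤ t ^ γ := by positivity
  have h2 : 0 ≤ t' ^ γ := by positivity
  rcases le_total t t' with h | h
  · rw [abs_of_nonpos (by linarith)]
    have := Real.rpow_le_rpow (by linarith) (by linarith : -(t - t') ≤ t') hγ
    linarith
  · rw [abs_of_nonneg (by linarith)]
    have := Real.rpow_le_rpow (by linarith) (by linarith : t - t' ≤ t) hγ
    linarith

lemma lintegral_abs_rpow_lt_top {r : ℝ} (hr : -1 < r) :
    ∫⁻ z in Set.Ioc (-1 : ℝ) 1, ENNReal.ofReal (|z| ^ r) < ⊤ := by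
  have h1 : IntervalIntegrable (fun z : ℝ => |z| ^ r) volume 0 1 :=
    (intervalIntegral.intervalIntegrable_rpow' hr).congr fun z hz => by
      rw [Set.uIoc_of_le zero_le_one] at hz
      simp only [abs_of_pos hz.1]
  have h2 : IntervalIntegrable (fun z : ℝ => |z| ^ r) volume (-1) 0 := by
    simpa using ((IntervalIntegrable.iff_comp_neg (by simp)).mp h1).symm
  have h3 := (intervalIntegrable_iff_integrableOn_Ioc_of_le (by norm_num)).mp (h2.trans h1)
  exact h3.lintegral_lt_top

lemma lintegral_Ioc_abs_sub_le {n x : ℝ} (hx : x ∈ Set.Ioc n (n + 1)) (F : ℝ → ℝ≥0∞) :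
    ∫⁻ y in Set.Ioc n (n + 1), F (x - y) ≤ ∫⁻ z in Set.Ioc (-1 : ℝ) 1, F z := by
  rw [← lintegral_indicator measurableSet_Ioc, ← lintegral_indicator measurableSet_Ioc,
    ← lintegral_sub_left_eq_self ((Set.Ioc (-1 : ℝ) 1).indicator F) x]
  refine lintegral_mono (Set.indicator_le (g := fun y => (Set.Ioc (-1 : ℝ) 1).indicator F (x - y))
    fun y hy => ?_)
  rw [Set.indicator_of_mem]
  constructor <;> linarith [hx.1, hx.2, hy.1, hy.2]

/-- Maximal estimate along a measurable choice of times. -/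
theorem exists_linearized_maximal_bound {a γ ρ : ℝ} (ha : 0 < a) (hγ : 1 < γ)
    (hρ : AboveThreshold a γ ρ) : ∃ C : ℝ≥0∞, C ≠ ⊤ ∧ ∀ (l n : ℝ) (t : ℝ → ℝ) (g : ℝ → ℂ), 1 ≤ l →
      Measurable t → (∀ x, 0 < t x) → Measurable g → MemLp g 2 (volume.restrict (annulus l)) →
      ∫⁻ x in Set.Ioc n (n + 1), ‖∫ ξ in annulus l, g ξ * propagator a γ (t x) x ξ‖ₑ ^ 2
        ≤ C * ENNReal.ofReal (l ^ (2 * ρ)) * ∫⁻ ξ in annulus l, ‖g ξ‖ₑ ^ 2 := by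
  obtain ⟨C, η, hC, hη0, hη1, hK⟩ := exists_kernel_bound ha hγ hρ
  have hI := lintegral_abs_rpow_lt_top (r := -1 + η) (by linarith)
  set I := ∫⁻ z in Set.Ioc (-1 : ℝ) 1, ENNReal.ofReal (|z| ^ (-1 + η)) with hIdef
  refine ⟨2 * (ENNReal.ofReal (2 * C) * I), ENNReal.mul_ne_top (by norm_num)
    (ENNReal.mul_ne_top ENNReal.ofReal_ne_top hI.ne), fun l n t g hl ht ht0 hgm hg => ?_⟩
  have hl0 : 0 < l := by linarith
  have hem : Measurable (Function.uncurry fun x ξ => propagator a γ (t x) x ξ) := by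
    have h1 : Measurable fun z : ℝ × ℝ => t z.1 := ht.comp measurable_fst
    unfold propagator
    simp only [Function.uncurry_def]
    fun_prop
  have hfin : IsFiniteMeasure (volume.restrict (Set.Ioc n (n + 1))) := ⟨by simp⟩
  refine (lintegral_sq_integral_le_of_kernel
    (μ := volume.restrict (Set.Ioc n (n + 1))) (ν := volume.restrict (annulus l))
    (e := fun x ξ => propagator a γ (t x) x ξ)
    (k := fun x y => ENNReal.ofReal (2 * C) * ENNReal.ofReal (l ^ (2 * ρ)) *
      ENNReal.ofReal (|x - y| ^ (-1 + η)))
    (A := ENNReal.ofReal (2 * C) * ENNReal.ofReal (l ^ (2 * ρ)) * I)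
    hem (fun x ξ => norm_propagator_le (ht0 x).le) ?_ ?_ ?_ ?_ hgm hg).trans_eq ?_
  · simp only [Function.uncurry_def]
    fun_prop
  · intro x y
    rw [abs_sub_comm]
  · filter_upwards [ae_restrict_mem measurableSet_Ioc] with x hx
    have hne : ∀ᵐ y ∂(volume.restrict (Set.Ioc n (n + 1))), y ≠ x :=
      ae_restrict_of_ae (Measure.ae_ne volume x)
    filter_upwards [ae_restrict_mem measurableSet_Ioc, hne] with y hy hyx
    rw [integral_annulus_propagator_mul_conj ha hl0]
    have hr : x - y ≠ 0 := sub_ne_zero.mpr hyx.symm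
    have hr1 : |x - y| ≤ 1 := abs_le.mpr ⟨by linarith [hx.1, hy.2], by linarith [hx.2, hy.1]⟩
    have hq := abs_sub_rpow_le (γ := γ) (by linarith) (ht0 x).le (ht0 y).le
    have k1 := hK l (x - y) (t x - t y) _ hl hr hr1 hq
    have k2 := hK l (-(x - y)) (t x - t y) _ hl (neg_ne_zero.mpr hr) (by rwa [abs_neg]) hq
    rw [abs_neg] at k2
    rw [← ENNReal.ofReal_mul (by positivity), ← ENNReal.ofReal_mul (by positivity), ← ofReal_norm]
    apply ENNReal.ofReal_le_ofReal
    refine (norm_add_le _ _).trans ?_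
    linarith
  · filter_upwards [ae_restrict_mem measurableSet_Ioc] with x hx
    rw [lintegral_const_mul' _ _ (by finiteness)]
    gcongr
    exact lintegral_Ioc_abs_sub_le hx fun z => ENNReal.ofReal (|z| ^ (-1 + η))
  · ring

/-- Measurable selection of the maximiser among finitely many times. -/
lemma exists_measurable_argmax (q : ℕ → ℝ) (V : ℝ → ℝ → ℝ≥0∞)
    (hV : ∀ t : ℝ → ℝ, Measurable t → Measurable fun x => V (t x) x) (P : ℝ → Prop)
    (hq : ∀ j, P (q j)) :
    ∃ t : ℕ → ℝ → ℝ, (∀ J, Measurable (t J)) ∧ (∀ J x, P (t J x)) ∧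
      (∀ J x, V (q J) x ≤ V (t J x) x) ∧ ∀ x, Monotone fun J => V (t J x) x := by
  classical
  let t : ℕ → ℝ → ℝ := fun J => Nat.rec (fun _ => q 0)
    (fun J s x => if V (s x) x ≤ V (q (J + 1)) x then q (J + 1) else s x) J
  have h0 : ∀ x, t 0 x = q 0 := fun x => rfl
  have hs : ∀ J x, t (J + 1) x = if V (t J x) x ≤ V (q (J + 1)) x then q (J + 1) else t J x :=
    fun J x => rfl
  have hm : ∀ J, Measurable (t J) := by
    intro J
    induction J with
    | zero => exact measurable_const
    | succ J ih =>
      refine Measurable.ite ?_ measurable_const ih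
      exact measurableSet_le (hV _ ih) (hV (fun _ => q (J + 1)) measurable_const)
  refine ⟨t, hm, ?_, ?_, ?_⟩
  · intro J x
    induction J with
    | zero => exact hq 0
    | succ J ih => rw [hs]; split_ifs; exacts [hq _, ih]
  · intro J x
    cases J with
    | zero => exact le_rfl
    | succ J =>
      rw [hs]; split_ifs with h
      · exact le_rfl
      · exact (not_le.mp h).le
  · intro x
    refine monotone_nat_of_le_succ fun J => ?_
    simp only [hs]
    split_ifs with h
    · exact h
    · exact le_rfl

lemma continuous_propagator_time {a γ : ℝ} (hγ : 0 ≤ γ) (x ξ : ℝ) :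
    Continuous (fun t => propagator a γ t x ξ) := by
  have h : Continuous fun t : ℝ => ((t ^ γ : ℝ) : ℂ) :=
    Complex.continuous_ofReal.comp (Real.continuous_rpow_const hγ)
  unfold propagator
  simp only [Complex.ofReal_mul]
  fun_prop

/-- The maximal estimate for functions with frequencies in a dyadic annulus. -/
theorem exists_maximal_bound {a γ ρ : ℝ} (ha : 0 < a) (hγ : 1 < γ)
    (hρ : AboveThreshold a γ ρ) : ∃ C : ℝ≥0∞, C ≠ ⊤ ∧ ∀ (l : ℝ) (g : ℝ → ℂ), 1 ≤ l →
      Measurable g → MemLp g 2 (volume.restrict (annulus l)) →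
      ∃ M : ℝ → ℝ≥0∞, Measurable M ∧
        (∀ x t, 0 < t → ‖∫ ξ in annulus l, g ξ * propagator a γ t x ξ‖ₑ ≤ M x) ∧
        ∀ n : ℝ, ∫⁻ x in Set.Ioc n (n + 1), M x ^ 2
          ≤ C * ENNReal.ofReal (l ^ (2 * ρ)) * ∫⁻ ξ in annulus l, ‖g ξ‖ₑ ^ 2 := by
  obtain ⟨C, hC, hbound⟩ := exists_linearized_maximal_bound ha hγ hρ
  refine ⟨C, hC, fun l g hl hgm hg => ?_⟩
  have hgi : IntegrableOn g (annulus l) := hg.integrable (by norm_num)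
  have : Nonempty (Set.Ioi (0 : ℝ)) := ⟨⟨1, by simp⟩⟩
  set d : ℕ → Set.Ioi (0 : ℝ) := TopologicalSpace.denseSeq _ with hd
  set V : ℝ → ℝ → ℝ≥0∞ := fun t x => ‖∫ ξ in annulus l, g ξ * propagator a γ t x ξ‖ₑ with hVdef
  have hV : ∀ t : ℝ → ℝ, Measurable t → Measurable fun x => V (t x) x := by
    intro t ht
    have hem : Measurable (Function.uncurry fun x ξ => g ξ * propagator a γ (t x) x ξ) := by
      have h1 : Measurable fun z : ℝ × ℝ => t z.1 := ht.comp measurable_fst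
      unfold propagator
      simp only [Function.uncurry_def]
      fun_prop
    exact (hem.stronglyMeasurable.integral_prod_right
      (ν := volume.restrict (annulus l))).measurable.enorm
  obtain ⟨t, htm, ht0, htq, htmono⟩ := exists_measurable_argmax (fun j => (d j : ℝ)) V hV
    (fun r => 0 < r) (fun j => (d j).2)
  have hcont : ∀ x, Continuous fun s : Set.Ioi (0 : ℝ) => V s x := by
    intro x
    refine Continuous.enorm ?_
    refine continuous_of_dominated (bound := fun ξ => ‖g ξ‖) (fun s => ?_) (fun s => ?_)
      hgi.norm (ae_of_all _ fun ξ => ?_)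
    · exact (hgm.aestronglyMeasurable).mul
        (continuous_propagator_freq ha γ s x).aestronglyMeasurable
    · refine ae_of_all _ fun ξ => ?_
      rw [norm_mul]
      exact mul_le_of_le_one_right (norm_nonneg _) (norm_propagator_le s.2.le)
    · exact continuous_const.mul
        ((continuous_propagator_time (by linarith) x ξ).comp continuous_subtype_val)
  refine ⟨fun x => ⨆ J, V (t J x) x, Measurable.iSup fun J => hV _ (htm J), fun x s hs => ?_,
    fun n => ?_⟩
  -- The supremum controls a dense set of times, hence all times by continuity in time.
  · have hclosed : IsClosed {s : Set.Ioi (0 : ℝ) | V s x ≤ ⨆ J, V (t J x) x} :=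
      isClosed_le (hcont x) continuous_const
    have := (TopologicalSpace.denseRange_denseSeq (Set.Ioi (0 : ℝ))).induction_on
      (p := fun s => V s x ≤ ⨆ J, V (t J x) x) ⟨s, hs⟩ hclosed
      fun J => (htq J x).trans (le_iSup (fun J => V (t J x) x) J)
    exact this
  -- The finite maxima increase with `J`, so monotone convergence transfers the linearised bound,
  -- whose constant does not depend on the choice of times.
  · simp_rw [ENNReal.iSup_pow]
    rw [lintegral_iSup (fun J => (hV _ (htm J)).pow_const 2)
      (fun i j hij x => by have := htmono x hij; dsimp only at this ⊢; gcongr)]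
    exact iSup_le fun J => hbound l n (t J) g hl (htm J) (ht0 J) hgm hg

/-! ### Dyadic summation and almost everywhere convergence. -/

lemma IsFourierTransform.congr_right {f g g' : ℝ → ℂ} (h : IsFourierTransform f g)
    (hg : g =ᵐ[volume] g') : IsFourierTransform f g' := by
  have hφ : ∀ φ : 𝓢(ℝ, ℂ), (fun ξ => g ξ * φ ξ) =ᵐ[volume] fun ξ => g' ξ * φ ξ := fun φ =>
    hg.mono fun ξ hξ => by simp only [hξ]
  exact ⟨fun φ => (h.1 φ).congr (hφ φ), fun φ => (integral_congr_ae (hφ φ)).symm.trans (h.2 φ)⟩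

/-- The damping alone is square integrable for `t > 0`. Paired with `f̂ ∈ L²`, it makes the defining
integral absolutely convergent. -/
lemma memLp_two_propagator {a γ t : ℝ} (ha : 0 < a) (ht : 0 < t) (x : ℝ) :
    MemLp (propagator a γ t x) 2 := by
  have hc := continuous_propagator_freq ha γ t x
  rw [memLp_two_iff_integrable_sq_norm hc.aestronglyMeasurable]
  have hb : 0 < 2 * t ^ γ := by positivity
  have h0 : IntegrableOn (fun ξ : ℝ => Real.exp (-(2 * t ^ γ) * ξ ^ a)) (Set.Ioi 0) := by
    simpa using integrableOn_rpow_mul_exp_neg_mul_rpow (s := 0) (by norm_num) ha hb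
  have h1 : IntegrableOn (fun ξ : ℝ => ‖propagator a γ t x ξ‖ ^ 2) (Set.Ioi 0) := by
    refine h0.congr_fun (fun ξ hξ => ?_) measurableSet_Ioi
    simp only [norm_propagator]
    rw [← Real.exp_nat_mul, abs_of_pos hξ]
    congr 1
    push_cast
    ring
  have h2 : IntegrableOn (fun ξ : ℝ => ‖propagator a γ t x ξ‖ ^ 2) (Set.Iic 0) := by
    rw [integrableOn_Iic_iff_integrableOn_Iio]
    rw [← (Measure.measurePreserving_neg (volume : Measure ℝ)).integrableOn_comp_preimage
      (Homeomorph.neg ℝ).measurableEmbedding]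
    simpa only [Function.comp_def, norm_propagator, abs_neg, Set.neg_preimage, Set.neg_Iio,
      neg_zero] using h1
  rw [← integrableOn_univ, ← Set.Iic_union_Ioi (a := (0 : ℝ))]
  exact h2.union h1

/-- The frequencies `|ξ| < 1` for `k = 0`, and the annulus `2^(k-1) ≤ |ξ| < 2^k` otherwise. -/
def dyadicBlock (k : ℕ) : Set ℝ := disjointed (fun N : ℕ => Metric.ball (0 : ℝ) (2 ^ N)) k

lemma monotone_ball_two_pow : Monotone fun N : ℕ => Metric.ball (0 : ℝ) (2 ^ N) := fun _ _ hij =>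
  Metric.ball_subset_ball (pow_le_pow_right₀ one_le_two hij)

lemma dyadicBlock_succ (k : ℕ) : dyadicBlock (k + 1) = annulus (2 ^ k) := by
  rw [dyadicBlock, monotone_ball_two_pow.disjointed_add_one]
  ext ξ
  simp only [annulus, Set.mem_sdiff, mem_ball_zero_iff, Real.norm_eq_abs, not_lt,
    Set.mem_ofPred_eq, pow_succ']
  exact and_comm

lemma measurableSet_dyadicBlock (k : ℕ) : MeasurableSet (dyadicBlock k) :=
  MeasurableSet.disjointed (fun _ => measurableSet_ball) k

lemma isBounded_dyadicBlock (k : ℕ) : Bornology.IsBounded (dyadicBlock k) :=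
  Metric.isBounded_ball.subset (disjointed_subset _ k)

lemma pairwise_disjoint_dyadicBlock : Pairwise (Function.onFun Disjoint dyadicBlock) :=
  disjoint_disjointed _

lemma iUnion_dyadicBlock : ⋃ k, dyadicBlock k = Set.univ := by
  simp only [dyadicBlock, iUnion_disjointed]
  refine Set.eq_univ_of_forall fun ξ => Set.mem_iUnion.mpr ?_
  obtain ⟨n, hn⟩ := pow_unbounded_of_one_lt |ξ| one_lt_two
  exact ⟨n, by simpa using hn⟩

lemma sum_setIntegral_dyadicBlock {F : ℝ → ℂ} (hF : ∀ k, IntegrableOn F (dyadicBlock k)) (N : ℕ) :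
    ∑ k ∈ Finset.range (N + 1), ∫ ξ in dyadicBlock k, F ξ = ∫ ξ in Metric.ball 0 (2 ^ N), F ξ := by
  rw [← integral_biUnion_finset _ (fun k _ => measurableSet_dyadicBlock k)
    (fun i _ j _ hij => pairwise_disjoint_dyadicBlock hij) (fun k _ => hF k)]
  have h : ⋃ k ∈ Finset.range (N + 1), dyadicBlock k = partialSups
      (fun N : ℕ => Metric.ball (0 : ℝ) (2 ^ N)) N := by
    simpa only [dyadicBlock, Finset.mem_range] using biUnion_range_succ_disjointed _ N
  rw [h, monotone_ball_two_pow.partialSups_eq]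

/-- Summability of maximal functions with geometrically decaying local `L²` norms. -/
lemma ae_tsum_lt_top_of_lintegral_sq_le {M : ℕ → ℝ → ℝ≥0∞} (hM : ∀ k, Measurable (M k))
    {K : ℝ≥0∞} (hK : K ≠ ⊤) {θ : ℝ≥0∞} (hθ : θ < 1)
    (h : ∀ (k : ℕ) (n : ℝ), ∫⁻ x in Set.Ioc n (n + 1), M k x ^ 2 ≤ K * (θ ^ k) ^ 2) :
    ∀ᵐ x : ℝ, ∑' k, M k x < ⊤ := by
  have hloc : ∀ n : ℤ, ∀ᵐ x ∂(volume.restrict (Set.Ioc (n : ℝ) (n + 1))), ∑' k, M k x < ⊤ := by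
    intro n
    have h1 : ∀ k, ∫⁻ x in Set.Ioc (n : ℝ) (n + 1), M k x ≤ (K + 1) * θ ^ k := by
      intro k
      rw [← ENNReal.pow_le_pow_left_iff two_ne_zero]
      have := sq_lintegral_mul_le (ν := volume.restrict (Set.Ioc (n : ℝ) (n + 1)))
        (hM k).aemeasurable (v := fun _ => 1) aemeasurable_const
      simp only [mul_one, one_pow, lintegral_const, Measure.restrict_apply_univ, Real.volume_Ioc,
        add_sub_cancel_left, ENNReal.ofReal_one] at this
      refine this.trans ((h k n).trans ?_)
      rw [mul_pow]
      gcongr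
      -- `K + 1` serves as a convenient upper bound for `√K`.
      calc K ≤ K + 1 := le_self_add
        _ ≤ (K + 1) ^ 2 := le_self_pow₀ le_add_self two_ne_zero
    refine ae_lt_top (Measurable.tsum hM) ?_
    rw [lintegral_tsum fun k => (hM k).aemeasurable]
    refine ne_top_of_le_ne_top ?_ (ENNReal.tsum_le_tsum h1)
    rw [ENNReal.tsum_mul_left, ENNReal.tsum_geometric]
    refine ENNReal.mul_ne_top (by finiteness) (ENNReal.inv_ne_top.mpr ?_)
    exact (tsub_pos_of_lt hθ).ne'
  have := (ae_restrict_iUnion_iff (fun n : ℤ => Set.Ioc (n : ℝ) (n + 1)) _).mpr hloc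
  rwa [iUnion_Ioc_intCast, Measure.restrict_univ] at this

lemma tendsto_setIntegral_propagator {a γ : ℝ} (ha : 0 < a) (hγ : 0 < γ) {g : ℝ → ℂ} {E : Set ℝ}
    (hg : IntegrableOn g E) (x : ℝ) :
    Tendsto (fun t => ∫ ξ in E, g ξ * propagator a γ t x ξ) (𝓝[>] 0)
      (𝓝 (∫ ξ in E, g ξ * Complex.exp (Complex.I * x * ξ))) := by
  refine tendsto_integral_filter_of_dominated_convergence (fun ξ => ‖g ξ‖) ?_ ?_ hg.norm ?_
  · exact Eventually.of_forall fun t => hg.aestronglyMeasurable.mul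
      (continuous_propagator_freq ha γ t x).aestronglyMeasurable
  · filter_upwards [self_mem_nhdsWithin] with t ht
    refine ae_of_all _ fun ξ => ?_
    rw [norm_mul]
    exact mul_le_of_le_one_right (norm_nonneg _) (norm_propagator_le (le_of_lt ht))
  · refine ae_of_all _ fun ξ => Tendsto.const_mul _ ?_
    have := (continuous_propagator_time (a := a) hγ.le x ξ).tendsto 0
    simp only [propagator, Real.zero_rpow hγ.ne'] at this
    simp only [Complex.ofReal_zero, mul_zero, zero_mul, neg_zero, Complex.exp_zero, mul_one] at this
    exact this.mono_left nhdsWithin_le_nhds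

/-- Each block converges as `t → 0+`, and a summable bound uniform in `t` allows the limit to pass
through the sum over blocks. The partial sums of the limiting series are the inverse Fourier
integrals over balls, so both limits coincide. -/
lemma tendsto_integral_propagator {a γ : ℝ} (ha : 0 < a) (hγ : 0 < γ) {g : ℝ → ℂ} (hg : MemLp g 2)
    {x : ℝ} {b : ℕ → ℝ} (hb : Summable b)
    (hbound : ∀ k t, 0 < t → ‖∫ ξ in dyadicBlock k, g ξ * propagator a γ t x ξ‖ ≤ b k) :
    ∃ L : ℂ, Tendsto (fun t => ∫ ξ, g ξ * propagator a γ t x ξ) (𝓝[>] 0) (𝓝 L) ∧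
      Tendsto (fun N : ℕ => ∫ ξ in Metric.ball 0 (2 ^ N), g ξ * Complex.exp (Complex.I * x * ξ))
        atTop (𝓝 L) := by
  have hgi : ∀ k, IntegrableOn g (dyadicBlock k) := fun k => by
    have : IsFiniteMeasure (volume.restrict (dyadicBlock k)) :=
      ⟨by simpa using (isBounded_dyadicBlock k).measure_lt_top⟩
    exact (hg.restrict _).integrable (by norm_num)
  set c : ℕ → ℂ := fun k => ∫ ξ in dyadicBlock k, g ξ * Complex.exp (Complex.I * x * ξ) with hc
  have hlim : ∀ k, Tendsto (fun t => ∫ ξ in dyadicBlock k, g ξ * propagator a γ t x ξ) (𝓝[>] 0)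
      (𝓝 (c k)) := fun k => tendsto_setIntegral_propagator ha hγ (hgi k) x
  have hev : ∀ᶠ t in 𝓝[>] (0 : ℝ), 0 < t := self_mem_nhdsWithin
  have hcb : ∀ k, ‖c k‖ ≤ b k := fun k =>
    le_of_tendsto (hlim k).norm (hev.mono fun t ht => hbound k t ht)
  have hcs : Summable c := Summable.of_norm_bounded hb hcb
  refine ⟨∑' k, c k, ?_, ?_⟩
  · refine (tendsto_tsum_of_dominated_convergence hb hlim
      (hev.mono fun t ht k => hbound k t ht)).congr' ?_
    filter_upwards [hev] with t ht
    have hint : Integrable fun ξ => g ξ * propagator a γ t x ξ :=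
      hg.integrable_mul (memLp_two_propagator ha ht x)
    have := hasSum_integral_iUnion measurableSet_dyadicBlock pairwise_disjoint_dyadicBlock
      (f := fun ξ => g ξ * propagator a γ t x ξ) (μ := volume) hint.integrableOn
    rw [iUnion_dyadicBlock, setIntegral_univ] at this
    exact this.tsum_eq
  · refine ((tendsto_add_atTop_iff_nat 1).mpr hcs.hasSum.tendsto_sum_nat).congr fun N => ?_
    refine sum_setIntegral_dyadicBlock (fun k => ?_) N
    refine (hgi k).mul_bdd (c := 1) (by fun_prop) (ae_of_all _ fun ξ => ?_)
    simp [Complex.norm_exp]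

theorem ae_tendsto_of_lintegral_annulus_le {a γ ρ σ B : ℝ} (ha : 0 < a) (hγ : 1 < γ)
    (hρ : AboveThreshold a γ ρ) (hσ : ρ < σ) (hB : 0 ≤ B) {f g : ℝ → ℂ} (hf : MemLp f 2)
    (hF : IsFourierTransform f g) (hgm : Measurable g)
    (hband : ∀ l : ℝ, 0 < l →
      ∫⁻ ξ in annulus l, ‖g ξ‖ₑ ^ 2 ≤ ENNReal.ofReal (B * l ^ (-(2 * σ)))) :
    ∀ᵐ x : ℝ, Tendsto (fun t : ℝ => (1 / (2 * π : ℂ)) * ∫ ξ, g ξ * propagator a γ t x ξ)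
      (𝓝[>] 0) (𝓝 (f x)) := by
  have hg : MemLp g 2 := hF.memLp hf
  obtain ⟨C, hC, hmax⟩ := exists_maximal_bound ha hγ hρ
  have hone : ∀ k : ℕ, (1 : ℝ) ≤ 2 ^ k := fun k => one_le_pow₀ one_le_two
  choose M hMm hMle hMsq using fun k : ℕ => hmax (2 ^ k) g (hone k) hgm (hg.restrict _)
  have hsum : ∀ᵐ x : ℝ, ∑' k, M k x < ⊤ := by
    -- At `l = 2^k` the maximal estimate costs `2^(2ρk)` and the band decay gains `2^(-2σk)`, which
    -- leaves the ratio `2^(ρ-σ) < 1`.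
    refine ae_tsum_lt_top_of_lintegral_sq_le hMm (K := C * ENNReal.ofReal B)
      (θ := ENNReal.ofReal (2 ^ (ρ - σ))) (ENNReal.mul_ne_top hC ENNReal.ofReal_ne_top) ?_ ?_
    · rw [ENNReal.ofReal_lt_one]
      exact Real.rpow_lt_one_of_one_lt_of_neg one_lt_two (by linarith)
    · intro k n
      refine (hMsq k n).trans ((mul_le_mul_right (hband _ (by positivity)) _).trans_eq ?_)
      rw [ENNReal.ofReal_mul hB, mul_assoc, mul_assoc, mul_left_comm (ENNReal.ofReal _),
        ← ENNReal.ofReal_mul (by positivity), ← ENNReal.ofReal_pow (by positivity),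
        ← ENNReal.ofReal_pow (by positivity)]
      congr 3
      rw [← Real.rpow_add (by positivity), ← Real.rpow_natCast 2 k, ← Real.rpow_mul (by norm_num),
        ← Real.rpow_natCast _ k, ← Real.rpow_mul (by norm_num), ← Real.rpow_natCast _ 2,
        ← Real.rpow_mul (by norm_num)]
      congr 1
      push_cast
      ring
  have hinv := tendsto_truncInv hf hF (E := fun N : ℕ => Metric.ball (0 : ℝ) (2 ^ N))
    (fun _ => measurableSet_ball) (fun _ => Metric.isBounded_ball) fun x => by
      filter_upwards [(tendsto_pow_atTop_atTop_of_one_lt one_lt_two).eventually_gt_atTop |x|]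
        with N hN
      simpa using hN
  have htm : ∀ N : ℕ, AEStronglyMeasurable (truncInv (Metric.ball (0 : ℝ) (2 ^ N)) g) := by
    intro N
    have hem : Measurable (Function.uncurry fun x ξ : ℝ => g ξ * Complex.exp (Complex.I * x * ξ)) := by
      simp only [Function.uncurry_def]
      fun_prop
    exact ((hem.stronglyMeasurable.integral_prod_right
      (ν := volume.restrict (Metric.ball (0 : ℝ) (2 ^ N)))).const_mul _).aestronglyMeasurable
  obtain ⟨ns, hns, hae⟩ := (tendstoInMeasure_of_tendsto_eLpNorm (by norm_num) htm
    hf.aestronglyMeasurable hinv).exists_seq_tendsto_ae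
  filter_upwards [hsum, hae] with x hx hxf
  -- The low frequencies `|ξ| < 1` need no maximal estimate, only `g ∈ L¹` there; block `j + 1` is
  -- the annulus at `2^j`.
  set b : ℕ → ℝ := fun k => Nat.casesOn k (∫ ξ in dyadicBlock 0, ‖g ξ‖) fun j => (M j x).toReal
    with hbdef
  have hb : Summable b := by
    rw [← summable_nat_add_iff 1]
    exact ENNReal.summable_toReal hx.ne
  have hbound : ∀ k t, 0 < t → ‖∫ ξ in dyadicBlock k, g ξ * propagator a γ t x ξ‖ ≤ b k := by
    intro k t ht
    cases k with
    | zero =>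
      have : IsFiniteMeasure (volume.restrict (dyadicBlock 0)) :=
        ⟨by simpa using (isBounded_dyadicBlock 0).measure_lt_top⟩
      refine norm_integral_le_of_norm_le ((hg.restrict _).integrable (by norm_num)).norm
        (ae_of_all _ fun ξ => ?_)
      rw [norm_mul]
      exact mul_le_of_le_one_right (norm_nonneg _) (norm_propagator_le ht.le)
    | succ j =>
      have h1 := hMle j x t ht
      rw [dyadicBlock_succ, ← toReal_enorm]
      exact ENNReal.toReal_mono (ENNReal.ne_top_of_tsum_ne_top hx.ne j) h1
  obtain ⟨L, hL, hL'⟩ := tendsto_integral_propagator ha (by linarith) hg hb hbound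
  have hlim : Tendsto (fun i => truncInv (Metric.ball (0 : ℝ) (2 ^ ns i)) g x) atTop
      (𝓝 ((1 / (2 * π : ℂ)) * L)) :=
    (hL'.comp hns.tendsto_atTop).const_mul _
  -- The full sequence of truncations converges at `x`, so the almost everywhere convergent
  -- subsequence identifies its limit as `f x`.
  rw [tendsto_nhds_unique hxf hlim]
  exact hL.const_mul _

/-! ### Thresholds and the theorem. -/

/-- `r` is the critical `L²` regularity. For `a = 1` it is `(1 - 1/γ)/2`, since `1/p - 1/(2γ) = (1/p
- 1/2) + (1 - 1/γ)/2`. The total stays below `1` because `1/p - 1/2 < 1/2` and `r ≤ 1/2`, so at most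
one derivative of `f` is ever used. -/
lemma exists_threshold {s a γ p : ℝ} (hγ : 1 < γ) (hp : 1 < p)
    (h : (0 < a ∧ a < 1 ∧ (2 - p) / (2 * p) + a * (1 - 1 / γ) / 4 < s) ∨
      (a = 1 ∧ 1 / p - 1 / (2 * γ) < s) ∨
      (1 < a ∧ (2 - p) / (2 * p) + min (a * (1 - 1 / γ) / 4) (1 / 4) < s)) :
    0 < a ∧ ∃ r : ℝ, 0 ≤ r ∧ (2 - p) / (2 * p) + r < s ∧ (2 - p) / (2 * p) + r < 1 ∧
      ∀ ρ, r < ρ → AboveThreshold a γ ρ := by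
  have hd : (2 - p) / (2 * p) = 1 / p - 1 / 2 := by field_simp
  have hp1 : 1 / p < 1 := by rw [div_lt_one (by linarith)]; exact hp
  have hγ0 : 0 < 1 / γ := by positivity
  have hγ1 : 1 / γ < 1 := by rw [div_lt_one (by linarith)]; exact hγ
  have hγ2 : 1 / (2 * γ) = 1 / γ / 2 := by field_simp
  rw [hd] at h ⊢
  rcases h with ⟨h0, h1, h2⟩ | ⟨h1, h2⟩ | ⟨h1, h2⟩
  · refine ⟨h0, a * (1 - 1 / γ) / 4, ?_, h2, ?_, fun ρ hρ => Or.inl ⟨h1.ne, hρ⟩⟩ <;> nlinarith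
  · refine ⟨by linarith, (1 - 1 / γ) / 2, ?_, ?_, ?_, fun ρ hρ => Or.inr (Or.inl ⟨h1, hρ⟩)⟩ <;>
      linarith
  · have hmin : min (a * (1 - 1 / γ) / 4) (1 / 4) ≤ 1 / 4 := min_le_right _ _
    refine ⟨by linarith, min (a * (1 - 1 / γ) / 4) (1 / 4), le_min ?_ (by norm_num), h2,
      by linarith, fun ρ hρ => ?_⟩
    · have : 0 ≤ a * (1 - 1 / γ) := mul_nonneg (by linarith) (by linarith)
      linarith
    rcases min_lt_iff.mp hρ with h | h
    · exact Or.inl ⟨h1.ne', h⟩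
    · exact Or.inr (Or.inr ⟨h1, h⟩)

/-- If `s > 1/p - 1/2 + r`, then `W^{s,p} ⊂ L²`, and the `L²` norm of the Fourier transform over the
annulus at `l` decays like a power of `l` of order larger than `r`. -/
lemma MemW.exists_band_decay {s p r : ℝ} (hs : 0 < s) (hp : 1 < p) (hp2 : p ≤ 2) (hr : 0 ≤ r)
    (hrs : (2 - p) / (2 * p) + r < s) (hr1 : (2 - p) / (2 * p) + r < 1) {f : ℝ → ℂ}
    (hf : MemW s p f) :
    MemLp f 2 ∧ ∃ σ B : ℝ, r < σ ∧ 0 ≤ B ∧ ∀ g, IsFourierTransform f g → ∀ l, 0 < l →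
      ∫⁻ ξ in annulus l, ‖g ξ‖ₑ ^ 2 ≤ ENNReal.ofReal (B * l ^ (-(2 * σ))) := by
  obtain ⟨u, σ, C, hfu, hum, hu, hσ, hC, hG⟩ := hf.exists_averagedModulus hs hp.le hrs hr1
  have hu2 : MemLp u 2 := memLp_two_of_averagedModulus hp.le hp2 hC hum hu hG (by linarith)
  have hf2 : MemLp f 2 := hu2.ae_eq hfu.symm
  have hF := (isFourierTransform_fourierHat hf2).congr_left hfu
  obtain ⟨B, hB, hband⟩ := exists_band_bound hp.le hp2 hC hum hu hG hu2 hF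
  refine ⟨hf2, σ - (2 - p) / (2 * p), B, by linarith, hB, fun g hg l hl => ?_⟩
  have hae : g =ᵐ[volume] fourierHat f := hg.ae_eq (isFourierTransform_fourierHat hf2)
  refine le_trans ?_ (hband l hl)
  rw [lintegral_congr_ae (ae_restrict_of_ae (hae.mono fun ξ hξ => by rw [hξ]))]
  exact lintegral_mono_set fun ξ hξ => ⟨hξ.1, hξ.2.le⟩

end LandauSchrodinger

end

theorem theorem1p2 (s a γ p : ℝ) (hs : 0 < s) (hγ : 1 < γ) (hp : 1 < p) (hp2 : p ≤ 2)
    (h : (0 < a ∧ a < 1 ∧ (2 - p) / (2 * p) + a * (1 - 1 / γ) / 4 < s) ∨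
      (a = 1 ∧ 1 / p - 1 / (2 * γ) < s) ∨
      (1 < a ∧ (2 - p) / (2 * p) + min (a * (1 - 1 / γ) / 4) (1 / 4) < s))
    (f : ℝ → ℂ) (hf : LandauSchrodinger.MemW s p f) :
    LandauSchrodinger.IsFourierTransform f (LandauSchrodinger.fourierHat f) ∧
    (∀ t : ℝ, 0 < t → ∀ x : ℝ, Integrable (LandauSchrodinger.landauIntegrand a γ f t x)) ∧
    ∀ᵐ x : ℝ, Tendsto (fun t : ℝ => LandauSchrodinger.landauOp a γ t f x)
      (𝓝[>] (0 : ℝ)) (𝓝 (f x)) := by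
  open LandauSchrodinger in
  obtain ⟨ha, r, hr, hrs, hr1, hthr⟩ := exists_threshold hγ hp h
  obtain ⟨hf2, σ, B, hσ, hB, hband⟩ := hf.exists_band_decay hs hp hp2 hr hrs hr1
  have hF := isFourierTransform_fourierHat hf2
  have hg : MemLp (fourierHat f) 2 := hF.memLp hf2
  refine ⟨hF, fun t ht x => ?_, ?_⟩
  · rw [show landauIntegrand a γ f t x = fun ξ => fourierHat f ξ * propagator a γ t x ξ from
      funext fun ξ => landauIntegrand_eq a γ f t x ξ]
    exact hg.integrable_mul (memLp_two_propagator ha ht x)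
  -- The maximal estimate needs a Borel function; the transform changes only on a null set, which no
  -- integral sees.
  · set g := hg.aestronglyMeasurable.mk _
    have hae : fourierHat f =ᵐ[volume] g := hg.aestronglyMeasurable.ae_eq_mk
    have hFg : IsFourierTransform f g := hF.congr_right hae
    obtain ⟨ρ, hρ1, hρ2⟩ := exists_between hσ
    filter_upwards [ae_tendsto_of_lintegral_annulus_le ha hγ (hthr ρ hρ1) hρ2 hB hf2 hFg
      hg.aestronglyMeasurable.stronglyMeasurable_mk.measurable (hband g hFg)] with x hx
    refine hx.congr fun t => ?_
    rw [landauOp]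
    congr 1
    refine integral_congr_ae (hae.mono fun ξ hξ => ?_)
    simp only [landauIntegrand_eq, hξ]
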